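/- Let $\mathbb{K}=\mathbb{R}$ or $\mathbb{C}$, let $n\ge 3$, and let $r_1,\dots,r_n\in\mathbb{K}$ be pairwise distinct. Write $\langle v,w\rangle=\sum_i v^iw^i$. For $u=(u^1,\dots,u^{n-1})$ put $\Delta=1+\langle u,u\rangle$ and $$s^j=\frac{2u^j}{1+\langle u,u\rangle}\quad(1\le j\le n-1),\qquad s^n=\frac{1-\langle u,u\rangle}{1+\langle u,u\rangle}.$$ Consider the evolution system $$\begin{aligned}u_t={}&u_{xxx}-6\langle u,u_x\rangle\Delta^{-1}u_{xx}+\bigl(-6\langle u,u_{xx}\rangle\Delta^{-1}+24\langle u,u_x\rangle^2\Delta^{-2}-6\langle u,u\rangle\langle u_x,u_x\rangle\Delta^{-2}\bigr)u_x\\&+\bigl(6\langle u_x,u_{xx}\rangle\Delta^{-1}-12\langle u,u_x\rangle\langle u_x,u_x\rangle\Delta^{-2}\bigr)u+\tfrac32\Bigl(r_n+4\Delta^{-2}\sum_{i=1}^{n-1}(r_i-r_n)(u^i)^2\Bigr)u_x,\end{aligned}$$ and denote the $i$-th component of its right-hand side by $F^i$. Regard $u^i_k=\partial^k u^i/\partial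 x^k$ ($1\le i\le n-1$, $k\ge 0$, $u^i_0=u^i$) as coordinates on the infinite jet space $\mathcal{E}$, with the product topology, and let $$D_x=\sum_{i,k}u^i_{k+1}\frac{\partial}{\partial u^i_k},\qquad D_t=\sum_{i,k}D_x^k(F^i)\frac{\partial}{\partial u^i_k}.$$ Let $\mathfrak{L}$ be any Lie algebra over $\mathbb{K}$. Let $A=A(u^i)$ and $B=B(u^i,u^i_1,u^i_2)$ be either (a) smooth (for $\mathbb{K}=\mathbb{C}$: analytic) $\mathfrak{L}$-valued functions on a connected open subset $U$ of $\{\Delta\ne 0\}\subset\mathcal{E}$, that is, elements of $\mathfrak{L}\otimes_{\mathbb{K}}\mathcal{A}$, where $\mathcal{A}$ is the algebra of smooth (resp. analytic) $\mathbb{K}$-valued functions on $U$ of finitely many of the coordinates $u^i_k$; or (b) formal power series with coefficients in $\mathfrak{L}$ in the variables $u^i-a^i_0$ (for $A$) and $u^i_k-a^i_k$, $k\le 2$ (for $B$), for fixed $a^i_k\in\mathbb{K}$ with $1+\sum_i(a^i_0)^2\ne0$; here $F^i$ and $s^l$ are replaced by their Taylor series at $u^i_k=a^i_k$. Then $A$,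 $B$ satisfy $$D_x(B)-D_t(A)+[A,B]=0$$ if and only if there are $C_0,C_1,\dots,C_{n+1}\in\mathfrak{L}$ such that $$A=C_0+\sum_{l=1}^nC_ls^l,$$ $$\begin{aligned}B={}&D_x^2(A)+[D_x(A),A]+\frac32\sum_{i,k=1}^nC_ks^k\bigl(D_x(s^i)\bigr)^2+\frac12\sum_{i,k=1}^nr_iC_ks^k(s^i)^2\\&+\bigl([C_2,[C_2,C_1]]+r_2C_1\bigr)s^1+\sum_{j=2}^n\bigl([C_1,[C_1,C_j]]+r_1C_j\bigr)s^j+C_{n+1},\end{aligned}$$ and $$\begin{gathered}[C_0,C_k]=0\quad(1\le k\le n),\qquad [C_k,C_{n+1}]=0\quad(0\le k\le n),\\ [C_i,[C_j,C_k]]=0\quad(1\le i,j,k\le n\text{ pairwise distinct}),\\ [C_i,[C_i,C_k]]-[C_j,[C_j,C_k]]=(r_j-r_i)C_k\quad(1\le i,j,k\le n,\ i\ne k,\ j\ne k).\end{gathered}$$ -/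

import Mathlib

open scoped TensorProduct ContDiff

namespace LandauLifshitz

/-! ## Formulas valid over any commutative `𝕂`-algebra of functions of the jets

Throughout `n = m + 1`.  The vector `u` has the `m = n - 1` components `u^1, …, u^{n-1}` indexed by
`Fin m`, and `s`, `r`, `C` are indexed by `Fin (m + 1)`, the index `i ∈ {1, …, n}` being
the Lean index `i - 1`; `1` in `C 1` is thus the second index and `0` in `C 0` the first one. -/

section Formulas

variable {𝕂 R L M : Type*} [Field 𝕂] [CommRing R] [Algebra 𝕂 R] {m : ℕ}

/-- `⟨v, w⟩ = ∑ vⁱ wⁱ`. -/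
def pairing (v w : Fin m → R) : R := ∑ i, v i * w i

/-- `Δ = 1 + ⟨u, u⟩`. -/
def delta (u : Fin m → R) : R := 1 + pairing u u

/-- `Δ⁻¹`.  (`Δ` is a unit of the algebra `R` wherever this is used, see `isUnit_delta_smooth`
and `isUnit_delta_formal`.) -/
noncomputable def deltaInv (u : Fin m → R) : R := Ring.inverse (delta u)

/-- The functions `sʲ = 2 uʲ / (1 + ⟨u,u⟩)` for `j < n`, and `sⁿ = (1 - ⟨u,u⟩) / (1 + ⟨u,u⟩)`. -/
noncomputable def sphereCoord (u : Fin m → R) : Fin (m + 1) → R :=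
  Fin.snoc (α := fun _ => R) (fun j => 2 * u j * deltaInv u) ((1 - pairing u u) * deltaInv u)

/-- The `j`-th component of the right-hand side of the evolution system `u_t = F(u, u_x, u_xx,
u_xxx)`; here `u k i` stands for `∂ᵏuⁱ/∂xᵏ`. -/
noncomputable def rhs (r : Fin (m + 1) → 𝕂) (u : ℕ → Fin m → R) (j : Fin m) : R :=
  u 3 j
    - 6 * pairing (u 0) (u 1) * deltaInv (u 0) * u 2 j
    + (-6 * pairing (u 0) (u 2) * deltaInv (u 0)
        + 24 * pairing (u 0) (u 1) ^ 2 * deltaInv (u 0) ^ 2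
        - 6 * pairing (u 0) (u 0) * pairing (u 1) (u 1) * deltaInv (u 0) ^ 2) * u 1 j
    + (6 * pairing (u 1) (u 2) * deltaInv (u 0)
        - 12 * pairing (u 0) (u 1) * pairing (u 1) (u 1) * deltaInv (u 0) ^ 2) * u 0 j
    + (3 / 2 : 𝕂) • ((algebraMap 𝕂 R (r (Fin.last m))
        + 4 * deltaInv (u 0) ^ 2 *
          ∑ i : Fin m, algebraMap 𝕂 R (r i.castSucc - r (Fin.last m)) * u 0 i ^ 2) * u 1 j)

/-- The relations imposed on `C₀`, `C₁, …, Cₙ` (here `C`) and `Cₙ₊₁` (here `Cn1`). -/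
structure Relations [LieRing L] [LieAlgebra 𝕂 L]
    (r : Fin (m + 1) → 𝕂) (C0 : L) (C : Fin (m + 1) → L) (Cn1 : L) : Prop where
  comm_zero : ∀ k, ⁅C0, C k⁆ = 0
  triple : ∀ i j k, i ≠ j → j ≠ k → k ≠ i → ⁅C i, ⁅C j, C k⁆⁆ = 0
  double : ∀ i j k, i ≠ k → j ≠ k →
    ⁅C i, ⁅C i, C k⁆⁆ - ⁅C j, ⁅C j, C k⁆⁆ = (r j - r i) • C k
  comm_last_zero : ⁅C0, Cn1⁆ = 0
  comm_last : ∀ k, ⁅C k, Cn1⁆ = 0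

/-- `[C₂,[C₂,C₁]] + r₂C₁` for the first index, `[C₁,[C₁,Cⱼ]] + r₁Cⱼ` for the other indices `j`. -/
def linCoeff [LieRing L] [LieAlgebra 𝕂 L]
    (r : Fin (m + 1) → 𝕂) (C : Fin (m + 1) → L) (j : Fin (m + 1)) : L :=
  if j = 0 then ⁅C 1, ⁅C 1, C 0⁆⁆ + r 1 • C 0 else ⁅C 0, ⁅C 0, C j⁆⁆ + r 0 • C j

variable [AddCommGroup M] [Module 𝕂 M]

/-- `C₀ + ∑ C_l s^l`, where `mk f c` is the `L`-valued function (or series) `f · c`. -/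
def formA (mk : R → L → M) (s : Fin (m + 1) → R) (C0 : L) (C : Fin (m + 1) → L) : M :=
  mk 1 C0 + ∑ l, mk (s l) (C l)

/-- The explicit expression for `B` in terms of `A` and `C`.  The arguments are the product
`mk f c = f · c`, the bracket of `L`-valued functions, and the total derivative `D_x` on scalar
(`dR`) and on `L`-valued (`dM`) functions. -/
def formB [LieRing L] [LieAlgebra 𝕂 L] (mk : R → L → M) (br : M → M → M) (dR : R → R) (dM : M → M)
    (r : Fin (m + 1) → 𝕂) (s : Fin (m + 1) → R) (A : M) (C : Fin (m + 1) → L) (Cn1 : L) : M :=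
  dM (dM A) + br (dM A) A
    + (3 / 2 : 𝕂) • ∑ i, ∑ k, mk (s k * dR (s i) ^ 2) (C k)
    + (1 / 2 : 𝕂) • ∑ i, ∑ k, r i • mk (s k * s i ^ 2) (C k)
    + ∑ j, mk (s j) (linCoeff r C j)
    + mk 1 Cn1

end Formulas

/-! ## Smooth functions on open subsets of the infinite jet space -/

section Smooth

/-- The space of infinite jets: `p k i` is the value of `u^i_k`.  Its (product) topology is the
coarsest one for which all truncations are continuous. -/
abbrev Jet (𝕂 : Type*) (m : ℕ) : Type _ := ℕ → Fin m → 𝕂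

variable {𝕂 : Type*} [RCLike 𝕂] {m : ℕ}

/-- The projection onto the coordinates `u^i_k` with `k ≤ l`. -/
def trunc (l : ℕ) (p : Jet 𝕂 m) : Fin (l + 1) → Fin m → 𝕂 := fun k => p k

/-- `f` is a function of the coordinates `u^i_k`, `k ≤ l`, only, and is smooth (for `𝕂 = ℂ`:
holomorphic). -/
def IsSmoothOfOrder (U : Set (Jet 𝕂 m)) (l : ℕ) (f : U → 𝕂) : Prop :=
  ∃ g : (Fin (l + 1) → Fin m → 𝕂) → 𝕂,
    (∀ p : U, ContDiffAt 𝕂 ∞ g (trunc l p.1)) ∧ ∀ p : U, f p = g (trunc l p.1)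

theorem IsSmoothOfOrder.mono {U : Set (Jet 𝕂 m)} {l l' : ℕ} (h : l ≤ l') {f : U → 𝕂}
    (hf : IsSmoothOfOrder U l f) : IsSmoothOfOrder U l' f := by
  obtain ⟨g, hg, hfg⟩ := hf
  refine ⟨fun q => g (fun k i => q (Fin.castLE (by omega) k) i), fun p => ?_, fun p => hfg p⟩
  have h1 : ContDiff 𝕂 ∞ (fun q : Fin (l' + 1) → Fin m → 𝕂 =>
      (fun (k : Fin (l + 1)) i => q (Fin.castLE (by omega) k) i)) := by fun_prop
  exact ContDiffAt.comp (trunc l' p.1) (hg p) h1.contDiffAt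

theorem IsSmoothOfOrder.add {U : Set (Jet 𝕂 m)} {l : ℕ} {f g : U → 𝕂}
    (hf : IsSmoothOfOrder U l f) (hg : IsSmoothOfOrder U l g) : IsSmoothOfOrder U l (f + g) := by
  obtain ⟨a, ha, hfa⟩ := hf
  obtain ⟨b, hb, hgb⟩ := hg
  exact ⟨fun q => a q + b q, fun p => (ha p).add (hb p), fun p => by simp [hfa, hgb]⟩

theorem IsSmoothOfOrder.mul {U : Set (Jet 𝕂 m)} {l : ℕ} {f g : U → 𝕂}
    (hf : IsSmoothOfOrder U l f) (hg : IsSmoothOfOrder U l g) : IsSmoothOfOrder U l (f * g) := by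
  obtain ⟨a, ha, hfa⟩ := hf
  obtain ⟨b, hb, hgb⟩ := hg
  exact ⟨fun q => a q * b q, fun p => (ha p).mul (hb p), fun p => by simp [hfa, hgb]⟩

theorem isSmoothOfOrder_const (U : Set (Jet 𝕂 m)) (l : ℕ) (c : 𝕂) :
    IsSmoothOfOrder U l (fun _ => c) :=
  ⟨fun _ => c, fun _ => contDiffAt_const, fun _ => rfl⟩

/-- The algebra of `𝕂`-valued admissible smooth functions on `U`: those depending on finitely many
jet coordinates. -/
def smoothFun (U : Set (Jet 𝕂 m)) : Subalgebra 𝕂 (U → 𝕂) where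
  carrier := {f | ∃ l, IsSmoothOfOrder U l f}
  mul_mem' := by
    rintro f g ⟨l, hf⟩ ⟨l', hg⟩
    exact ⟨max l l', (hf.mono (le_max_left _ _)).mul (hg.mono (le_max_right _ _))⟩
  add_mem' := by
    rintro f g ⟨l, hf⟩ ⟨l', hg⟩
    exact ⟨max l l', (hf.mono (le_max_left _ _)).add (hg.mono (le_max_right _ _))⟩
  algebraMap_mem' c := ⟨0, isSmoothOfOrder_const U 0 c⟩

/-- The subspace of smooth functions of the coordinates `u^i_k` with `k ≤ l`. -/
def smoothFunOfOrder (U : Set (Jet 𝕂 m)) (l : ℕ) : Submodule 𝕂 (smoothFun U) where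
  carrier := {f | IsSmoothOfOrder U l f.1}
  add_mem' hf hg := hf.add hg
  zero_mem' := isSmoothOfOrder_const U l 0
  smul_mem' c _ hf := (isSmoothOfOrder_const U l c).mul hf

/-- The coordinate function `u^i_k`. -/
def coordFun (U : Set (Jet 𝕂 m)) (k : ℕ) (i : Fin m) : smoothFun U :=
  ⟨fun p => p.1 k i, k, fun q => q (Fin.last k) i, fun p => by fun_prop, fun p => rfl⟩

/-- The partial derivative `∂f/∂u^i_k`, taken along the coordinate line through the point. -/
noncomputable def partialFun (U : Set (Jet 𝕂 m)) (k : ℕ) (i : Fin m) (f : U → 𝕂) : U → 𝕂 :=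
  fun p => deriv (fun z => Function.extend Subtype.val f 0
    (Function.update p.1 k (Function.update (p.1 k) i z))) (p.1 k i)

theorem hasDerivAt_line (U : TopologicalSpace.Opens (Jet 𝕂 m)) {l : ℕ} {f : U → 𝕂}
    {g : (Fin (l + 1) → Fin m → 𝕂) → 𝕂}
    (hg : ∀ p : U, ContDiffAt 𝕂 ∞ g (trunc l p.1)) (hfg : ∀ p : U, f p = g (trunc l p.1))
    (k : ℕ) (i : Fin m) (p : U) :
    HasDerivAt (fun z => Function.extend Subtype.val f 0
        (Function.update p.1 k (Function.update (p.1 k) i z)))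
      (fderiv 𝕂 g (trunc l p.1)
        (fun j => if (j : ℕ) = k then Pi.single i (1 : 𝕂) else 0)) (p.1 k i) := by
  have hline : Continuous (fun z : 𝕂 =>
      Function.update p.1 k (Function.update (p.1 k) i z)) :=
    continuous_const.update k (continuous_const.update i continuous_id)
  have h0 : Function.update p.1 k (Function.update (p.1 k) i (p.1 k i)) = p.1 := by simp
  have hmem : ∀ᶠ z in nhds (p.1 k i),
      Function.update p.1 k (Function.update (p.1 k) i z) ∈ U := by
    refine hline.continuousAt.eventually_mem (U.isOpen.mem_nhds ?_)
    rw [h0]; exact p.2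
  have hcurve : HasDerivAt (fun z : 𝕂 =>
      trunc l (Function.update p.1 k (Function.update (p.1 k) i z)))
      (fun j : Fin (l + 1) => if (j : ℕ) = k then Pi.single i (1 : 𝕂) else 0) (p.1 k i) := by
    rw [hasDerivAt_pi]
    intro j
    by_cases hj : (j : ℕ) = k
    · subst hj
      simpa [trunc] using hasDerivAt_update (p.1 j) i (p.1 j i)
    · simpa [trunc, hj] using hasDerivAt_const (p.1 k i) (p.1 j)
  have hgd : HasFDerivAt g (fderiv 𝕂 g (trunc l p.1))
      (trunc l (Function.update p.1 k (Function.update (p.1 k) i (p.1 k i)))) := by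
    rw [h0]
    exact ((hg p).differentiableAt (by simp)).hasFDerivAt
  refine (hgd.comp_hasDerivAt (p.1 k i) hcurve).congr_of_eventuallyEq ?_
  filter_upwards [hmem] with z hz
  have := Subtype.val_injective.extend_apply f 0 (⟨_, hz⟩ : U)
  simpa [hfg] using this

theorem partialFun_eq (U : TopologicalSpace.Opens (Jet 𝕂 m)) {l : ℕ} {f : U → 𝕂}
    {g : (Fin (l + 1) → Fin m → 𝕂) → 𝕂}
    (hg : ∀ p : U, ContDiffAt 𝕂 ∞ g (trunc l p.1)) (hfg : ∀ p : U, f p = g (trunc l p.1))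
    (k : ℕ) (i : Fin m) (p : U) :
    partialFun (U : Set (Jet 𝕂 m)) k i f p = fderiv 𝕂 g (trunc l p.1)
      (fun j => if (j : ℕ) = k then Pi.single i (1 : 𝕂) else 0) :=
  (hasDerivAt_line U hg hfg k i p).deriv

theorem IsSmoothOfOrder.partialFun (U : TopologicalSpace.Opens (Jet 𝕂 m)) {l : ℕ} {f : U → 𝕂}
    (hf : IsSmoothOfOrder (U : Set (Jet 𝕂 m)) l f) (k : ℕ) (i : Fin m) :
    IsSmoothOfOrder (U : Set (Jet 𝕂 m)) l (partialFun (U : Set (Jet 𝕂 m)) k i f) := by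
  obtain ⟨g, hg, hfg⟩ := hf
  refine ⟨fun q => fderiv 𝕂 g q (fun j => if (j : ℕ) = k then Pi.single i (1 : 𝕂) else 0),
    fun p => ?_, partialFun_eq U hg hfg k i⟩
  exact ((hg p).fderiv_right (m := ∞) (by simp)).clm_apply contDiffAt_const

theorem partialFun_eq_zero (U : TopologicalSpace.Opens (Jet 𝕂 m)) {l : ℕ} {f : U → 𝕂}
    (hf : IsSmoothOfOrder (U : Set (Jet 𝕂 m)) l f) {k : ℕ} (hk : l < k) (i : Fin m) :
    partialFun (U : Set (Jet 𝕂 m)) k i f = 0 := by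
  obtain ⟨g, hg, hfg⟩ := hf
  funext p
  rw [partialFun_eq U hg hfg]
  have : (fun j : Fin (l + 1) => if (j : ℕ) = k then Pi.single i (1 : 𝕂) else 0)
      = (0 : Fin (l + 1) → Fin m → 𝕂) := by
    funext j
    have := j.2
    rw [if_neg (by omega)]; rfl
  rw [this, map_zero]; rfl

/-- `∂/∂u^i_k` as a linear operator on smooth functions. -/
noncomputable def pd (U : TopologicalSpace.Opens (Jet 𝕂 m)) (k : ℕ) (i : Fin m) :
    smoothFun (U : Set (Jet 𝕂 m)) →ₗ[𝕂] smoothFun (U : Set (Jet 𝕂 m)) where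
  toFun f := ⟨partialFun (U : Set (Jet 𝕂 m)) k i f.1, f.2.imp fun _ h => h.partialFun U k i⟩
  map_add' f f' := by
    obtain ⟨f, l, hf⟩ := f
    obtain ⟨f', l', hf'⟩ := f'
    obtain ⟨g, hg, hfg⟩ := hf.mono (le_max_left l l')
    obtain ⟨g', hg', hfg'⟩ := hf'.mono (le_max_right l l')
    ext p
    have h1 := partialFun_eq U hg hfg k i p
    have h2 := partialFun_eq U hg' hfg' k i p
    have h3 := partialFun_eq U (f := f + f') (g := g + g') (fun p => (hg p).add (hg' p))
      (fun p => by simp [hfg, hfg']) k i p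
    rw [fderiv_add ((hg p).differentiableAt (by simp)) ((hg' p).differentiableAt (by simp))] at h3
    change partialFun (U : Set (Jet 𝕂 m)) k i (f + f') p
      = partialFun (U : Set (Jet 𝕂 m)) k i f p + partialFun (U : Set (Jet 𝕂 m)) k i f' p
    rw [h1, h2, h3]; rfl
  map_smul' c f := by
    obtain ⟨f, l, g, hg, hfg⟩ := f
    ext p
    have h1 := partialFun_eq U hg hfg k i p
    have h3 := partialFun_eq U (f := c • f) (g := c • g) (fun p => (hg p).const_smul c)
      (fun p => by simp [hfg]) k i p
    rw [fderiv_const_smul ((hg p).differentiableAt (by simp))] at h3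
    change partialFun (U : Set (Jet 𝕂 m)) k i (c • f) p
      = c • partialFun (U : Set (Jet 𝕂 m)) k i f p
    rw [h1, h3]; rfl

theorem finite_support_pd (U : TopologicalSpace.Opens (Jet 𝕂 m))
    (Q : ℕ → Fin m → smoothFun (U : Set (Jet 𝕂 m))) (f : smoothFun (U : Set (Jet 𝕂 m))) :
    (Function.support fun k => ∑ i, Q k i * pd U k i f).Finite := by
  obtain ⟨l, hl⟩ := f.2
  refine (Set.finite_Iic l).subset fun k hk => ?_
  by_contra hlk
  refine hk (Finset.sum_eq_zero fun i _ => ?_)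
  have : pd U k i f = 0 := Subtype.ext (partialFun_eq_zero U hl (by simpa using hlk) i)
  rw [this, mul_zero]

/-- The derivation `∑_{i,k} Q^i_k ∂/∂u^i_k` of the algebra of admissible functions (on each function
the sum is finite). -/
noncomputable def vecField (U : TopologicalSpace.Opens (Jet 𝕂 m))
    (Q : ℕ → Fin m → smoothFun (U : Set (Jet 𝕂 m))) :
    smoothFun (U : Set (Jet 𝕂 m)) →ₗ[𝕂] smoothFun (U : Set (Jet 𝕂 m)) where
  toFun f := ∑ᶠ k, ∑ i, Q k i * pd U k i f
  map_add' f g := by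
    rw [← finsum_add_distrib (finite_support_pd U Q f) (finite_support_pd U Q g)]
    simp only [map_add, mul_add, Finset.sum_add_distrib]
  map_smul' c f := by
    rw [RingHom.id_apply, smul_finsum' c (finite_support_pd U Q f)]
    simp only [map_smul, mul_smul_comm, Finset.smul_sum]

/-- The total derivative `D_x = ∑ u^i_{k+1} ∂/∂u^i_k`. -/
noncomputable def Dx (U : TopologicalSpace.Opens (Jet 𝕂 m)) :
    smoothFun (U : Set (Jet 𝕂 m)) →ₗ[𝕂] smoothFun (U : Set (Jet 𝕂 m)) :=
  vecField U fun k i => coordFun (U : Set (Jet 𝕂 m)) (k + 1) i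

/-- The total derivative `D_t = ∑ D_x^k(F^i) ∂/∂u^i_k` of the system `u^i_t = F^i`. -/
noncomputable def Dt (U : TopologicalSpace.Opens (Jet 𝕂 m)) (r : Fin (m + 1) → 𝕂) :
    smoothFun (U : Set (Jet 𝕂 m)) →ₗ[𝕂] smoothFun (U : Set (Jet 𝕂 m)) :=
  vecField U fun k i => (Dx U)^[k] (rhs r (coordFun (U : Set (Jet 𝕂 m))) i)

theorem isUnit_delta_smooth (U : Set (Jet 𝕂 m)) (hU : ∀ p ∈ U, delta (p 0) ≠ 0) :
    IsUnit (delta (coordFun U 0)) := by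
  have hval : ∀ p : U, (delta (coordFun U 0)).1 p = delta (p.1 0) := fun p => by
    simp [delta, pairing, coordFun]
  have hs : IsSmoothOfOrder U 0 (fun p : U => (delta (p.1 0))⁻¹) := by
    refine ⟨fun q => (delta (q 0))⁻¹, fun p => ContDiffAt.inv ?_ (hU p.1 p.2), fun p => rfl⟩
    unfold delta pairing
    fun_prop
  refine IsUnit.of_mul_eq_one ⟨_, 0, hs⟩ (Subtype.ext (funext fun p => ?_))
  change (delta (coordFun U 0)).1 p * (delta (p.1 0))⁻¹ = 1
  rw [hval, mul_inv_cancel₀ (hU p.1 p.2)]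

variable (L : Type*) [LieRing L] [LieAlgebra 𝕂 L]

/-- Admissible smooth functions on `U` with values in the Lie algebra `L`, with the bracket
`[f₁ ⊗ h₁, f₂ ⊗ h₂] = f₁f₂ ⊗ [h₁, h₂]`. -/
abbrev LieFun (U : Set (Jet 𝕂 m)) : Type _ := smoothFun U ⊗[𝕂] L

/-- The `L`-valued smooth functions of the coordinates `u^i_k` with `k ≤ l`. -/
noncomputable def lieFunOfOrder (U : Set (Jet 𝕂 m)) (l : ℕ) : Submodule 𝕂 (LieFun L U) :=
  LinearMap.range ((smoothFunOfOrder U l).subtype.rTensor L)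

end Smooth

/-! ## Formal power series -/

section Formal

variable {𝕂 : Type*} [RCLike 𝕂] {m : ℕ}

/-- Indices `(k, i)` of the formal variables `u^i_k - a^i_k`. -/
abbrev JetVar (m : ℕ) : Type := ℕ × Fin m

variable {V : Type*} [AddCommGroup V] [Module 𝕂 V] {L : Type*} [LieRing L] [LieAlgebra 𝕂 L]

/-- A power series with coefficients in `V` in the variables `u^i_k - a^i_k`; for `V = L` these are
the formal power series with coefficients in a Lie algebra.  The coefficient of `U^γ` is `A γ`. -/
abbrev Series (m : ℕ) (V : Type*) : Type _ := MvPowerSeries (JetVar m) V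

/-- `A` contains only the variables with `k ≤ l`. -/
def Series.HasOrder (l : ℕ) (A : Series m V) : Prop :=
  ∀ γ : JetVar m →₀ ℕ, (∃ q ∈ γ.support, l < q.1) → A γ = 0

/-- The product of a scalar series and a `V`-valued series. -/
noncomputable def Series.mulLeft (f : Series m 𝕂) (A : Series m V) : Series m V :=
  fun γ => ∑ αβ ∈ Finset.HasAntidiagonal.antidiagonal γ, f αβ.1 • A αβ.2

/-- The bracket `[A, B] = ∑ [A_α, B_β] U^α U^β`. -/
noncomputable def Series.bracket (A B : Series m L) : Series m L :=
  fun γ => ∑ αβ ∈ Finset.HasAntidiagonal.antidiagonal γ, ⁅A αβ.1, B αβ.2⁆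

/-- The series `f · c`. -/
def Series.mk (f : Series m 𝕂) (c : L) : Series m L := fun γ => f γ • c

/-- The formal partial derivative with respect to `u^i_k`. -/
noncomputable def Series.pd (k : ℕ) (i : Fin m) (A : Series m V) : Series m V :=
  fun γ => (γ (k, i) + 1) • A (γ + Finsupp.single (k, i) 1)

/-- The function `u^i_k = a^i_k + (u^i_k - a^i_k)` as a power series at the point `a`. -/
noncomputable def coordSeries (a : Jet 𝕂 m) (k : ℕ) (i : Fin m) : Series m 𝕂 :=
  MvPowerSeries.C (a k i) + MvPowerSeries.X (k, i)

/-- The operator `∑_{i,k} Q^i_k ∂/∂u^i_k`.  The sum is finite on every series in finitely many of the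
variables. -/
noncomputable def Series.vecField (Q : ℕ → Fin m → Series m 𝕂) (A : Series m V) : Series m V :=
  ∑ᶠ k, ∑ i, Series.mulLeft (Q k i) (Series.pd k i A)

/-- The total derivative `D_x = ∑ u^i_{k+1} ∂/∂u^i_k` on power series at the point `a`. -/
noncomputable def Series.Dx (a : Jet 𝕂 m) (A : Series m V) : Series m V :=
  Series.vecField (fun k i => coordSeries a (k + 1) i) A

/-- The total derivative `D_t = ∑ D_x^k(F^i) ∂/∂u^i_k` on power series at the point `a`. -/
noncomputable def Series.Dt (a : Jet 𝕂 m) (r : Fin (m + 1) → 𝕂) (A : Series m V) : Series m V :=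
  Series.vecField (fun k i => (Series.Dx a)^[k] (rhs r (coordSeries a) i)) A

theorem isUnit_delta_formal (a : Jet 𝕂 m) (ha : delta (a 0) ≠ 0) :
    IsUnit (delta (coordSeries a 0)) := by
  rw [MvPowerSeries.isUnit_iff_constantCoeff, isUnit_iff_ne_zero]
  simpa [delta, pairing, coordSeries] using ha

end Formal

end LandauLifshitz

/-! In the coordinates u the functions s^1, …, s^n parametrize the unit sphere (complexified for 𝕂 =
ℂ) with metric g = 4Δ⁻²⟨du,du⟩. The equation is sorted first by the order of the jets and then by
the degree in u_1.

Differentiating in u_3 and u_2 forces B = D_x²A + [D_xA, A] − (3/2)H + E, where H is the covariant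
Hessian of A on (u_1,u_1) and E depends on u only (`exists_ord_zero`). After substitution, twice the
equation is a sum of parts of degree 3, 2, 1, 0 in u_1 (`two_smul_equation`), which the Euler
operator separates (`parts_eq_zero`).

Degree 3 is a linear third order system for A alone. Written for P = ΔA it contains only second and
third derivatives, and its compatibility conditions make P affine in u and ⟨u,u⟩ (`exists_affine`);
thus A = C_0 + S with S = ∑ C_l s^l. Degree 2: linear functions on the sphere satisfy Hess f = −f g,
so this part says [C_0, S] = 0. Degree 1 prescribes the differential of E: 2dE = 3q dS + 2[S,[S,dS]]
with q = ∑ r_l (s^l)². Its closedness is an identity for pairs of tangent vectors. On the tangent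
vectors s^a e_b − s^b e_a it becomes a cubic form in s; such a form with constant coefficients
vanishes identically (`cubic_form_eq_zero`), and its values at e_a and e_a + e_b are the relations
among the C_l. These relations in turn integrate dE to E = ½ q S + ∑ K_l s^l + C_{n+1}, where K is
`linCoeff` (`two_smul_map_potential`). Degree 0, [A, E] = 0, then only says that C_{n+1} commutes
with all C_k, because [S, ∑ K_l s^l] = 0; this rests on `lie_linCoeff_add`, which needs a third
index and hence n ≥ 3. The converse uses the same decomposition.

The argument is carried out once, in a `JetModel`, where only Δ and nonzero constants are ever
inverted. Smooth functions and formal power series are two such models. -/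

namespace LandauLifshitz

set_option linter.unusedSimpArgs false
set_option linter.unusedSectionVars false

/-! ## Derivations of a Lie algebra over a commutative ring -/

section LieDer

/-- A derivation of the commutative algebra `R` together with a compatible derivation of a Lie
algebra `M` over `R`. -/
structure LieDer (𝕂 R M : Type*) [Field 𝕂] [CommRing R] [Algebra 𝕂 R] [LieRing M]
    [LieAlgebra R M] where
  onR : Derivation 𝕂 R R
  onM : M →+ M
  smul' : ∀ (f : R) (x : M), onM (f • x) = onR f • x + f • onM x
  lie' : ∀ x y : M, onM ⁅x, y⁆ = ⁅onM x, y⁆ + ⁅x, onM y⁆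

namespace LieDer

variable {𝕂 R M : Type*} [Field 𝕂] [CommRing R] [Algebra 𝕂 R] [LieRing M] [LieAlgebra R M]
  {n : Type*}

theorem map_smul (D : LieDer 𝕂 R M) (f : R) (x : M) :
    D.onM (f • x) = D.onR f • x + f • D.onM x := D.smul' f x

theorem map_lie (D : LieDer 𝕂 R M) (x y : M) :
    D.onM ⁅x, y⁆ = ⁅D.onM x, y⁆ + ⁅x, D.onM y⁆ := D.lie' x y

/-- The componentwise action on vectors of functions. -/
def vec (D : LieDer 𝕂 R M) (w : n → R) : n → R := fun i => D.onR (w i)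

theorem vec_apply (D : LieDer 𝕂 R M) (w : n → R) (i : n) : D.vec w i = D.onR (w i) := rfl

theorem vec_add (D : LieDer 𝕂 R M) (v w : n → R) : D.vec (v + w) = D.vec v + D.vec w := by
  ext i; simp [vec]

theorem vec_sub (D : LieDer 𝕂 R M) (v w : n → R) : D.vec (v - w) = D.vec v - D.vec w := by
  ext i; simp [vec]

theorem vec_neg (D : LieDer 𝕂 R M) (v : n → R) : D.vec (-v) = -D.vec v := by
  ext i; simp [vec]

theorem vec_smul (D : LieDer 𝕂 R M) (f : R) (v : n → R) :
    D.vec (f • v) = D.onR f • v + f • D.vec v := by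
  ext i; simp [vec]; ring

theorem map_ofNat (D : LieDer 𝕂 R M) (k : ℕ) [k.AtLeastTwo] :
    D.onR (ofNat(k) : R) = 0 := by
  have := D.onR.map_natCast k; exact_mod_cast this

theorem map_pairing {m : ℕ} (D : LieDer 𝕂 R M) (v w : Fin m → R) :
    D.onR (pairing v w) = pairing (D.vec v) w + pairing v (D.vec w) := by
  simp only [pairing, vec, map_sum, Derivation.leibniz, smul_eq_mul, Finset.sum_add_distrib]
  rw [add_comm]
  congr 1
  exact Finset.sum_congr rfl fun i _ => mul_comm _ _

/-- The combination `∑ fᵢ Dᵢ`. -/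
def comb {ι : Type*} (s : Finset ι) (f : ι → R) (D : ι → LieDer 𝕂 R M) : LieDer 𝕂 R M where
  onR := ∑ i ∈ s, f i • (D i).onR
  onM :=
    { toFun := fun x => ∑ i ∈ s, f i • (D i).onM x
      map_zero' := by simp
      map_add' := fun x y => by simp [Finset.sum_add_distrib] }
  smul' g x := by
    have h : (∑ i ∈ s, f i • (D i).onR) g = ∑ i ∈ s, f i • (D i).onR g := by
      induction s using Finset.cons_induction with
      | empty => simp
      | cons a s ha ih => simp [Finset.sum_cons, ih]
    change ∑ i ∈ s, f i • (D i).onM (g • x) = _ • x + g • ∑ i ∈ s, f i • (D i).onM x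
    rw [h, Finset.sum_smul, Finset.smul_sum, ← Finset.sum_add_distrib]
    refine Finset.sum_congr rfl fun i _ => ?_
    rw [(D i).map_smul]; simp only [smul_eq_mul]; module
  lie' x y := by
    change ∑ i ∈ s, f i • (D i).onM ⁅x, y⁆
      = ⁅∑ i ∈ s, f i • (D i).onM x, y⁆ + ⁅x, ∑ i ∈ s, f i • (D i).onM y⁆
    rw [sum_lie, lie_sum, ← Finset.sum_add_distrib]
    refine Finset.sum_congr rfl fun i _ => ?_
    rw [(D i).map_lie, smul_add, smul_lie, lie_smul]

theorem comb_onM {ι : Type*} (s : Finset ι) (f : ι → R) (D : ι → LieDer 𝕂 R M) (x : M) :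
    (comb s f D).onM x = ∑ i ∈ s, f i • (D i).onM x := rfl

theorem comb_onR {ι : Type*} (s : Finset ι) (f : ι → R) (D : ι → LieDer 𝕂 R M) (g : R) :
    (comb s f D).onR g = ∑ i ∈ s, f i * (D i).onR g := by
  change (∑ i ∈ s, f i • (D i).onR) g = _
  induction s using Finset.cons_induction with
  | empty => simp
  | cons a s ha ih => simp [Finset.sum_cons, ih]

end LieDer

end LieDer

/-! ## Pairings -/

section Pairing

variable {R : Type*} [CommRing R] {m : ℕ}

theorem pairing_comm (v w : Fin m → R) : pairing v w = pairing w v := by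
  simp [pairing, mul_comm]

theorem pairing_add_left (v v' w : Fin m → R) :
    pairing (v + v') w = pairing v w + pairing v' w := by
  simp [pairing, add_mul, Finset.sum_add_distrib]

theorem pairing_add_right (v w w' : Fin m → R) :
    pairing v (w + w') = pairing v w + pairing v w' := by
  simp [pairing, mul_add, Finset.sum_add_distrib]

theorem pairing_sub_right (v w w' : Fin m → R) :
    pairing v (w - w') = pairing v w - pairing v w' := by
  simp [pairing, mul_sub, Finset.sum_sub_distrib]

theorem pairing_smul_left (f : R) (v w : Fin m → R) :
    pairing (f • v) w = f * pairing v w := by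
  simp [pairing, Finset.mul_sum, mul_assoc]

theorem pairing_smul_right (f : R) (v w : Fin m → R) :
    pairing v (f • w) = f * pairing v w := by
  simp [pairing, Finset.mul_sum, mul_left_comm]

theorem pairing_zero_left (w : Fin m → R) : pairing 0 w = 0 := by simp [pairing]

theorem pairing_zero_right (w : Fin m → R) : pairing w 0 = 0 := by simp [pairing]

theorem pairing_single_left (i : Fin m) (f : R) (w : Fin m → R) :
    pairing (Pi.single i f) w = f * w i := by
  simp [pairing, Pi.single_apply]

theorem pairing_single_right (i : Fin m) (f : R) (w : Fin m → R) :
    pairing w (Pi.single i f) = w i * f := by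
  simp [pairing, Pi.single_apply]

end Pairing

/-! ## An abstract calculus of jets -/

/-- A commutative algebra `R` of functions of the jet coordinates `u k i`, a Lie algebra `M` over
`R` of functions with values in `L`, and commuting partial derivatives `pd k i` on both, whose
common kernel in `M` consists of the constants. -/
structure JetModel (𝕂 R L M : Type*) [Field 𝕂] [CommRing R] [Algebra 𝕂 R] [LieRing L]
    [LieAlgebra 𝕂 L] [LieRing M] [LieAlgebra R M] [Module 𝕂 M] (m : ℕ) where
  u : ℕ → Fin m → R
  isUnit_delta : IsUnit (delta (u 0))
  pd : ℕ → Fin m → LieDer 𝕂 R M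
  pd_u : ∀ k i l j, (pd k i).onR (u l j) = if k = l ∧ i = j then 1 else 0
  pd_comm : ∀ k i l j x, (pd k i).onM ((pd l j).onM x) = (pd l j).onM ((pd k i).onM x)
  const : L →ₗ[𝕂] M
  const_lie : ∀ x y, const ⁅x, y⁆ = ⁅const x, const y⁆
  const_injective : Function.Injective const
  pd_const : ∀ k i c, (pd k i).onM (const c) = 0
  exists_const : ∀ x, (∀ k i, (pd k i).onM x = 0) → ∃ c, const c = x

namespace JetModel

variable {𝕂 R L M : Type*} [Field 𝕂] [CommRing R] [Algebra 𝕂 R] [LieRing L]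
  [LieAlgebra 𝕂 L] [LieRing M] [LieAlgebra R M] [Module 𝕂 M] {m : ℕ}
  (J : JetModel 𝕂 R L M m)

/-- The elements of `M` which depend on the `u k i` with `k ≤ l` only. -/
def Ord (l : ℕ) (x : M) : Prop := ∀ k, l < k → ∀ i, (J.pd k i).onM x = 0

/-- `Δ⁻¹`. -/
noncomputable def dinv : R := deltaInv (J.u 0)

variable {J}

theorem Ord.mono {l l' : ℕ} (h : l ≤ l') {x : M} (hx : J.Ord l x) : J.Ord l' x :=
  fun k hk i => hx k (lt_of_le_of_lt h hk) i

theorem Ord.pd {l : ℕ} {x : M} (hx : J.Ord l x) (k : ℕ) (i : Fin m) :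
    J.Ord l ((J.pd k i).onM x) := fun k' hk' i' => by
  rw [J.pd_comm, hx k' hk', map_zero]

theorem Ord.add {l : ℕ} {x y : M} (hx : J.Ord l x) (hy : J.Ord l y) : J.Ord l (x + y) :=
  fun k hk i => by rw [map_add, hx k hk, hy k hk, add_zero]

theorem Ord.sub {l : ℕ} {x y : M} (hx : J.Ord l x) (hy : J.Ord l y) : J.Ord l (x - y) :=
  fun k hk i => by rw [map_sub, hx k hk, hy k hk, sub_zero]

theorem Ord.lie {l : ℕ} {x y : M} (hx : J.Ord l x) (hy : J.Ord l y) : J.Ord l ⁅x, y⁆ :=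
  fun k hk i => by rw [LieDer.map_lie, hx k hk, hy k hk, zero_lie, lie_zero, add_zero]

theorem Ord.smul {l : ℕ} {f : R} {x : M} (hf : ∀ k, l < k → ∀ i, (J.pd k i).onR f = 0)
    (hx : J.Ord l x) : J.Ord l (f • x) :=
  fun k hk i => by rw [LieDer.map_smul, hx k hk, hf k hk, zero_smul, smul_zero, add_zero]

theorem ord_const (l : ℕ) (c : L) : J.Ord l (J.const c) := fun k _ i => J.pd_const k i c

theorem Ord.sum {ι : Type*} {l : ℕ} {s : Finset ι} {x : ι → M} (hx : ∀ i ∈ s, J.Ord l (x i)) :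
    J.Ord l (∑ i ∈ s, x i) :=
  fun k hk i => by rw [map_sum]; exact Finset.sum_eq_zero fun j hj => hx j hj k hk i

variable (J)

theorem pd_vec_u (k l : ℕ) (i : Fin m) :
    (J.pd k i).vec (J.u l) = if k = l then Pi.single i 1 else 0 := by
  ext j
  rw [LieDer.vec_apply, J.pd_u]
  by_cases h : k = l <;> simp [h, Pi.single_apply, eq_comm]

theorem pd_vec_u_self (k : ℕ) (i : Fin m) : (J.pd k i).vec (J.u k) = Pi.single i 1 := by
  simp [pd_vec_u]

theorem pd_vec_u_ne {k l : ℕ} (h : k ≠ l) (i : Fin m) : (J.pd k i).vec (J.u l) = 0 := by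
  simp [pd_vec_u, h]

theorem delta_mul_dinv : (1 + pairing (J.u 0) (J.u 0)) * J.dinv = 1 :=
  Ring.mul_inverse_cancel _ J.isUnit_delta

theorem map_dinv (D : LieDer 𝕂 R M) :
    D.onR J.dinv = -(2 * pairing (J.u 0) (D.vec (J.u 0)) * J.dinv ^ 2) := by
  have h := congrArg D.onR J.delta_mul_dinv
  have h1 := J.delta_mul_dinv
  rw [Derivation.leibniz, map_add, D.map_pairing, D.onR.map_one_eq_zero,
    pairing_comm (D.vec _)] at h
  simp only [smul_eq_mul] at h
  linear_combination J.dinv * h - D.onR J.dinv * h1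

/-- The first differential in the variables `u 0`. -/
def d1 (x : M) : (Fin m → R) →ₗ[R] M :=
  Fintype.linearCombination R fun i => (J.pd 0 i).onM x

/-- The second differential in the variables `u 0`. -/
def d2 (x : M) : (Fin m → R) →ₗ[R] (Fin m → R) →ₗ[R] M :=
  Fintype.linearCombination R fun i => J.d1 ((J.pd 0 i).onM x)

/-- The third differential in the variables `u 0`. -/
def d3 (x : M) : (Fin m → R) →ₗ[R] (Fin m → R) →ₗ[R] (Fin m → R) →ₗ[R] M :=
  Fintype.linearCombination R fun i => J.d2 ((J.pd 0 i).onM x)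

theorem d1_apply (x : M) (w : Fin m → R) : J.d1 x w = ∑ i, w i • (J.pd 0 i).onM x := rfl

theorem d2_apply (x : M) (w w' : Fin m → R) :
    J.d2 x w w' = ∑ i, w i • J.d1 ((J.pd 0 i).onM x) w' := by
  simp [d2, Fintype.linearCombination_apply]

theorem d3_apply (x : M) (w w' w'' : Fin m → R) :
    J.d3 x w w' w'' = ∑ i, w i • J.d2 ((J.pd 0 i).onM x) w' w'' := by
  simp [d3, Fintype.linearCombination_apply]

theorem d1_single (x : M) (i : Fin m) : J.d1 x (Pi.single i 1) = (J.pd 0 i).onM x := by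
  simp [d1]

theorem d2_single (x : M) (i : Fin m) (w : Fin m → R) :
    J.d2 x (Pi.single i 1) w = J.d1 ((J.pd 0 i).onM x) w := by
  simp [d2]

theorem d3_single (x : M) (i : Fin m) (w w' : Fin m → R) :
    J.d3 x (Pi.single i 1) w w' = J.d2 ((J.pd 0 i).onM x) w w' := by
  simp [d3]

theorem d2_comm (x : M) (w w' : Fin m → R) : J.d2 x w w' = J.d2 x w' w := by
  simp only [d2_apply, d1_apply, Finset.smul_sum]
  rw [Finset.sum_comm]
  refine Finset.sum_congr rfl fun i _ => Finset.sum_congr rfl fun j _ => ?_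
  rw [smul_comm, J.pd_comm]

theorem d3_comm_right (x : M) (w w' w'' : Fin m → R) : J.d3 x w w' w'' = J.d3 x w w'' w' := by
  simp only [d3_apply]
  exact Finset.sum_congr rfl fun i _ => by rw [J.d2_comm]

theorem d3_comm_left (x : M) (w w' w'' : Fin m → R) : J.d3 x w w' w'' = J.d3 x w' w w'' := by
  simp only [d3_apply, d2_apply, Finset.smul_sum]
  rw [Finset.sum_comm]
  refine Finset.sum_congr rfl fun i _ => Finset.sum_congr rfl fun j _ => ?_
  rw [smul_comm, J.pd_comm]

/-- `D` acts on functions of the variables `u 0` by the chain rule. -/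
def Geom (D : LieDer 𝕂 R M) : Prop := ∀ x, J.Ord 0 x → D.onM x = J.d1 x (D.vec (J.u 0))

theorem geom_pd (k : ℕ) (i : Fin m) : J.Geom (J.pd k i) := by
  intro x hx
  rcases Nat.eq_zero_or_pos k with rfl | hk
  · rw [J.pd_vec_u_self, d1_single]
  · rw [J.pd_vec_u_ne hk.ne', hx k hk, map_zero]

/-- The chain rule survives combinations with coefficients in `R`, so it holds for every vector
field used below: `D`, `euler`, `vfield` and the directional fields. -/
theorem geom_comb {ι : Type*} (s : Finset ι) (f : ι → R) (D : ι → LieDer 𝕂 R M)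
    (hD : ∀ i ∈ s, J.Geom (D i)) : J.Geom (LieDer.comb s f D) := by
  intro x hx
  rw [LieDer.comb_onM]
  have : (LieDer.comb s f D).vec (J.u 0) = ∑ i ∈ s, f i • (D i).vec (J.u 0) := by
    ext j
    simp [LieDer.vec, LieDer.comb_onR]
  rw [this, map_sum]
  exact Finset.sum_congr rfl fun i hi => by rw [map_smul, hD i hi x hx]

variable {J}

/-- The coefficients `(J.pd 0 i).onM x` are again of order zero, so the chain rule applies to them
as well; symmetry of `d2` moves the new direction to the first slot. -/
theorem Geom.map_d1 {D : LieDer 𝕂 R M} (hD : J.Geom D) {x : M} (hx : J.Ord 0 x)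
    (w : Fin m → R) :
    D.onM (J.d1 x w) = J.d2 x (D.vec (J.u 0)) w + J.d1 x (D.vec w) := by
  rw [J.d2_comm, d1_apply, map_sum, d2_apply, d1_apply, ← Finset.sum_add_distrib]
  refine Finset.sum_congr rfl fun i _ => ?_
  rw [D.map_smul, hD _ (hx.pd 0 i), add_comm]; rfl

theorem Geom.map_d2 {D : LieDer 𝕂 R M} (hD : J.Geom D) {x : M} (hx : J.Ord 0 x)
    (w w' : Fin m → R) :
    D.onM (J.d2 x w w') = J.d3 x (D.vec (J.u 0)) w w' + J.d2 x (D.vec w) w'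
      + J.d2 x w (D.vec w') := by
  rw [J.d3_comm_left, d2_apply, map_sum, d3_apply, d2_apply, d2_apply, ← Finset.sum_add_distrib,
    ← Finset.sum_add_distrib]
  refine Finset.sum_congr rfl fun i _ => ?_
  rw [D.map_smul, hD.map_d1 (hx.pd 0 i), smul_add, LieDer.vec_apply]
  abel

/-- A derivation that kills `u 0` sees only the directions, which avoids a fourth differential. -/
theorem Geom.map_d3_of_vec_eq_zero {D : LieDer 𝕂 R M} (hD : J.Geom D) (h0 : D.vec (J.u 0) = 0)
    {x : M} (hx : J.Ord 0 x) (w w' w'' : Fin m → R) :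
    D.onM (J.d3 x w w' w'') = J.d3 x (D.vec w) w' w'' + J.d3 x w (D.vec w') w''
      + J.d3 x w w' (D.vec w'') := by
  simp only [d3_apply, map_sum]
  rw [← Finset.sum_add_distrib, ← Finset.sum_add_distrib]
  refine Finset.sum_congr rfl fun i _ => ?_
  rw [D.map_smul, hD.map_d2 (hx.pd 0 i), smul_add, smul_add, h0, map_zero, LieDer.vec_apply]
  simp only [LinearMap.zero_apply]
  module

theorem Ord.d1 {l : ℕ} {x : M} (hx : J.Ord 0 x) {w : Fin m → R}
    (hw : ∀ k, l < k → ∀ i, (J.pd k i).vec w = 0) : J.Ord l (J.d1 x w) := fun k hk i => by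
  rw [(J.geom_pd k i).map_d1 hx, hw k hk, J.pd_vec_u_ne (by omega)]; simp

theorem Ord.d2 {l : ℕ} {x : M} (hx : J.Ord 0 x) {w w' : Fin m → R}
    (hw : ∀ k, l < k → ∀ i, (J.pd k i).vec w = 0)
    (hw' : ∀ k, l < k → ∀ i, (J.pd k i).vec w' = 0) : J.Ord l (J.d2 x w w') := fun k hk i => by
  rw [(J.geom_pd k i).map_d2 hx, hw k hk, hw' k hk, J.pd_vec_u_ne (by omega)]; simp

variable (J)

/-- The vector field `∑ W k i ∂/∂u^i_k` with `k < N`. -/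
def field (N : ℕ) (W : ℕ → Fin m → R) : LieDer 𝕂 R M :=
  LieDer.comb (Finset.range N ×ˢ Finset.univ) (fun q => W q.1 q.2) fun q => J.pd q.1 q.2

theorem field_onM (N : ℕ) (W : ℕ → Fin m → R) (x : M) :
    (J.field N W).onM x = ∑ k ∈ Finset.range N, ∑ i, W k i • (J.pd k i).onM x := by
  rw [field, LieDer.comb_onM, Finset.sum_product]

theorem field_onR (N : ℕ) (W : ℕ → Fin m → R) (f : R) :
    (J.field N W).onR f = ∑ k ∈ Finset.range N, ∑ i, W k i * (J.pd k i).onR f := by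
  rw [field, LieDer.comb_onR, Finset.sum_product]

theorem geom_field (N : ℕ) (W : ℕ → Fin m → R) : J.Geom (J.field N W) :=
  J.geom_comb _ _ _ fun q _ => J.geom_pd q.1 q.2

theorem field_vec_u (N : ℕ) (W : ℕ → Fin m → R) (k : ℕ) :
    (J.field N W).vec (J.u k) = if k < N then W k else 0 := by
  ext j
  rw [LieDer.vec_apply, field_onR]
  have h : ∀ l, ∑ i, W l i * (J.pd l i).onR (J.u k j) = if l = k then W k j else 0 := by
    intro l
    by_cases hl : l = k
    · subst hl; simp [J.pd_u]
    · simp [J.pd_u, hl]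
  simp only [h, Finset.sum_ite_eq', Finset.mem_range]
  split_ifs <;> rfl

/-- The total derivative, on functions of order at most two. -/
def D : LieDer 𝕂 R M := J.field 3 fun k => J.u (k + 1)

theorem D_vec_u {k : ℕ} (hk : k < 3) : J.D.vec (J.u k) = J.u (k + 1) := by
  rw [D, field_vec_u, if_pos hk]

theorem geom_D : J.Geom J.D := J.geom_field _ _

/-- The commutator of ∂/∂u^j_{l+1} with the total derivative is ∂/∂u^j_l, and `x` does not depend on
u_{l+1}. This is how the top order of the equation is read off. -/
theorem pd_D {l : ℕ} (hl : l < 3) {x : M} (hx : J.Ord l x) (j : Fin m) :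
    (J.pd (l + 1) j).onM (J.D.onM x) = (J.pd l j).onM x := by
  rw [D, field_onM, map_sum]
  have h : ∀ k, (J.pd (l + 1) j).onM (∑ i, J.u (k + 1) i • (J.pd k i).onM x)
      = if k = l then (J.pd l j).onM x else 0 := by
    intro k
    rw [map_sum]
    have h1 : ∀ i, (J.pd (l + 1) j).onM (J.u (k + 1) i • (J.pd k i).onM x)
        = (if l = k ∧ j = i then (1 : R) else 0) • (J.pd k i).onM x := by
      intro i
      rw [LieDer.map_smul, J.pd_u, J.pd_comm, hx _ (Nat.lt_succ_self l), map_zero, smul_zero,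
        add_zero]
      simp
    simp only [h1]
    by_cases hk : k = l
    · subst hk; simp
    · simp [hk, Ne.symm hk]
  simp [h, hl]

end JetModel

/-! ### The evolution system, and the dependence of B on u_2 and u_1 -/

namespace JetModel

variable {𝕂 R L M : Type*} [Field 𝕂] [CommRing R] [Algebra 𝕂 R] [LieRing L]
  [LieAlgebra 𝕂 L] [LieRing M] [LieAlgebra R M] [Module 𝕂 M] {m : ℕ}
  (J : JetModel 𝕂 R L M m)

/-- The constant `3 / 2`. -/
def threeHalves (_ : JetModel 𝕂 R L M m) : R := algebraMap 𝕂 R (3 / 2)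

/-- The function `∑ r_l (s^l)²`. -/
noncomputable def quad (r : Fin (m + 1) → 𝕂) : R :=
  algebraMap 𝕂 R (r (Fin.last m)) + 4 * J.dinv ^ 2 *
    ∑ i : Fin m, algebraMap 𝕂 R (r i.castSucc - r (Fin.last m)) * J.u 0 i ^ 2

/-- The Christoffel symbols of the round metric applied to `(u 1, u 1)`. -/
noncomputable def gam : Fin m → R :=
  -(2 * J.dinv) • ((2 * pairing (J.u 0) (J.u 1)) • J.u 1 - pairing (J.u 1) (J.u 1) • J.u 0)

/-- The covariant Hessian applied to `(u 1, u 1)`. -/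
noncomputable def hess (A : M) : M := J.d2 A (J.u 1) (J.u 1) - J.d1 A J.gam

theorem two_mul_threeHalves [CharZero 𝕂] : 2 * J.threeHalves = 3 := by
  have h2 : (2 : R) = algebraMap 𝕂 R 2 := (map_ofNat _ 2).symm
  rw [threeHalves, h2, ← map_mul, mul_div_cancel₀ _ (two_ne_zero' 𝕂), _root_.map_ofNat]

theorem map_threeHalves (D : LieDer 𝕂 R M) : D.onR J.threeHalves = 0 := D.onR.map_algebraMap _

theorem map_quad_eq_zero {D : LieDer 𝕂 R M} (hD : D.vec (J.u 0) = 0) (r : Fin (m + 1) → 𝕂) :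
    D.onR (J.quad r) = 0 := by
  have h0 : ∀ i, D.onR (J.u 0 i) = 0 := fun i => congrFun hD i
  simp [quad, J.map_dinv, hD, pairing_zero_right, h0, LieDer.map_ofNat, Derivation.leibniz_pow]

theorem rhs_eq (r : Fin (m + 1) → 𝕂) : rhs r J.u =
    J.u 3 - (6 * pairing (J.u 0) (J.u 1) * J.dinv) • J.u 2
      + (-6 * pairing (J.u 0) (J.u 2) * J.dinv
          + 24 * pairing (J.u 0) (J.u 1) ^ 2 * J.dinv ^ 2
          - 6 * pairing (J.u 0) (J.u 0) * pairing (J.u 1) (J.u 1) * J.dinv ^ 2) • J.u 1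
      + (6 * pairing (J.u 1) (J.u 2) * J.dinv
          - 12 * pairing (J.u 0) (J.u 1) * pairing (J.u 1) (J.u 1) * J.dinv ^ 2) • J.u 0
      + (J.threeHalves * J.quad r) • J.u 1 := by
  ext j
  simp only [rhs, Pi.add_apply, Pi.sub_apply, Pi.smul_apply, smul_eq_mul,
    Algebra.smul_def (3 / 2 : 𝕂), threeHalves, quad, dinv]
  ring

theorem pd_three_rhs (r : Fin (m + 1) → 𝕂) (j : Fin m) :
    (J.pd 3 j).vec (rhs r J.u) = Pi.single j 1 := by
  have hq := J.map_quad_eq_zero (D := J.pd 3 j) (by simp [pd_vec_u]) r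
  rw [J.rhs_eq]
  simp [LieDer.vec_add, LieDer.vec_sub, LieDer.vec_smul, pd_vec_u, LieDer.map_pairing, J.map_dinv,
    pairing_zero_left, pairing_zero_right, hq, J.map_threeHalves, Derivation.leibniz_pow,
    LieDer.map_ofNat]

theorem pd_two_rhs (r : Fin (m + 1) → 𝕂) (j : Fin m) :
    (J.pd 2 j).vec (rhs r J.u) = (-(6 * J.dinv)) • (pairing (J.u 0) (J.u 1) • Pi.single j 1
      + J.u 0 j • J.u 1 - J.u 1 j • J.u 0) := by
  have hq := J.map_quad_eq_zero (D := J.pd 2 j) (by simp [pd_vec_u]) r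
  rw [J.rhs_eq]
  simp only [LieDer.vec_add, LieDer.vec_sub, LieDer.vec_smul, pd_vec_u, LieDer.map_pairing,
    J.map_dinv, pairing_zero_left, pairing_zero_right, hq, J.map_threeHalves,
    Derivation.leibniz_pow, Derivation.leibniz, map_add, map_sub, map_neg, LieDer.map_ofNat,
    smul_eq_mul, pairing_single_right]
  simp [pairing_single_right, pairing_zero_left, pairing_zero_right]
  module

/-- The same vector as in `pd_two_rhs`, with 4 in place of 6. This ratio is the origin of the
coefficient 3/2 of the Hessian in B. -/
theorem pd_one_gam (j : Fin m) :
    (J.pd 1 j).vec J.gam = (-(4 * J.dinv)) • (pairing (J.u 0) (J.u 1) • Pi.single j 1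
      + J.u 0 j • J.u 1 - J.u 1 j • J.u 0) := by
  simp [gam, LieDer.vec_sub, LieDer.vec_smul, pd_vec_u, LieDer.map_pairing, J.map_dinv,
    pairing_zero_left, pairing_zero_right, pairing_single_left, pairing_single_right,
    LieDer.map_ofNat, LieDer.vec_neg]
  module

theorem vec_gam_eq_zero {D : LieDer 𝕂 R M} (h0 : D.vec (J.u 0) = 0) (h1 : D.vec (J.u 1) = 0) :
    D.vec J.gam = 0 := by
  simp [gam, LieDer.vec_sub, LieDer.vec_smul, h0, h1, LieDer.map_pairing, J.map_dinv,
    pairing_zero_left, pairing_zero_right, LieDer.map_ofNat, LieDer.vec_neg]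

variable {J}

theorem Ord.hess {A : M} (hA : J.Ord 0 A) : J.Ord 1 (J.hess A) := by
  refine Ord.sub (hA.d2 ?_ ?_) (hA.d1 ?_)
  · exact fun k hk i => J.pd_vec_u_ne (by omega) i
  · exact fun k hk i => J.pd_vec_u_ne (by omega) i
  · exact fun k hk i => J.vec_gam_eq_zero (J.pd_vec_u_ne (by omega) i) (J.pd_vec_u_ne (by omega) i)

theorem pd_one_hess {A : M} (hA : J.Ord 0 A) (j : Fin m) :
    (J.pd 1 j).onM (J.hess A) = (2 : R) • J.d2 A (J.u 1) (Pi.single j 1)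
      - J.d1 A ((J.pd 1 j).vec J.gam) := by
  rw [JetModel.hess, map_sub, (J.geom_pd 1 j).map_d2 hA, (J.geom_pd 1 j).map_d1 hA]
  simp [pd_vec_u, J.d2_comm A (J.u 1)]
  module

theorem D_of_ord_zero {A : M} (hA : J.Ord 0 A) : J.D.onM A = J.d1 A (J.u 1) := by
  rw [J.geom_D A hA, J.D_vec_u (by norm_num)]

theorem D_D_of_ord_zero {A : M} (hA : J.Ord 0 A) :
    J.D.onM (J.D.onM A) = J.d2 A (J.u 1) (J.u 1) + J.d1 A (J.u 2) := by
  rw [D_of_ord_zero hA, J.geom_D.map_d1 hA, J.D_vec_u (by norm_num), J.D_vec_u (by norm_num)]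

/-- The equation forces the dependence of `B` on `u 2` and `u 1`. -/
theorem exists_ord_zero [CharZero 𝕂] {r : Fin (m + 1) → 𝕂} {A B : M} (hA : J.Ord 0 A)
    (hB : J.Ord 2 B)
    (h : J.D.onM B - J.d1 A (rhs r J.u) + ⁅A, B⁆ = 0) :
    ∃ E, J.Ord 0 E ∧
      B = J.D.onM (J.D.onM A) + ⁅J.D.onM A, A⁆ - J.threeHalves • J.hess A + E := by
  have hu : ∀ l k : ℕ, l < k → ∀ i, (J.pd k i).vec (J.u l) = 0 := fun l k hk i =>
    J.pd_vec_u_ne (by omega) i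
  -- Derivative of the equation in u^j_3: `D` contributes ∂B/∂u_2, and u_3 enters the right-hand
  -- side of the system with coefficient one.
  have hB2 : ∀ j, (J.pd 2 j).onM B = (J.pd 0 j).onM A := by
    intro j
    have h3 := congrArg (J.pd 3 j).onM h
    rw [map_add, map_sub, J.pd_D (l := 2) (by norm_num) hB, (J.geom_pd 3 j).map_d1 hA,
      J.pd_three_rhs, LieDer.map_lie, hA 3 (by norm_num), hB 3 (by norm_num), d1_single,
      J.pd_vec_u_ne (by norm_num)] at h3
    simpa [sub_eq_zero] using h3
  set B0 := J.D.onM (J.D.onM A) + ⁅J.D.onM A, A⁆ with hB0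
  have hDA : J.Ord 1 (J.D.onM A) := by
    rw [D_of_ord_zero hA]; exact hA.d1 (hu 1)
  have hord2 : J.Ord 2 B0 := by
    rw [hB0, D_D_of_ord_zero hA]
    refine ((hA.d2 ?_ ?_).add (hA.d1 ?_)).add ((hDA.mono (by norm_num)).lie (hA.mono (by norm_num)))
    · exact fun k hk i => hu 1 k (by omega) i
    · exact fun k hk i => hu 1 k (by omega) i
    · exact hu 2
  have hB' : J.Ord 1 (B - B0) := by
    intro k hk j
    rcases Nat.lt_or_ge 2 k with hk2 | hk2
    · exact (hB.sub hord2) k hk2 j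
    · obtain rfl : k = 2 := by omega
      rw [map_sub, hB2, hB0, map_add, LieDer.map_lie, hDA 2 (by norm_num), hA 2 (by norm_num),
        D_D_of_ord_zero hA, map_add, (J.geom_pd 2 j).map_d2 hA, (J.geom_pd 2 j).map_d1 hA]
      simp [pd_vec_u, d1_single]
  -- The equation rewritten for the remainder `B - B0`, which no longer involves u_2.
  have hDB' : J.D.onM (B - B0) = J.d1 A (rhs r J.u) - J.d3 A (J.u 1) (J.u 1) (J.u 1)
      - (3 : R) • J.d2 A (J.u 1) (J.u 2) - J.d1 A (J.u 3) - ⁅A, B - B0⁆ - ⁅A, ⁅J.D.onM A, A⁆⁆ := by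
    have e1 : J.D.onM B = J.d1 A (rhs r J.u) - ⁅A, B⁆ := by
      rw [eq_sub_iff_add_eq, ← sub_eq_zero, ← h]; abel
    have e2 : J.D.onM B0 = J.d3 A (J.u 1) (J.u 1) (J.u 1) + (3 : R) • J.d2 A (J.u 1) (J.u 2)
        + J.d1 A (J.u 3) + ⁅J.D.onM (J.D.onM A), A⁆ := by
      rw [hB0, map_add, LieDer.map_lie, lie_self, add_zero, D_D_of_ord_zero hA, map_add,
        J.geom_D.map_d2 hA, J.geom_D.map_d1 hA, J.D_vec_u (by norm_num), J.D_vec_u (by norm_num),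
        J.D_vec_u (by norm_num), J.d2_comm A (J.u 2)]
      module
    rw [map_sub, e1, e2, lie_sub, hB0, lie_add, ← lie_skew A (J.D.onM (J.D.onM A))]
    abel
  refine ⟨B - B0 + J.threeHalves • J.hess A, ?_, by rw [hB0]; abel⟩
  intro k hk j
  have hH : J.Ord 1 (J.threeHalves • J.hess A) :=
    Ord.smul (fun k _ i => J.map_threeHalves _) hA.hess
  rcases Nat.lt_or_ge 1 k with hk1 | hk1
  · exact (hB'.add hH) k hk1 j
  · obtain rfl : k = 1 := by omega
    have hF := J.pd_two_rhs r j
    -- By `pd_D` this computes ∂/∂u^j_1 of the remainder. The brackets have order at most one and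
    -- drop out.
    have e := congrArg (J.pd 2 j).onM hDB'
    rw [J.pd_D (l := 1) (by norm_num) hB'] at e
    simp only [map_sub, LieDer.map_smul, LieDer.map_lie, hB' 2 (by norm_num), hA 2 (by norm_num),
      hDA 2 (by norm_num), (J.geom_pd 2 j).map_d2 hA, (J.geom_pd 2 j).map_d1 hA, hF,
      (J.geom_pd 2 j).map_d2 hA, LieDer.map_ofNat] at e
    rw [map_add, map_sub, e, LieDer.map_smul, J.map_threeHalves, pd_one_hess hA, J.pd_one_gam]
    have h3 : (J.pd 2 j).onM (J.d3 A (J.u 1) (J.u 1) (J.u 1)) = 0 := by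
      rw [(J.geom_pd 2 j).map_d3_of_vec_eq_zero (J.pd_vec_u_ne (by norm_num) j) hA]
      simp [pd_vec_u]
    rw [h3]
    have ht := J.two_mul_threeHalves
    simp [pd_vec_u]
    -- All numerals are expressed through t = 3/2, using 2t = 3, so that `module` compares
    -- polynomials in t.
    have h6 : (6 : R) = 4 * J.threeHalves := by linear_combination -2 * ht
    rw [h6, ← ht]
    module

/-- The part of the equation which is cubic in `u 1`. -/
noncomputable def cubicPart (J : JetModel 𝕂 R L M m) (A : M) : M :=
  -J.d3 A (J.u 1) (J.u 1) (J.u 1) + (3 : R) • J.d2 A (J.u 1) J.gam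
    + J.d1 A ((-24 * pairing (J.u 0) (J.u 1) ^ 2 * J.dinv ^ 2
        - 6 * pairing (J.u 1) (J.u 1) * J.dinv
        + 12 * pairing (J.u 0) (J.u 0) * pairing (J.u 1) (J.u 1) * J.dinv ^ 2) • J.u 1
      + (12 * pairing (J.u 0) (J.u 1) * pairing (J.u 1) (J.u 1) * J.dinv ^ 2) • J.u 0)

/-- The part of the equation which is linear in `u 1`. -/
noncomputable def linearPart (J : JetModel 𝕂 R L M m) (r : Fin (m + 1) → 𝕂) (A E : M) : M :=
  (2 : R) • J.d1 E (J.u 1) - (3 * J.quad r) • J.d1 A (J.u 1)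
    + (2 : R) • ⁅A, ⁅J.d1 A (J.u 1), A⁆⁆

theorem D_vec_gam : J.D.vec J.gam =
    (8 * pairing (J.u 0) (J.u 1) ^ 2 * J.dinv ^ 2 - 2 * pairing (J.u 1) (J.u 1) * J.dinv) • J.u 1
      - (4 * pairing (J.u 0) (J.u 1) * pairing (J.u 1) (J.u 1) * J.dinv ^ 2) • J.u 0
      - (2 * J.dinv) • ((2 * pairing (J.u 0) (J.u 2)) • J.u 1
        + (2 * pairing (J.u 0) (J.u 1)) • J.u 2 - (2 * pairing (J.u 1) (J.u 2)) • J.u 0) := by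
  simp only [gam, LieDer.vec_neg, LieDer.vec_sub, LieDer.vec_smul, LieDer.map_pairing, J.map_dinv,
    map_neg, Derivation.leibniz, LieDer.map_ofNat, smul_eq_mul,
    J.D_vec_u (show 0 < 3 by norm_num), J.D_vec_u (show 1 < 3 by norm_num), zero_add,
    pairing_comm (J.u 2) (J.u 1)]
  module

/-- The equation, for `B` of the form found in `exists_ord_zero`, sorted by degree in `u 1`. -/
theorem two_smul_equation [CharZero 𝕂] {r : Fin (m + 1) → 𝕂} {A B E : M} (hA : J.Ord 0 A)
    (hE : J.Ord 0 E)
    (hB : B = J.D.onM (J.D.onM A) + ⁅J.D.onM A, A⁆ - J.threeHalves • J.hess A + E) :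
    (2 : R) • (J.D.onM B - J.d1 A (rhs r J.u) + ⁅A, B⁆) =
      J.cubicPart A - (3 : R) • ⁅A, J.hess A⁆ + J.linearPart r A E + (2 : R) • ⁅A, E⁆ := by
  have hu0 := J.D_vec_u (show 0 < 3 by norm_num)
  have hu1 := J.D_vec_u (show 1 < 3 by norm_num)
  have hu2 := J.D_vec_u (show 2 < 3 by norm_num)
  have e1 : J.D.onM (J.D.onM (J.D.onM A)) = J.d3 A (J.u 1) (J.u 1) (J.u 1)
      + (3 : R) • J.d2 A (J.u 1) (J.u 2) + J.d1 A (J.u 3) := by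
    rw [D_D_of_ord_zero hA, map_add, J.geom_D.map_d2 hA, J.geom_D.map_d1 hA, hu0, hu1, hu2,
      J.d2_comm A (J.u 2)]
    module
  have e2 : J.D.onM (J.hess A) = J.d3 A (J.u 1) (J.u 1) (J.u 1)
      + (2 : R) • J.d2 A (J.u 1) (J.u 2) - J.d2 A (J.u 1) J.gam - J.d1 A (J.D.vec J.gam) := by
    rw [hess, map_sub, J.geom_D.map_d2 hA, J.geom_D.map_d1 hA, hu0, hu1, J.d2_comm A (J.u 2)]
    module
  have e3 : ⁅A, J.D.onM (J.D.onM A)⁆ = -⁅J.D.onM (J.D.onM A), A⁆ := (lie_skew _ _).symm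
  have ht := J.two_mul_threeHalves
  rw [hB, map_add, map_sub, map_add, LieDer.map_lie, lie_self, add_zero, e1, LieDer.map_smul,
    J.map_threeHalves, e2, D_of_ord_zero hE, J.rhs_eq, D_vec_gam, lie_add, lie_sub, lie_add, e3,
    lie_smul, cubicPart, linearPart, D_of_ord_zero hA]
  -- Doubled, D³A contributes 2 and −(3/2) D(hess A) contributes −3 to the coefficient of the third
  -- differential.
  have hd : -J.d3 A (J.u 1) (J.u 1) (J.u 1)
      = (2 - 2 * J.threeHalves) • J.d3 A (J.u 1) (J.u 1) (J.u 1) := by rw [ht]; module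
  rw [hd]
  simp only [map_add, map_sub, map_smul, ← ht]
  have h6 : (6 : R) = 4 * J.threeHalves := by linear_combination -2 * ht
  have h12 : (12 : R) = 8 * J.threeHalves := by linear_combination -4 * ht
  have h24 : (24 : R) = 16 * J.threeHalves := by linear_combination -8 * ht
  rw [h6, h12, h24]
  module

/-! ### Separation of the equation by degree in u_1 -/

variable (J)

/-- The Euler operator of the variables `u 1`. -/
def euler : LieDer 𝕂 R M := J.field 2 fun k => if k = 1 then J.u 1 else 0

theorem euler_vec_u_zero : J.euler.vec (J.u 0) = 0 := by
  rw [euler, field_vec_u]; simp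

theorem euler_vec_u_one : J.euler.vec (J.u 1) = J.u 1 := by
  rw [euler, field_vec_u]; simp

theorem geom_euler : J.Geom J.euler := J.geom_field _ _

variable {J}

theorem euler_of_ord_zero {A : M} (hA : J.Ord 0 A) : J.euler.onM A = 0 := by
  rw [J.geom_euler A hA, J.euler_vec_u_zero, map_zero]

theorem euler_vec_gam : J.euler.vec J.gam = (2 : R) • J.gam := by
  simp only [gam, LieDer.vec_neg, LieDer.vec_sub, LieDer.vec_smul, LieDer.map_pairing, J.map_dinv,
    map_neg, Derivation.leibniz, LieDer.map_ofNat, smul_eq_mul, euler_vec_u_zero, euler_vec_u_one,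
    pairing_zero_left, pairing_zero_right]
  module

theorem euler_hess {A : M} (hA : J.Ord 0 A) : J.euler.onM (J.hess A) = (2 : R) • J.hess A := by
  rw [hess, map_sub, J.geom_euler.map_d2 hA, J.geom_euler.map_d1 hA, euler_vec_u_zero,
    euler_vec_u_one, euler_vec_gam]
  simp only [map_smul, map_zero, LinearMap.zero_apply]
  module

theorem euler_cubicPart {A : M} (hA : J.Ord 0 A) :
    J.euler.onM (J.cubicPart A) = (3 : R) • J.cubicPart A := by
  rw [cubicPart, map_add, map_add, map_neg, LieDer.map_smul, J.geom_euler.map_d2 hA,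
    J.geom_euler.map_d1 hA, J.geom_euler.map_d3_of_vec_eq_zero J.euler_vec_u_zero hA]
  simp only [LieDer.vec_neg, LieDer.vec_sub, LieDer.vec_add, LieDer.vec_smul, LieDer.map_pairing,
    J.map_dinv, euler_vec_gam, Derivation.leibniz_pow,
    map_neg, map_add, map_sub, Derivation.leibniz, LieDer.map_ofNat, smul_eq_mul, euler_vec_u_zero,
    euler_vec_u_one, pairing_zero_left, pairing_zero_right, map_smul, map_zero,
    LinearMap.zero_apply]
  module

theorem euler_linearPart {r : Fin (m + 1) → 𝕂} {A E : M} (hA : J.Ord 0 A) (hE : J.Ord 0 E) :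
    J.euler.onM (J.linearPart r A E) = J.linearPart r A E := by
  rw [linearPart, map_add, map_sub, LieDer.map_smul, LieDer.map_smul, LieDer.map_smul,
    LieDer.map_lie, LieDer.map_lie, J.geom_euler.map_d1 hA, J.geom_euler.map_d1 hE,
    euler_of_ord_zero hA, euler_vec_u_zero, euler_vec_u_one, Derivation.leibniz,
    J.map_quad_eq_zero J.euler_vec_u_zero]
  simp only [LieDer.map_ofNat, map_zero, LinearMap.zero_apply, smul_zero, zero_smul, zero_add,
    zero_lie, lie_zero, add_zero]

theorem eq_zero_of_natCast_smul [CharZero 𝕂] {k : ℕ} (hk : k ≠ 0) {x : M} (h : (k : R) • x = 0) :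
    x = 0 := by
  have h1 : algebraMap 𝕂 R ((k : 𝕂)⁻¹) * (k : R) = 1 := by
    rw [← map_natCast (algebraMap 𝕂 R) k, ← map_mul, inv_mul_cancel₀ (Nat.cast_ne_zero.2 hk),
      map_one]
  rw [← one_smul R x, ← h1, mul_smul, h, smul_zero]

theorem eq_zero_of_ofNat_smul [CharZero 𝕂] {k : ℕ} [k.AtLeastTwo] {x : M}
    (h : (ofNat(k) : R) • x = 0) : x = 0 :=
  eq_zero_of_natCast_smul (𝕂 := 𝕂) (R := R) (k := OfNat.ofNat k) (NeZero.ne k)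
    (by rw [Nat.cast_ofNat]; exact h)

/-- The parts of the equation of different degree vanish separately. -/
theorem parts_eq_zero [CharZero 𝕂] {r : Fin (m + 1) → 𝕂} {A E : M} (hA : J.Ord 0 A)
    (hE : J.Ord 0 E)
    (h : J.cubicPart A - (3 : R) • ⁅A, J.hess A⁆ + J.linearPart r A E + (2 : R) • ⁅A, E⁆ = 0) :
    J.cubicPart A = 0 ∧ ⁅A, J.hess A⁆ = 0 ∧ J.linearPart r A E = 0 ∧ ⁅A, E⁆ = 0 := by
  have c3 := euler_cubicPart hA
  have c2 : J.euler.onM ⁅A, J.hess A⁆ = (2 : R) • ⁅A, J.hess A⁆ := by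
    rw [LieDer.map_lie, euler_of_ord_zero hA, euler_hess hA, zero_lie, zero_add, lie_smul]
  have c1 := euler_linearPart (r := r) hA hE
  have c0 : J.euler.onM ⁅A, E⁆ = 0 := by
    rw [LieDer.map_lie, euler_of_ord_zero hA, euler_of_ord_zero hE, zero_lie, lie_zero, zero_add]
  generalize J.cubicPart A = x3 at *
  generalize ⁅A, J.hess A⁆ = x2 at *
  generalize J.linearPart r A E = x1 at *
  generalize ⁅A, E⁆ = x0 at *
  have h1 := congrArg J.euler.onM h
  simp only [map_add, map_sub, LieDer.map_smul, c3, c2, c1, c0, LieDer.map_ofNat, map_zero,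
    zero_smul, zero_add, smul_zero, add_zero] at h1
  have h2 := congrArg J.euler.onM h1
  simp only [map_add, map_sub, LieDer.map_smul, c3, c2, c1, c0, LieDer.map_ofNat, map_zero,
    zero_smul, zero_add, smul_zero, add_zero] at h2
  have h3 := congrArg J.euler.onM h2
  simp only [map_add, map_sub, LieDer.map_smul, c3, c2, c1, c0, LieDer.map_ofNat, map_zero,
    zero_smul, zero_add, smul_zero, add_zero] at h3
  -- With θ the Euler operator, `h3 - 3 h2 + 2 h1` is θ(θ−1)(θ−2) applied to `h`. It kills degrees
  -- 0, 1, 2 and multiplies degree 3 by 6.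
  have e3 : x3 = 0 := eq_zero_of_ofNat_smul (𝕂 := 𝕂) (R := R) (k := 6) (by
    linear_combination (norm := module) h3 - (3 : R) • h2 + (2 : R) • h1)
  subst e3
  have e2 : x2 = 0 := eq_zero_of_ofNat_smul (𝕂 := 𝕂) (R := R) (k := 6) (by
    linear_combination (norm := module) h1 - h2)
  subst e2
  have e1 : x1 = 0 := by simpa using h1
  subst e1
  exact ⟨rfl, rfl, rfl, eq_zero_of_ofNat_smul (𝕂 := 𝕂) (R := R) (k := 2) (by simpa using h)⟩

end JetModel

/-! ### The cubic part: ΔA is affine in u and ⟨u,u⟩ -/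

namespace JetModel

variable {𝕂 R L M : Type*} [Field 𝕂] [CommRing R] [Algebra 𝕂 R] [LieRing L]
  [LieAlgebra 𝕂 L] [LieRing M] [LieAlgebra R M] [Module 𝕂 M] {m : ℕ}
  {J : JetModel 𝕂 R L M m}

theorem ord_dinv_smul {P : M} (hP : J.Ord 0 P) : J.Ord 0 (J.dinv • P) :=
  Ord.smul (fun k hk i => by
    rw [J.map_dinv, J.pd_vec_u_ne (by omega), pairing_zero_right]; simp) hP

/-- The field ∑ wᵢ ∂/∂u^i turns the differential in direction `w` into a derivation, so the product
rule gives the formula. The second and third differentials are treated alike. -/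
theorem d1_dinv_smul {P : M} (hP : J.Ord 0 P) (w : Fin m → R) :
    J.d1 (J.dinv • P) w
      = J.dinv • J.d1 P w - (2 * pairing (J.u 0) w * J.dinv ^ 2) • P := by
  have hG := J.geom_field 1 fun _ => w
  have hv : (J.field 1 fun _ => w).vec (J.u 0) = w := by rw [field_vec_u]; simp
  have h := hG _ (ord_dinv_smul hP)
  rw [hv] at h
  rw [← h, LieDer.map_smul, hG P hP, J.map_dinv, hv]
  module

theorem d2_dinv_smul {P : M} (hP : J.Ord 0 P) (v w : Fin m → R) :
    J.d2 (J.dinv • P) v w = J.dinv • J.d2 P v w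
      - (2 * pairing (J.u 0) v * J.dinv ^ 2) • J.d1 P w
      - (2 * pairing (J.u 0) w * J.dinv ^ 2) • J.d1 P v
      + (8 * pairing (J.u 0) v * pairing (J.u 0) w * J.dinv ^ 3
          - 2 * pairing v w * J.dinv ^ 2) • P := by
  have hG := J.geom_field 1 fun _ => v
  set D := J.field 1 fun _ => v
  have hv : D.vec (J.u 0) = v := by rw [field_vec_u]; simp
  have h := congrArg D.onM (d1_dinv_smul hP w)
  rw [hG.map_d1 (ord_dinv_smul hP), hv, d1_dinv_smul hP, map_sub, LieDer.map_smul, LieDer.map_smul,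
    hG.map_d1 hP, hG P hP, hv] at h
  simp only [J.map_dinv, Derivation.leibniz, Derivation.leibniz_pow, LieDer.map_ofNat,
    LieDer.map_pairing, hv, smul_eq_mul] at h
  linear_combination (norm := module) h

/-- The hypothesis on `v` discards derivatives of the direction itself. It is met by `u 1`, since
the field only differentiates in u_0. -/
theorem d3_dinv_smul {P : M} (hP : J.Ord 0 P) (v : Fin m → R)
    (hv0 : (J.field 1 fun _ => v).vec v = 0) :
    J.d3 (J.dinv • P) v v v = J.dinv • J.d3 P v v v
      - (6 * pairing (J.u 0) v * J.dinv ^ 2) • J.d2 P v v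
      + (24 * pairing (J.u 0) v ^ 2 * J.dinv ^ 3 - 6 * pairing v v * J.dinv ^ 2) • J.d1 P v
      + (24 * pairing (J.u 0) v * pairing v v * J.dinv ^ 3
          - 48 * pairing (J.u 0) v ^ 3 * J.dinv ^ 4) • P := by
  have hG := J.geom_field 1 fun _ => v
  set D := J.field 1 fun _ => v
  have hv : D.vec (J.u 0) = v := by rw [field_vec_u]; simp
  have h := congrArg D.onM (d2_dinv_smul hP v v)
  rw [hG.map_d2 (ord_dinv_smul hP), hv, hv0, map_add, map_sub, map_sub, LieDer.map_smul,
    LieDer.map_smul, LieDer.map_smul, hG.map_d1 hP, hG.map_d2 hP, hG P hP, hv, hv0] at h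
  simp only [J.map_dinv, Derivation.leibniz, Derivation.leibniz_pow, LieDer.map_ofNat, map_sub,
    LieDer.map_pairing, hv, hv0, smul_eq_mul, map_zero, LinearMap.zero_apply, pairing_zero_left,
    pairing_zero_right, LieDer.map_smul] at h
  linear_combination (norm := module) h

theorem hess_dinv_smul {P : M} (hP : J.Ord 0 P) :
    J.hess (J.dinv • P) = J.dinv • J.d2 P (J.u 1) (J.u 1)
      + (2 * J.dinv ^ 2 * pairing (J.u 1) (J.u 1)) • (P - J.d1 P (J.u 0))
      - (4 * J.dinv ^ 2 * pairing (J.u 1) (J.u 1)) • (J.dinv • P) := by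
  have hδ := J.delta_mul_dinv
  rw [hess, d2_dinv_smul hP, gam]
  simp only [map_smul, map_sub, d1_dinv_smul hP, pairing_smul_right, pairing_sub_right]
  match_scalars
  · ring
  · ring
  · linear_combination (4 * J.dinv ^ 2 * pairing (J.u 1) (J.u 1)) * hδ
  · ring

/-- The purpose of the substitution A = Δ⁻¹P: all terms with P itself or its first derivatives
cancel. -/
theorem cubicPart_dinv_smul {P : M} (hP : J.Ord 0 P) :
    J.cubicPart (J.dinv • P) = -J.dinv • (J.d3 P (J.u 1) (J.u 1) (J.u 1)
      - (6 * J.dinv * pairing (J.u 1) (J.u 1)) • J.d2 P (J.u 0) (J.u 1)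
      + (6 * J.dinv * pairing (J.u 0) (J.u 1)) • J.d2 P (J.u 1) (J.u 1)) := by
  have hδ := J.delta_mul_dinv
  have hv0 : (J.field 1 fun _ => J.u 1).vec (J.u 1) = 0 := by rw [field_vec_u]; simp
  rw [cubicPart, d3_dinv_smul hP _ hv0, gam]
  simp only [map_smul, map_sub, map_add, d1_dinv_smul hP, d2_dinv_smul hP,
    J.d2_comm P (J.u 1) (J.u 0), pairing_comm (J.u 1) (J.u 0), pairing_smul_right,
    pairing_sub_right, pairing_add_right]
  generalize J.dinv = δ at *
  generalize pairing (J.u 0) (J.u 0) = a at *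
  generalize pairing (J.u 0) (J.u 1) = b at *
  generalize pairing (J.u 1) (J.u 1) = c at *
  match_scalars <;> grind


/-- The vector field `∑ wᵢ ∂/∂u^i_1`. -/
def vfield (J : JetModel 𝕂 R L M m) (w : Fin m → R) : LieDer 𝕂 R M :=
  J.field 2 fun k => if k = 1 then w else 0

theorem vfield_vec_u_zero (w : Fin m → R) : (J.vfield w).vec (J.u 0) = 0 := by
  rw [vfield, field_vec_u]; simp

theorem vfield_vec_u_one (w : Fin m → R) : (J.vfield w).vec (J.u 1) = w := by
  rw [vfield, field_vec_u]; simp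

theorem vfield_vec_eq_zero (w : Fin m → R) {v : Fin m → R}
    (hv : ∀ i, (J.pd 1 i).vec v = 0) : (J.vfield w).vec v = 0 := by
  ext j
  have : ∀ i, (J.pd 1 i).onR (v j) = 0 := fun i => congrFun (hv i) j
  rw [LieDer.vec_apply, vfield, field_onR]
  simp [Finset.sum_range_succ, this]

theorem geom_vfield (w : Fin m → R) : J.Geom (J.vfield w) := J.geom_field _ _

theorem vfield_d3 {P : M} (hP : J.Ord 0 P) (w v v' v'' : Fin m → R) :
    (J.vfield w).onM (J.d3 P v v' v'') = J.d3 P ((J.vfield w).vec v) v' v''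
      + J.d3 P v ((J.vfield w).vec v') v'' + J.d3 P v v' ((J.vfield w).vec v'') :=
  (J.geom_vfield w).map_d3_of_vec_eq_zero (J.vfield_vec_u_zero w) hP v v' v''

theorem vfield_d2 {P : M} (hP : J.Ord 0 P) (w v v' : Fin m → R) :
    (J.vfield w).onM (J.d2 P v v') = J.d2 P ((J.vfield w).vec v) v'
      + J.d2 P v ((J.vfield w).vec v') := by
  rw [(J.geom_vfield w).map_d2 hP, vfield_vec_u_zero]; simp

/-- The polarized form of the cubic part of the equation. -/
theorem delta_smul_d3 [CharZero 𝕂] {P : M} (hP : J.Ord 0 P)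
    (h : J.cubicPart (J.dinv • P) = 0) {w₁ w₂ w₃ : Fin m → R}
    (h₁ : ∀ i, (J.pd 1 i).vec w₁ = 0) (h₂ : ∀ i, (J.pd 1 i).vec w₂ = 0) :
    (1 + pairing (J.u 0) (J.u 0)) • J.d3 P w₁ w₂ w₃ =
      (2 : R) • (pairing w₁ w₂ • J.d2 P (J.u 0) w₃ + pairing w₂ w₃ • J.d2 P (J.u 0) w₁
        + pairing w₁ w₃ • J.d2 P (J.u 0) w₂)
      - (2 : R) • (pairing (J.u 0) w₁ • J.d2 P w₂ w₃ + pairing (J.u 0) w₂ • J.d2 P w₁ w₃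
        + pairing (J.u 0) w₃ • J.d2 P w₁ w₂) := by
  have hδ := J.delta_mul_dinv
  -- The cubic part multiplied by −Δ², which clears the denominators.
  have h0 : (1 + pairing (J.u 0) (J.u 0)) • J.d3 P (J.u 1) (J.u 1) (J.u 1)
      - (6 * pairing (J.u 1) (J.u 1)) • J.d2 P (J.u 0) (J.u 1)
      + (6 * pairing (J.u 0) (J.u 1)) • J.d2 P (J.u 1) (J.u 1) = 0 := by
    rw [cubicPart_dinv_smul hP] at h
    have h' := congrArg (fun x => -(1 + pairing (J.u 0) (J.u 0)) ^ 2 • x) h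
    simp only [smul_zero] at h'
    rw [← h']
    match_scalars
    · linear_combination (-(1 + pairing (J.u 0) (J.u 0))) * hδ
    · linear_combination (6 * pairing (J.u 1) (J.u 1)) *
        ((1 + pairing (J.u 0) (J.u 0)) * J.dinv + 1) * hδ
    · linear_combination (-6 * pairing (J.u 0) (J.u 1)) *
        ((1 + pairing (J.u 0) (J.u 0)) * J.dinv + 1) * hδ
  have hz := J.vfield_vec_u_zero (M := M)
  have ho := J.vfield_vec_u_one (M := M)
  -- Three derivatives in u_1 polarize the cubic form and produce the factor 3! = 6. The directions
  -- `w₁` and `w₂` get differentiated again, so they must not depend on u_1.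
  have e1 := congrArg (J.vfield w₁).onM h0
  simp only [map_add, map_sub, LieDer.map_smul, vfield_d3 hP, vfield_d2 hP, hz, ho,
    LieDer.map_pairing, Derivation.leibniz, LieDer.map_ofNat, Derivation.map_one_eq_zero,
    smul_eq_mul, map_zero, LinearMap.zero_apply, pairing_zero_left, pairing_zero_right,
    J.d3_comm_left P (J.u 1) w₁, J.d3_comm_right P (J.u 1) (J.u 1) w₁, J.d2_comm P (J.u 1) w₁,
    pairing_comm (J.u 1) w₁] at e1
  have e2 := congrArg (J.vfield w₂).onM e1
  simp only [map_add, map_sub, LieDer.map_smul, vfield_d3 hP, vfield_d2 hP, hz, ho,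
    LieDer.map_pairing, Derivation.leibniz, LieDer.map_ofNat, Derivation.map_one_eq_zero,
    smul_eq_mul, map_zero, LinearMap.zero_apply, pairing_zero_left, pairing_zero_right,
    vfield_vec_eq_zero w₂ h₁, J.d3_comm_right P w₁ (J.u 1) w₂, J.d2_comm P (J.u 1) w₂] at e2
  have e3 := congrArg (J.vfield w₃).onM e2
  simp only [map_add, map_sub, LieDer.map_smul, vfield_d3 hP, vfield_d2 hP, hz, ho,
    LieDer.map_pairing, Derivation.leibniz, LieDer.map_ofNat, Derivation.map_one_eq_zero,
    smul_eq_mul, map_zero, LinearMap.zero_apply, pairing_zero_left, pairing_zero_right,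
    vfield_vec_eq_zero w₃ h₁, vfield_vec_eq_zero w₃ h₂, pairing_comm w₃ w₂] at e3
  rw [← sub_eq_zero]
  refine eq_zero_of_ofNat_smul (𝕂 := 𝕂) (R := R) (k := 6) ?_
  linear_combination (norm := module) e3


theorem pd_vec_single (k : ℕ) (i j : Fin m) : (J.pd k i).vec (Pi.single j (1 : R)) = 0 := by
  ext l
  rw [LieDer.vec_apply, Pi.single_apply]
  split_ifs <;> simp

theorem pd_d1_u {x : M} (hx : J.Ord 0 x) (k : Fin m) :
    (J.pd 0 k).onM (J.d1 x (J.u 0))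
      = J.d1 ((J.pd 0 k).onM x) (J.u 0) + (J.pd 0 k).onM x := by
  rw [(J.geom_pd 0 k).map_d1 hx, pd_vec_u_self, d2_single, d1_single]

theorem delta_cancel {x : M} (h : (1 + pairing (J.u 0) (J.u 0)) • x = 0) : x = 0 := by
  rw [← one_smul R x, ← J.delta_mul_dinv, mul_comm, mul_smul, h, smul_zero]

theorem pd_pairing_u (k : Fin m) :
    (J.pd 0 k).onR (pairing (J.u 0) (J.u 0)) = 2 * J.u 0 k := by
  rw [LieDer.map_pairing, pd_vec_u_self, pairing_single_left, pairing_single_right]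
  ring

section Components

variable [CharZero 𝕂] {P : M} (hP : J.Ord 0 P) (h : J.cubicPart (J.dinv • P) = 0)
include hP h

theorem delta_smul_pd_pd_pd (i k : Fin m) :
    (1 + pairing (J.u 0) (J.u 0)) • (J.pd 0 k).onM ((J.pd 0 i).onM ((J.pd 0 i).onM P)) =
      (2 : R) • (J.d1 ((J.pd 0 k).onM P) (J.u 0)
        + (if i = k then (2 : R) else 0) • J.d1 ((J.pd 0 i).onM P) (J.u 0))
      - (2 : R) • ((2 * J.u 0 i) • (J.pd 0 k).onM ((J.pd 0 i).onM P)
        + J.u 0 k • (J.pd 0 i).onM ((J.pd 0 i).onM P)) := by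
  have e := delta_smul_d3 hP h (w₃ := Pi.single k 1) (fun l => pd_vec_single 1 l i)
    (fun l => pd_vec_single 1 l i)
  simp only [J.d2_comm P (J.u 0), d3_single, d2_single, d1_single, pairing_single_left,
    pairing_single_right, mul_one, one_mul] at e
  rw [e]
  by_cases hik : i = k
  · subst hik; simp; module
  · simp [hik]; module

/-- Compatibility: ∂_k of the equation for ∂_i³P and ∂_i of the one for ∂_k∂_i²P contain the same
fourth derivative. Their difference relates y = ∂_k∂_iP to its radial derivative z, and the
polarized identity in the direction u gives a second such relation. -/
theorem pd_pd_eq_zero {i k : Fin m} (hik : i ≠ k) :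
    (J.pd 0 k).onM ((J.pd 0 i).onM P) = 0 := by
  have hc : ∀ x, (J.pd 0 i).onM ((J.pd 0 k).onM x) = (J.pd 0 k).onM ((J.pd 0 i).onM x) :=
    J.pd_comm 0 i 0 k
  have e1 := congrArg (J.pd 0 k).onM (delta_smul_pd_pd_pd hP h i i)
  have e2 := congrArg (J.pd 0 i).onM (delta_smul_pd_pd_pd hP h i k)
  have f2 := delta_smul_pd_pd_pd hP h i k
  have e3 := delta_smul_d3 hP h (w₃ := J.u 0) (fun l => pd_vec_single 1 l i)
    (fun l => pd_vec_single 1 l k)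
  simp only [J.d2_comm P (J.u 0), d3_single, d2_single, d1_single, pairing_single_left,
    pairing_single_right, mul_one, one_mul, Pi.single_apply, if_neg hik, if_neg hik.symm,
    hc] at e3
  simp only [if_neg hik, if_true, LieDer.map_smul, LieDer.map_ofNat, map_add, map_sub, pd_pairing_u,
    Derivation.map_one_eq_zero,
    pd_d1_u (hP.pd 0 i), pd_d1_u (hP.pd 0 k), hc, Derivation.leibniz, smul_eq_mul, J.pd_u,
    if_neg hik, if_neg hik.symm, and_false, and_true, true_and, map_zero] at e1 e2 f2
  set y := (J.pd 0 k).onM ((J.pd 0 i).onM P)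
  set z := J.d1 y (J.u 0)
  have hz : (4 : R) • z + (8 : R) • y = 0 := by
    linear_combination (norm := module) e2 - e1
  refine eq_zero_of_ofNat_smul (𝕂 := 𝕂) (R := R) (k := 8) ?_
  -- Here `e3` amounts to Δz = −2⟨u,u⟩y. Eliminating z from 4z + 8y = 0 leaves 8(Δ − ⟨u,u⟩)y = 8y.
  linear_combination (norm := module) (1 + pairing (J.u 0) (J.u 0)) • hz - (4 : R) • e3

theorem d1_pd_u (i : Fin m) :
    J.d1 ((J.pd 0 i).onM P) (J.u 0) = J.u 0 i • (J.pd 0 i).onM ((J.pd 0 i).onM P) := by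
  rw [d1_apply, Finset.sum_eq_single i]
  · intro k _ hki
    rw [pd_pd_eq_zero hP h (Ne.symm hki), smul_zero]
  · simp

/-- Only i = j = k remains. There the radial derivative of ∂_iP is u^i ∂_i²P, and the two sides of
the equation for Δ∂_i³P cancel. -/
theorem pd_pd_pd_eq_zero (i j k : Fin m) :
    (J.pd 0 k).onM ((J.pd 0 j).onM ((J.pd 0 i).onM P)) = 0 := by
  by_cases hij : i = j
  · subst hij
    by_cases hik : i = k
    · subst hik
      apply delta_cancel (J := J)
      rw [delta_smul_pd_pd_pd hP h, if_pos rfl, d1_pd_u hP h]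
      module
    · rw [J.pd_comm, pd_pd_eq_zero hP h hik, map_zero]
  · rw [pd_pd_eq_zero hP h hij, map_zero]

theorem pd_pd_eq (i k : Fin m) :
    (J.pd 0 k).onM ((J.pd 0 k).onM P) = (J.pd 0 i).onM ((J.pd 0 i).onM P) := by
  by_cases hik : i = k
  · rw [hik]
  have e := delta_smul_pd_pd_pd hP h i k
  rw [if_neg hik, d1_pd_u hP h k, pd_pd_eq_zero hP h hik, pd_pd_pd_eq_zero hP h] at e
  -- The equation has become u^k(∂_k²P − ∂_i²P) = 0. As third derivatives vanish, ∂_k removes the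
  -- factor u^k, which need not be invertible.
  have e' := congrArg (J.pd 0 k).onM e
  simp only [LieDer.map_smul, LieDer.map_ofNat, map_add, map_sub, map_zero, J.pd_u,
    pd_pd_pd_eq_zero hP h, smul_zero, and_self, if_true, zero_smul] at e'
  rw [← sub_eq_zero]
  refine eq_zero_of_ofNat_smul (𝕂 := 𝕂) (R := R) (k := 2) ?_
  linear_combination (norm := module) -e'

omit hP h in
theorem ord_u (k : ℕ) (hk : 0 < k) (i j : Fin m) : (J.pd k i).onR (J.u 0 j) = 0 := by
  rw [J.pd_u, if_neg (by omega)]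

/-- The solutions of the cubic equation are affine functions of `u` and `⟨u, u⟩`. -/
theorem exists_affine (hm : 2 ≤ m) : ∃ (c₀ c₂ : L) (c : Fin m → L),
    P = J.const c₀ + ∑ i, J.u 0 i • J.const (c i) + pairing (J.u 0) (J.u 0) • J.const c₂ := by
  have key : ∀ x : M, J.Ord 0 x → (∀ i, (J.pd 0 i).onM x = 0) → ∃ c, J.const c = x := by
    intro x hx hx0
    refine J.exists_const x fun k i => ?_
    rcases Nat.eq_zero_or_pos k with rfl | hk
    · exact hx0 i
    · exact hx k hk i
  have hpos : 0 < m := by omega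
  have ord_pair : ∀ k, 0 < k → ∀ i, (J.pd k i).onR (pairing (J.u 0) (J.u 0)) = 0 := by
    intro k hk i
    rw [LieDer.map_pairing, J.pd_vec_u_ne hk.ne', pairing_zero_left, pairing_zero_right, add_zero]
  -- Half of the common second derivative is the coefficient of ⟨u,u⟩. Subtracting its contribution
  -- leaves constant first derivatives `c i`, and then a constant `c₀`.
  obtain ⟨c₂, hc₂⟩ := key ((algebraMap 𝕂 R (1 / 2)) •
    (J.pd 0 ⟨0, hpos⟩).onM ((J.pd 0 ⟨0, hpos⟩).onM P))
    (Ord.smul (fun k _ i => (J.pd k i).onR.map_algebraMap _) ((hP.pd 0 _).pd 0 _))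
    (fun i => by
      rw [LieDer.map_smul, pd_pd_pd_eq_zero hP h, Derivation.map_algebraMap]; simp)
  have hc₂' : ∀ i, (J.pd 0 i).onM ((J.pd 0 i).onM P) = (2 : R) • J.const c₂ := by
    intro i
    rw [hc₂, smul_smul, pd_pd_eq hP h ⟨0, hpos⟩ i]
    have : (2 : R) * algebraMap 𝕂 R (1 / 2) = 1 := by
      have h2 : (2 : R) = algebraMap 𝕂 R 2 := (map_ofNat _ 2).symm
      rw [h2, ← map_mul, mul_div_cancel₀ _ (two_ne_zero' 𝕂), map_one]
    rw [this, one_smul]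
  have hc : ∀ i, ∃ c, J.const c = (J.pd 0 i).onM P - (2 * J.u 0 i) • J.const c₂ := by
    intro i
    refine key _ ((hP.pd 0 i).sub (Ord.smul (fun k hk j => ?_) (ord_const 0 _))) fun j => ?_
    · rw [Derivation.leibniz, ord_u k hk, LieDer.map_ofNat]; simp
    · rw [map_sub, LieDer.map_smul, J.pd_const, Derivation.leibniz, J.pd_u, LieDer.map_ofNat]
      by_cases hij : i = j
      · subst hij
        rw [hc₂']; simp
      · rw [pd_pd_eq_zero hP h hij]
        simp [Ne.symm hij]
  choose c hc using hc
  obtain ⟨c₀, hc₀⟩ := key (P - ∑ i, J.u 0 i • J.const (c i)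
      - pairing (J.u 0) (J.u 0) • J.const c₂)
    ((hP.sub (Ord.sum fun i _ => Ord.smul (fun k hk j => ord_u k hk j i) (ord_const 0 _))).sub
      (Ord.smul ord_pair (ord_const 0 _))) (fun i => by
        rw [map_sub, map_sub, map_sum, LieDer.map_smul, J.pd_const, pd_pairing_u,
          Finset.sum_eq_single i]
        · rw [LieDer.map_smul, J.pd_const, J.pd_u, hc]; simp
        · intro j _ hj
          rw [LieDer.map_smul, J.pd_const, J.pd_u]; simp [Ne.symm hj]
        · simp)
  refine ⟨c₀, c₂, c, ?_⟩
  rw [hc₀]; abel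

end Components

end JetModel

/-! ### The embedding s of the sphere and its differential -/

namespace JetModel

variable {𝕂 R L M : Type*} [Field 𝕂] [CommRing R] [Algebra 𝕂 R] [LieRing L]
  [LieAlgebra 𝕂 L] [LieRing M] [LieAlgebra R M] [Module 𝕂 M] {m : ℕ}
  (J : JetModel 𝕂 R L M m)

/-- The functions `s^l` on the sphere. -/
noncomputable def s : Fin (m + 1) → R := sphereCoord (J.u 0)

theorem s_castSucc (j : Fin m) : J.s j.castSucc = 2 * J.u 0 j * J.dinv := by
  simp [s, sphereCoord, dinv]

theorem s_last : J.s (Fin.last m) = (1 - pairing (J.u 0) (J.u 0)) * J.dinv := by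
  simp [s, sphereCoord, dinv]

/-- The differential of `s` applied to a vector `w`. -/
noncomputable def ds (w : Fin m → R) : Fin (m + 1) → R :=
  Fin.snoc (α := fun _ => R)
    (fun j => 2 * J.dinv * w j - 4 * J.dinv ^ 2 * pairing (J.u 0) w * J.u 0 j)
    (-(4 * J.dinv ^ 2 * pairing (J.u 0) w))

theorem ds_castSucc (w : Fin m → R) (j : Fin m) : J.ds w j.castSucc =
    2 * J.dinv * w j - 4 * J.dinv ^ 2 * pairing (J.u 0) w * J.u 0 j := by
  simp [ds]

theorem ds_last (w : Fin m → R) :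
    J.ds w (Fin.last m) = -(4 * J.dinv ^ 2 * pairing (J.u 0) w) := by
  simp [ds]

theorem vec_s (D : LieDer 𝕂 R M) : D.vec J.s = J.ds (D.vec (J.u 0)) := by
  have hδ := J.delta_mul_dinv
  ext l
  rw [LieDer.vec_apply]
  refine Fin.lastCases ?_ (fun j => ?_) l
  · rw [s_last, ds_last, Derivation.leibniz, map_sub, LieDer.map_pairing, J.map_dinv,
      Derivation.map_one_eq_zero, pairing_comm (D.vec _)]
    simp only [smul_eq_mul]
    linear_combination (2 * pairing (J.u 0) (D.vec (J.u 0)) * J.dinv) * hδ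
  · rw [s_castSucc, ds_castSucc, Derivation.leibniz, Derivation.leibniz, J.map_dinv,
      LieDer.map_ofNat]
    simp only [smul_eq_mul, LieDer.vec_apply]
    ring

theorem pairing_succ (v w : Fin (m + 1) → R) : pairing v w
    = pairing (fun j => v j.castSucc) (fun j => w j.castSucc)
      + v (Fin.last m) * w (Fin.last m) := by
  rw [pairing, Fin.sum_univ_castSucc, pairing]

theorem pairing_s_s : pairing J.s J.s = 1 := by
  have hδ := J.delta_mul_dinv
  have h : (fun j : Fin m => J.s j.castSucc) = (2 * J.dinv) • J.u 0 := by
    ext j; rw [s_castSucc, Pi.smul_apply, smul_eq_mul]; ring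
  rw [pairing_succ, h, s_last, pairing_smul_left, pairing_smul_right]
  linear_combination ((1 + pairing (J.u 0) (J.u 0)) * J.dinv + 1) * hδ

/-- The pullback by s of the ambient form is the conformally flat expression of the round metric. -/
theorem pairing_ds_ds (w : Fin m → R) :
    pairing (J.ds w) (J.ds w) = 4 * J.dinv ^ 2 * pairing w w := by
  have hδ := J.delta_mul_dinv
  have h : (fun j : Fin m => J.ds w j.castSucc)
      = (2 * J.dinv) • w + (-(4 * J.dinv ^ 2 * pairing (J.u 0) w)) • J.u 0 := by
    ext j
    rw [ds_castSucc, Pi.add_apply, Pi.smul_apply, Pi.smul_apply, smul_eq_mul, smul_eq_mul]; ring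
  rw [pairing_succ, h, ds_last]
  simp only [pairing_add_left, pairing_add_right, pairing_smul_left, pairing_smul_right,
    pairing_comm w (J.u 0)]
  linear_combination (16 * J.dinv ^ 3 * pairing (J.u 0) w ^ 2) * hδ

theorem pairing_s_ds (w : Fin m → R) : pairing J.s (J.ds w) = 0 := by
  have hδ := J.delta_mul_dinv
  have h : (fun j : Fin m => J.ds w j.castSucc)
      = (2 * J.dinv) • w + (-(4 * J.dinv ^ 2 * pairing (J.u 0) w)) • J.u 0 := by
    ext j
    rw [ds_castSucc, Pi.add_apply, Pi.smul_apply, Pi.smul_apply, smul_eq_mul, smul_eq_mul]; ring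
  have h' : (fun j : Fin m => J.s j.castSucc) = (2 * J.dinv) • J.u 0 := by
    ext j; rw [s_castSucc, Pi.smul_apply, smul_eq_mul]; ring
  rw [pairing_succ, h, h', ds_last, s_last]
  simp only [pairing_add_left, pairing_add_right, pairing_smul_left, pairing_smul_right,
    pairing_comm w (J.u 0)]
  linear_combination (-4 * J.dinv ^ 2 * pairing (J.u 0) w) * hδ

theorem ds_eq_sum (w : Fin m → R) (l : Fin (m + 1)) :
    J.ds w l = ∑ i, w i * (J.pd 0 i).onR (J.s l) := by
  have hv : (J.field 1 fun _ => w).vec (J.u 0) = w := by rw [field_vec_u]; simp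
  have h := congrFun (J.vec_s (J.field 1 fun _ => w)) l
  rw [hv, LieDer.vec_apply, field_onR] at h
  simpa using h.symm

theorem vec_pd_s (i : Fin m) : (J.pd 0 i).vec J.s = J.ds (Pi.single i 1) := by
  rw [vec_s, pd_vec_u_self]

/-- Every tangent vector of the sphere is in the image of the differential of `s`. -/
theorem exists_ds_eq {v : Fin (m + 1) → R} (hv : pairing J.s v = 0) [CharZero 𝕂] :
    ∃ w, J.ds w = v := by
  have hδ := J.delta_mul_dinv
  set v' : Fin m → R := fun j => v j.castSucc
  set vn := v (Fin.last m)
  set a := pairing (J.u 0) (J.u 0)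
  have h2 : algebraMap 𝕂 R (1 / 2) * 2 = 1 := by
    have h2 : (2 : R) = algebraMap 𝕂 R 2 := (map_ofNat _ 2).symm
    rw [h2, ← map_mul, div_mul_cancel₀ _ (two_ne_zero' 𝕂), map_one]
  set κ := algebraMap 𝕂 R (1 / 2)
  have h : (fun j : Fin m => J.s j.castSucc) = (2 * J.dinv) • J.u 0 := by
    ext j; rw [s_castSucc, Pi.smul_apply, smul_eq_mul]; ring
  rw [pairing_succ, h, s_last, pairing_smul_left] at hv
  change 2 * J.dinv * pairing (J.u 0) v' + (1 - a) * J.dinv * vn = 0 at hv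
  -- The last component of ds w = v gives −4Δ⁻²⟨u,w⟩ = vⁿ. The others then read v' = 2Δ⁻¹w + vⁿu and
  -- are solved for w.
  set w : Fin m → R := (κ * (1 + a)) • (v' - vn • J.u 0) with hw
  have hp : pairing (J.u 0) v' * 2 = -(1 - a) * vn := by
    linear_combination (1 + a) * hv - (2 * pairing (J.u 0) v' + (1 - a) * vn) * hδ
  have hwu : 4 * J.dinv ^ 2 * pairing (J.u 0) w = -vn := by
    rw [hw, pairing_smul_right, pairing_sub_right, pairing_smul_right]
    change 4 * J.dinv ^ 2 * (κ * (1 + a) * (pairing (J.u 0) v' - vn * a)) = -vn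
    grind
  refine ⟨w, ?_⟩
  ext l
  refine Fin.lastCases ?_ (fun j => ?_) l
  · rw [ds_last, hwu, neg_neg]
  · rw [ds_castSucc, hwu, hw, Pi.smul_apply, Pi.sub_apply, Pi.smul_apply]
    simp only [smul_eq_mul]
    change 2 * J.dinv * (κ * (1 + a) * (v j.castSucc - vn * J.u 0 j)) - -vn * J.u 0 j
      = v j.castSucc
    grind

/-- The constraint ⟨s,s⟩ = 1 makes the form symmetric in all n indices. -/
theorem quad_eq (r : Fin (m + 1) → 𝕂) : J.quad r = ∑ l, algebraMap 𝕂 R (r l) * J.s l ^ 2 := by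
  have h1 := J.pairing_s_s
  rw [pairing, Fin.sum_univ_castSucc] at h1
  rw [quad, Fin.sum_univ_castSucc]
  simp only [map_sub, sub_mul, Finset.sum_sub_distrib, mul_sub]
  have h2 : ∀ f : Fin m → R, 4 * J.dinv ^ 2 * ∑ i, f i * J.u 0 i ^ 2
      = ∑ i, f i * J.s i.castSucc ^ 2 := by
    intro f
    rw [Finset.mul_sum]
    exact Finset.sum_congr rfl fun i _ => by rw [s_castSucc]; ring
  rw [h2, h2, ← Finset.mul_sum]
  simp only [← sq] at h1
  linear_combination (-algebraMap 𝕂 R (r (Fin.last m))) * h1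

theorem map_quad (D : LieDer 𝕂 R M) (r : Fin (m + 1) → 𝕂) :
    D.onR (J.quad r) = 2 * ∑ l, algebraMap 𝕂 R (r l) * J.s l * D.vec J.s l := by
  rw [quad_eq, map_sum, Finset.mul_sum]
  refine Finset.sum_congr rfl fun l _ => ?_
  rw [Derivation.leibniz, Derivation.map_algebraMap, Derivation.leibniz_pow, LieDer.vec_apply]
  simp only [smul_eq_mul, nsmul_eq_mul, smul_zero, add_zero]
  push_cast
  ring

/-- `∑ y_l C_l`. -/
def lc (C : Fin (m + 1) → L) : (Fin (m + 1) → R) →ₗ[R] M :=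
  Fintype.linearCombination R fun l => J.const (C l)

theorem lc_apply (C : Fin (m + 1) → L) (y : Fin (m + 1) → R) :
    J.lc C y = ∑ l, y l • J.const (C l) := rfl

theorem lc_single (C : Fin (m + 1) → L) (l : Fin (m + 1)) :
    J.lc C (Pi.single l 1) = J.const (C l) := by
  simp [lc]

theorem map_lc (D : LieDer 𝕂 R M) (hD : ∀ c, D.onM (J.const c) = 0) (C : Fin (m + 1) → L)
    (y : Fin (m + 1) → R) : D.onM (J.lc C y) = J.lc C (D.vec y) := by
  rw [lc_apply, map_sum, lc_apply]
  refine Finset.sum_congr rfl fun l _ => ?_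
  rw [LieDer.map_smul, hD, smul_zero, add_zero, LieDer.vec_apply]

theorem field_const (N : ℕ) (W : ℕ → Fin m → R) (c : L) :
    (J.field N W).onM (J.const c) = 0 := by
  rw [field_onM]
  simp [J.pd_const]

theorem ord_lc_s (C : Fin (m + 1) → L) : J.Ord 0 (J.lc C J.s) := by
  intro k hk i
  rw [J.map_lc _ (J.pd_const k i), vec_s, J.pd_vec_u_ne hk.ne']
  have : J.ds 0 = 0 := by
    ext l
    rw [ds_eq_sum]; simp
  rw [this, map_zero]

theorem d1_lc_s (C : Fin (m + 1) → L) (w : Fin m → R) : J.d1 (J.lc C J.s) w = J.lc C (J.ds w) := by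
  have hG := J.geom_field 1 fun _ => w
  have hv : (J.field 1 fun _ => w).vec (J.u 0) = w := by rw [field_vec_u]; simp
  have h := hG _ (J.ord_lc_s C)
  rwa [hv, J.map_lc _ (J.field_const _ _), vec_s, hv, eq_comm] at h

theorem d1_const (c : L) (w : Fin m → R) : J.d1 (J.const c) w = 0 := by
  simp [d1_apply, J.pd_const]

theorem d1_add (x y : M) (w : Fin m → R) : J.d1 (x + y) w = J.d1 x w + J.d1 y w := by
  simp [d1_apply, Finset.sum_add_distrib]

/-- A frame is given by `s` and the image of its differential. -/
theorem frame [CharZero 𝕂] {x : (Fin (m + 1) → R) →ₗ[R] M} (h0 : x J.s = 0)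
    (h1 : ∀ i, x (J.ds (Pi.single i 1)) = 0) : x = 0 := by
  have h2 : ∀ w, x (J.ds w) = 0 := by
    intro w
    have : J.ds w = ∑ i, w i • J.ds (Pi.single i 1) := by
      ext l
      rw [ds_eq_sum, Finset.sum_apply]
      refine Finset.sum_congr rfl fun i _ => ?_
      rw [Pi.smul_apply, ← vec_pd_s]; rfl
    rw [this, map_sum]
    exact Finset.sum_eq_zero fun i _ => by rw [map_smul, h1, smul_zero]
  refine LinearMap.ext fun y => ?_
  -- Removing the component along s from `y` leaves a tangent vector.
  obtain ⟨w, hw⟩ := J.exists_ds_eq (v := y - pairing J.s y • J.s) (by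
    rw [pairing_sub_right, pairing_smul_right, pairing_s_s]; ring)
  have := h2 w
  rw [hw, map_sub, map_smul, h0, smul_zero, sub_zero] at this
  simpa using this

theorem dinv_cancel {x : M} (h : J.dinv • x = 0) : x = 0 := by
  rw [← one_smul R x, ← J.delta_mul_dinv, mul_smul, h, smul_zero]

/-- The functions `1, s^1, …, s^n` are linearly independent over the constants. -/
theorem const_add_lc_s_eq_zero [CharZero 𝕂] (hm : 0 < m) {c : L} {C : Fin (m + 1) → L}
    (h : J.const c + J.lc C J.s = 0) : c = 0 ∧ ∀ l, C l = 0 := by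
  have h1 : ∀ w, J.lc C (J.ds w) = 0 := by
    intro w
    have := congrArg (J.field 1 fun _ => w).onM h
    have hv : (J.field 1 fun _ => w).vec (J.u 0) = w := by rw [field_vec_u]; simp
    rwa [map_add, field_const, zero_add, J.map_lc _ (J.field_const _ _), vec_s, hv,
      map_zero] at this
  -- The projection e_l − s^l s of a basis vector is tangent, hence killed by `J.lc C`. So C_l
  -- equals s^l times ∑ C_k s^k = −c, and another derivative gives ds^l · c = 0.
  have h2 : ∀ l, J.const (C l) = -(J.s l • J.const c) := by
    intro l
    obtain ⟨w, hw⟩ := J.exists_ds_eq (v := Pi.single l 1 - J.s l • J.s) (by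
      rw [pairing_sub_right, pairing_smul_right, pairing_s_s, pairing_single_right]; ring)
    have := h1 w
    rw [hw, map_sub, map_smul, lc_single, sub_eq_zero] at this
    rw [this, eq_neg_of_add_eq_zero_right h, smul_neg]
  have h3 : ∀ l i, (J.pd 0 i).onR (J.s l) • J.const c = 0 := by
    intro l i
    have := congrArg (J.pd 0 i).onM (h2 l)
    rwa [J.pd_const, map_neg, LieDer.map_smul, J.pd_const, smul_zero, add_zero, eq_comm,
      neg_eq_zero] at this
  have h4 : ∀ l i, J.ds (Pi.single i 1) l • J.const c = 0 := by
    intro l i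
    rw [← vec_pd_s]; exact h3 l i
  have hc : J.const c = 0 := by
    set i : Fin m := ⟨0, hm⟩
    have e1 := h4 i.castSucc i
    have e2 := h4 (Fin.last m) i
    rw [ds_castSucc, pairing_single_right] at e1
    rw [ds_last, pairing_single_right] at e2
    simp only [Pi.single_eq_same, mul_one] at e1 e2
    refine J.dinv_cancel (eq_zero_of_ofNat_smul (𝕂 := 𝕂) (R := R) (k := 2) ?_)
    -- The terms quadratic in Δ⁻¹ cancel and 2Δ⁻¹c remains.
    linear_combination (norm := module) e1 - J.u 0 i • e2
  refine ⟨J.const_injective (by rw [hc, map_zero]), fun l => J.const_injective ?_⟩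
  rw [h2, hc, smul_zero, neg_zero, map_zero]

end JetModel

/-! ## Consequences of the relations in the Lie algebra -/

section Relations

variable {𝕂 L : Type*} [Field 𝕂] [CharZero 𝕂] [LieRing L] [LieAlgebra 𝕂 L] {m : ℕ}
  {r : Fin (m + 1) → 𝕂} {C : Fin (m + 1) → L}

/-- The double relation says precisely that [C_j,[C_j,C_k]] + r_j C_k is the same for all j ≠ k, so
any convenient j may be used below. -/
theorem linCoeff_eq (hm : 0 < m)
    (double : ∀ i j k, i ≠ k → j ≠ k → ⁅C i, ⁅C i, C k⁆⁆ - ⁅C j, ⁅C j, C k⁆⁆ = (r j - r i) • C k)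
    {j k : Fin (m + 1)} (hjk : j ≠ k) :
    linCoeff r C k = ⁅C j, ⁅C j, C k⁆⁆ + r j • C k := by
  have h01 : (1 : Fin (m + 1)) ≠ 0 := by
    have : NeZero m := ⟨hm.ne'⟩
    obtain ⟨k, rfl⟩ : ∃ k, m = k + 1 := ⟨m - 1, by omega⟩
    simp
  unfold linCoeff
  split_ifs with hk
  · subst hk
    linear_combination (norm := module) double 1 j 0 h01 hjk
  · linear_combination (norm := module) double 0 j k (Ne.symm hk) hjk

theorem exists_ne_ne (hm : 2 ≤ m) (i j : Fin (m + 1)) : ∃ k, k ≠ i ∧ k ≠ j := by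
  have : ({i, j} : Finset (Fin (m + 1))).card < Fintype.card (Fin (m + 1)) := by
    have := Finset.card_le_two (a := i) (b := j)
    simp only [Fintype.card_fin]; omega
  obtain ⟨k, hk⟩ := Finset.exists_mem_notMem_of_card_lt_card
    (s := {i, j}) (t := Finset.univ) (by simpa using this)
  exact ⟨k, by simp only [Finset.mem_insert, Finset.mem_singleton, not_or] at hk; exact hk.2⟩

/-- By the Jacobi identity [C_i,[C_k,[C_k,C_i]]] changes sign when i and k are exchanged. Going
around a triangle of three distinct indices shows that the bracket is its own negative. -/
theorem lie_linCoeff_self (hm : 2 ≤ m)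
    (double : ∀ i j k, i ≠ k → j ≠ k → ⁅C i, ⁅C i, C k⁆⁆ - ⁅C j, ⁅C j, C k⁆⁆ = (r j - r i) • C k)
    (i : Fin (m + 1)) : ⁅C i, linCoeff r C i⁆ = 0 := by
  have step : ∀ i k, i ≠ k → ⁅C i, linCoeff r C i⁆ = -⁅C k, linCoeff r C k⁆ := by
    intro i k hik
    rw [linCoeff_eq (by omega) double hik, linCoeff_eq (by omega) double hik.symm]
    have h1 : ⁅C i, ⁅C k, ⁅C k, C i⁆⁆⁆ = ⁅C k, ⁅C i, ⁅C k, C i⁆⁆⁆ := by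
      rw [leibniz_lie (C i) (C k), ← lie_skew (C k) (C i), lie_neg, lie_self]; simp
    have h2 : ⁅C i, ⁅C k, C i⁆⁆ = -⁅C i, ⁅C i, C k⁆⁆ := by
      rw [← lie_skew (C k) (C i), lie_neg]
    rw [lie_add, lie_add, h1, h2]
    simp only [lie_smul, lie_self, lie_neg, smul_zero, add_zero]
  obtain ⟨j, hj, -⟩ := exists_ne_ne hm i i
  obtain ⟨k, hk, hkj⟩ := exists_ne_ne hm i j
  have e1 := step i j hj.symm
  have e2 := step j k hkj.symm
  have e3 := step k i hk
  have e : (2 : 𝕂) • ⁅C i, linCoeff r C i⁆ = 0 := by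
    linear_combination (norm := module) e1 - e2 + e3
  exact (smul_eq_zero.1 e).resolve_left two_ne_zero

/-- With a third index k the triple relation reduces [C_i,[C_k,[C_k,C_j]]] to [[C_i,C_k],[C_k,C_j]],
which is antisymmetric in i and j, as is r_k[C_i,C_j]. -/
theorem lie_linCoeff_add (hm : 2 ≤ m)
    (triple : ∀ i j k, i ≠ j → j ≠ k → k ≠ i → ⁅C i, ⁅C j, C k⁆⁆ = 0)
    (double : ∀ i j k, i ≠ k → j ≠ k → ⁅C i, ⁅C i, C k⁆⁆ - ⁅C j, ⁅C j, C k⁆⁆ = (r j - r i) • C k)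
    (i j : Fin (m + 1)) : ⁅C i, linCoeff r C j⁆ + ⁅C j, linCoeff r C i⁆ = 0 := by
  by_cases hij : i = j
  · subst hij
    rw [lie_linCoeff_self hm double, add_zero]
  obtain ⟨k, hki, hkj⟩ := exists_ne_ne hm i j
  rw [linCoeff_eq (by omega) double hki, linCoeff_eq (by omega) double hkj]
  have h1 : ⁅C i, ⁅C k, ⁅C k, C j⁆⁆⁆ = ⁅⁅C i, C k⁆, ⁅C k, C j⁆⁆ := by
    rw [leibniz_lie (C i) (C k), triple i k j hki.symm hkj (Ne.symm hij), lie_zero, add_zero]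
  have h2 : ⁅C j, ⁅C k, ⁅C k, C i⁆⁆⁆ = -⁅⁅C i, C k⁆, ⁅C k, C j⁆⁆ := by
    rw [leibniz_lie (C j) (C k), triple j k i hkj.symm hki hij, lie_zero, add_zero,
      ← lie_skew (C k) (C j), ← lie_skew (C i) (C k), lie_neg, neg_neg, neg_lie, lie_skew]
  rw [lie_add, lie_add, h1, h2, lie_smul, lie_smul, ← lie_skew (C i) (C j)]
  module

end Relations

/-! ### From an identity on tangent vectors to relations in the Lie algebra -/

namespace JetModel

variable {𝕂 R L M : Type*} [Field 𝕂] [CharZero 𝕂] [CommRing R] [Algebra 𝕂 R] [LieRing L]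
  [LieAlgebra 𝕂 L] [LieRing M] [LieAlgebra R M] [Module 𝕂 M] [IsScalarTower 𝕂 R M] {m : ℕ}
  (J : JetModel 𝕂 R L M m)

theorem const_smul (a : 𝕂) (c : L) : J.const (a • c) = algebraMap 𝕂 R a • J.const c := by
  rw [map_smul, algebraMap_smul]

theorem lie_const_lc (c : L) (C : Fin (m + 1) → L) (y : Fin (m + 1) → R) :
    ⁅J.const c, J.lc C y⁆ = J.lc (fun l => ⁅c, C l⁆) y := by
  simp only [lc_apply, lie_sum, lie_smul, J.const_lie]

theorem lie_lc_const (c : L) (C : Fin (m + 1) → L) (y : Fin (m + 1) → R) :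
    ⁅J.lc C y, J.const c⁆ = J.lc (fun l => ⁅C l, c⁆) y := by
  simp only [lc_apply, sum_lie, smul_lie, J.const_lie]

theorem lc_eq_zero {C : Fin (m + 1) → L} (hC : ∀ l, C l = 0) (y : Fin (m + 1) → R) :
    J.lc C y = 0 := by
  simp [lc_apply, hC]

/-- A cubic form with constant coefficients which vanishes on `s` vanishes identically. -/
theorem cubic_form_eq_zero
    (T : (Fin (m + 1) → R) → (Fin (m + 1) → R) → (Fin (m + 1) → R) → M)
    (h1 : ∀ y z, IsLinearMap R fun x => T x y z) (h2 : ∀ x z, IsLinearMap R fun y => T x y z)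
    (h3 : ∀ x y, IsLinearMap R fun z => T x y z)
    (hT : ∀ i x y z, (J.pd 0 i).onM (T x y z) = T ((J.pd 0 i).vec x) y z
      + T x ((J.pd 0 i).vec y) z + T x y ((J.pd 0 i).vec z))
    (hs : T J.s J.s J.s = 0) {y : Fin (m + 1) → R} (hy : ∀ i, (J.pd 0 i).vec y = 0) :
    T y y y = 0 := by
  have frame' : ∀ f : (Fin (m + 1) → R) → M, IsLinearMap R f → f J.s = 0 →
      (∀ i, f (J.ds (Pi.single i 1)) = 0) → ∀ y, f y = 0 := by
    intro f hf h0 h1 y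
    exact congrArg (fun g : (Fin (m + 1) → R) →ₗ[R] M => g y)
      (J.frame (x := IsLinearMap.mk' f hf) h0 h1)
  have a1 : ∀ x x' y z, T (x + x') y z = T x y z + T x' y z := fun x x' y z =>
    (h1 y z).map_add x x'
  have a2 : ∀ x y y' z, T x (y + y') z = T x y z + T x y' z := fun x y y' z =>
    (h2 x z).map_add y y'
  have a3 : ∀ x y z z', T x y (z + z') = T x y z + T x y z' := fun x y z z' =>
    (h3 x y).map_add z z'
  have m1 : ∀ (c : R) x y z, T (c • x) y z = c • T x y z := fun c x y z => (h1 y z).map_smul c x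
  have m2 : ∀ (c : R) x y z, T x (c • y) z = c • T x y z := fun c x y z => (h2 x z).map_smul c y
  have m3 : ∀ (c : R) x y z, T x y (c • z) = c • T x y z := fun c x y z => (h3 x y).map_smul c z
  have z1 : ∀ y z, T 0 y z = 0 := fun y z => (h1 y z).map_zero
  have z2 : ∀ x z, T x 0 z = 0 := fun x z => (h2 x z).map_zero
  have z3 : ∀ x y, T x y 0 = 0 := fun x y => (h3 x y).map_zero
  -- The symmetrization of T vanishes on (s,s,s), and its derivatives put ds in one slot; since s
  -- and ds span, that slot may be arbitrary. Repeating this with constant `y` replaces the other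
  -- two entries s.
  have g1 : ∀ y, T y J.s J.s + T J.s y J.s + T J.s J.s y = 0 := by
    refine frame' _ ⟨fun x y => ?_, fun c x => ?_⟩ (by rw [hs]; simp) fun i => ?_
    · rw [a1, a2, a3]; abel
    · rw [m1, m2, m3]; module
    · rw [← vec_pd_s, ← hT, hs, map_zero]
  have g2 : ∀ z, T y z J.s + T y J.s z + T z y J.s + T J.s y z + T z J.s y + T J.s z y = 0 := by
    refine frame' _ ⟨fun x y => ?_, fun c x => ?_⟩ ?_ fun i => ?_
    · rw [a2, a3, a1, a3, a1, a2]; abel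
    · rw [m2, m3, m1, m3, m1, m2]; module
    · linear_combination (norm := module) (2 : R) • g1 y
    · have := congrArg (J.pd 0 i).onM (g1 y)
      simp only [map_add, hT, hy, z1, z2, z3, map_zero, vec_pd_s] at this
      linear_combination (norm := module) this
  have g3 : ∀ z, T y y z + T y z y + T z y y = 0 := by
    have e : T y y J.s + T y J.s y + T J.s y y = 0 := by
      refine eq_zero_of_ofNat_smul (𝕂 := 𝕂) (R := R) (k := 2) ?_
      linear_combination (norm := module) g2 y
    refine frame' _ ⟨fun x y => ?_, fun c x => ?_⟩ e fun i => ?_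
    · rw [a3, a2, a1]; abel
    · rw [m3, m2, m1]; module
    · have := congrArg (J.pd 0 i).onM e
      simpa only [map_add, hT, hy, z1, z2, z3, map_zero, vec_pd_s, zero_add, add_zero] using this
  refine eq_zero_of_ofNat_smul (𝕂 := 𝕂) (R := R) (k := 3) ?_
  linear_combination (norm := module) g3 y

/-- The polynomial form of an identity for tangent vectors of the sphere. -/
theorem cubic_of_tangent_identity {r : Fin (m + 1) → 𝕂} {C : Fin (m + 1) → L}
    (h : ∀ v v', pairing J.s v = 0 → pairing J.s v' = 0 →
      ⁅J.lc C J.s, ⁅J.lc C v, J.lc C v'⁆⁆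
        = (∑ l, algebraMap 𝕂 R (r l) * J.s l * v' l) • J.lc C v
          - (∑ l, algebraMap 𝕂 R (r l) * J.s l * v l) • J.lc C v')
    (a b c : Fin (m + 1)) {y : Fin (m + 1) → R} (hy : ∀ i, (J.pd 0 i).vec y = 0) :
    ⁅J.lc C y, ⁅y a • J.const (C b) - y b • J.const (C a),
        y a • J.const (C c) - y c • J.const (C a)⁆⁆
      - (algebraMap 𝕂 R (r c) * y c * y a - algebraMap 𝕂 R (r a) * y a * y c)
          • (y a • J.const (C b) - y b • J.const (C a))
      + (algebraMap 𝕂 R (r b) * y b * y a - algebraMap 𝕂 R (r a) * y a * y b)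
          • (y a • J.const (C c) - y c • J.const (C a)) = 0 := by
  set ρ : Fin (m + 1) → R := fun l => algebraMap 𝕂 R (r l) with hρ
  have hρ0 : ∀ i l, (J.pd 0 i).onR (ρ l) = 0 := fun i l => Derivation.map_algebraMap _ _
  -- Every monomial has its three factors distributed over x, y, z, so that the form is trilinear
  -- and its diagonal is the claimed expression.
  let T : (Fin (m + 1) → R) → (Fin (m + 1) → R) → (Fin (m + 1) → R) → M := fun x y z =>
    ⁅J.lc C x, ⁅y a • J.const (C b) - y b • J.const (C a),
        z a • J.const (C c) - z c • J.const (C a)⁆⁆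
      - (ρ c * x c * y a - ρ a * x a * y c) • (z a • J.const (C b) - z b • J.const (C a))
      + (ρ b * x b * y a - ρ a * x a * y b) • (z a • J.const (C c) - z c • J.const (C a))
  change T y y y = 0
  refine J.cubic_form_eq_zero T ?_ ?_ ?_ ?_ ?_ hy
  · intro y z
    refine ⟨fun x x' => ?_, fun f x => ?_⟩
    · simp only [T, map_add, Pi.add_apply, add_lie]; module
    · simp only [T, map_smul, Pi.smul_apply, smul_lie, smul_eq_mul]; module
  · intro x z
    refine ⟨fun y y' => ?_, fun f y => ?_⟩
    · simp only [T, Pi.add_apply, add_smul, lie_add, add_lie, sub_lie, lie_sub]; module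
    · simp only [T, Pi.smul_apply, smul_lie, lie_smul, smul_eq_mul, mul_smul, sub_lie,
        lie_sub]; module
  · intro x y
    refine ⟨fun z z' => ?_, fun f z => ?_⟩
    · simp only [T, Pi.add_apply, add_smul, lie_add, add_lie, sub_lie, lie_sub]; module
    · simp only [T, Pi.smul_apply, smul_lie, lie_smul, smul_eq_mul, mul_smul, sub_lie,
        lie_sub]; module
  · intro i x y z
    simp only [T, map_add, map_sub, LieDer.map_lie, LieDer.map_smul, J.pd_const,
      J.map_lc _ (J.pd_const 0 i), Derivation.leibniz, smul_eq_mul, hρ0, LieDer.vec_apply,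
      lie_add, lie_sub, add_lie, sub_lie, smul_lie, lie_smul,
      zero_lie, lie_zero]
    module
  -- On (s,s,s) the form is the given identity for the tangent vectors s^a e_b − s^b e_a and s^a e_c
  -- − s^c e_a.
  · have hv : ∀ d : Fin (m + 1), pairing J.s (J.s a • Pi.single d 1 - J.s d • Pi.single a 1)
        = 0 := by
      intro d
      rw [pairing_sub_right, pairing_smul_right, pairing_smul_right, pairing_single_right,
        pairing_single_right]
      ring
    have e := h _ _ (hv b) (hv c)
    have hsum : ∀ d, ∑ l, ρ l * J.s l * (J.s a • Pi.single d (1 : R)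
        - J.s d • Pi.single a 1 : Fin (m + 1) → R) l
        = ρ d * J.s d * J.s a - ρ a * J.s a * J.s d := by
      intro d
      simp [mul_sub, Finset.sum_sub_distrib, Pi.single_apply]
    rw [hsum, hsum] at e
    simp only [map_sub, map_smul, lc_single] at e
    simp only [T]
    rw [e]
    module

theorem pd_vec_single_succ (l : Fin (m + 1)) (i : Fin m) :
    (J.pd 0 i).vec (Pi.single l (1 : R)) = 0 := by
  ext j
  rw [LieDer.vec_apply, Pi.single_apply]
  split_ifs <;> simp

/-- The cubic form at y = e_a: all terms with y_b or y_c disappear. -/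
theorem triple_of_tangent_identity {r : Fin (m + 1) → 𝕂} {C : Fin (m + 1) → L}
    (h : ∀ v v', pairing J.s v = 0 → pairing J.s v' = 0 →
      ⁅J.lc C J.s, ⁅J.lc C v, J.lc C v'⁆⁆
        = (∑ l, algebraMap 𝕂 R (r l) * J.s l * v' l) • J.lc C v
          - (∑ l, algebraMap 𝕂 R (r l) * J.s l * v l) • J.lc C v')
    {a b c : Fin (m + 1)} (hab : a ≠ b) (hca : c ≠ a) : ⁅C a, ⁅C b, C c⁆⁆ = 0 := by
  have e1 := J.cubic_of_tangent_identity h a b c (J.pd_vec_single_succ a)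
  simp only [lc_single, Pi.single_eq_same, Pi.single_eq_of_ne hab.symm, Pi.single_eq_of_ne hca,
    one_smul, zero_smul, sub_zero, mul_zero, zero_mul, smul_zero, add_zero, ← J.const_lie] at e1
  exact J.const_injective (by rw [e1, map_zero])

/-- The cubic form at y = e_a + e_b: it is [C_a + C_b, [C_b − C_a, C_c]] + (r_b − r_a)C_c, whose
mixed brackets vanish by the triple relation. -/
theorem double_of_tangent_identity {r : Fin (m + 1) → 𝕂} {C : Fin (m + 1) → L}
    (h : ∀ v v', pairing J.s v = 0 → pairing J.s v' = 0 →
      ⁅J.lc C J.s, ⁅J.lc C v, J.lc C v'⁆⁆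
        = (∑ l, algebraMap 𝕂 R (r l) * J.s l * v' l) • J.lc C v
          - (∑ l, algebraMap 𝕂 R (r l) * J.s l * v l) • J.lc C v')
    {a b c : Fin (m + 1)} (hac : a ≠ c) (hbc : b ≠ c) :
    ⁅C a, ⁅C a, C c⁆⁆ - ⁅C b, ⁅C b, C c⁆⁆ = (r b - r a) • C c := by
  by_cases hab : a = b
  · subst hab; simp
  have f1 := J.triple_of_tangent_identity h hab hac.symm
  have f2 := J.triple_of_tangent_identity h (Ne.symm hab) hbc.symm
  have e2 := J.cubic_of_tangent_identity h a b c (y := Pi.single a 1 + Pi.single b 1) (fun i => by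
    rw [LieDer.vec_add, pd_vec_single_succ, pd_vec_single_succ, add_zero])
  simp only [map_add, lc_single, Pi.add_apply, Pi.single_eq_same, Pi.single_eq_of_ne hab,
    Pi.single_eq_of_ne (Ne.symm hab), Pi.single_eq_of_ne hac.symm, Pi.single_eq_of_ne hbc.symm,
    one_smul, zero_smul, sub_zero, mul_zero, mul_one, zero_mul, smul_zero, add_zero, zero_add,
    add_lie, sub_lie, lie_sub, ← J.const_lie, f1, f2, sub_self, map_zero, lie_zero] at e2
  rw [← sub_eq_zero]
  refine J.const_injective ?_
  simp only [map_sub, const_smul, map_zero]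
  linear_combination (norm := module) -e2

end JetModel

/-! ### The shape of A, its Hessian, and double brackets under the relations -/

namespace JetModel

variable {𝕂 R L M : Type*} [Field 𝕂] [CharZero 𝕂] [CommRing R] [Algebra 𝕂 R] [LieRing L]
  [LieAlgebra 𝕂 L] [LieRing M] [LieAlgebra R M] [Module 𝕂 M] [IsScalarTower 𝕂 R M] {m : ℕ}
  (J : JetModel 𝕂 R L M m)

section Affine

/-- An affine function of `u` and `⟨u, u⟩`. -/
noncomputable def affine (c₀ c₂ : L) (c : Fin m → L) : M :=
  J.const c₀ + ∑ i, J.u 0 i • J.const (c i) + pairing (J.u 0) (J.u 0) • J.const c₂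

variable (c₀ c₂ : L) (c : Fin m → L)

theorem ord_affine : J.Ord 0 (J.affine c₀ c₂ c) := by
  refine ((ord_const 0 _).add (Ord.sum fun i _ => Ord.smul (fun k hk j => ?_) (ord_const 0 _))).add
    (Ord.smul (fun k hk j => ?_) (ord_const 0 _))
  · rw [J.pd_u, if_neg (by omega)]
  · rw [LieDer.map_pairing, J.pd_vec_u_ne hk.ne', pairing_zero_left, pairing_zero_right, add_zero]

theorem pd_affine (i : Fin m) : (J.pd 0 i).onM (J.affine c₀ c₂ c)
    = J.const (c i) + (2 * J.u 0 i) • J.const c₂ := by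
  rw [affine, map_add, map_add, map_sum, J.pd_const, zero_add, LieDer.map_smul, J.pd_const,
    pd_pairing_u, smul_zero, add_zero, Finset.sum_eq_single i]
  · rw [LieDer.map_smul, J.pd_const, J.pd_u]; simp
  · intro j _ hj
    rw [LieDer.map_smul, J.pd_const, J.pd_u]; simp [Ne.symm hj]
  · simp

theorem pd_pd_affine (i j : Fin m) : (J.pd 0 j).onM ((J.pd 0 i).onM (J.affine c₀ c₂ c))
    = (if i = j then (2 : R) else 0) • J.const c₂ := by
  rw [pd_affine, map_add, J.pd_const, zero_add, LieDer.map_smul, J.pd_const, smul_zero, add_zero,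
    Derivation.leibniz, LieDer.map_ofNat, J.pd_u]
  by_cases h : i = j
  · subst h; simp
  · simp [h, Ne.symm h]

theorem d1_affine_u : J.d1 (J.affine c₀ c₂ c) (J.u 0) =
    ∑ i, J.u 0 i • J.const (c i) + (2 * pairing (J.u 0) (J.u 0)) • J.const c₂ := by
  rw [d1_apply, pairing, Finset.mul_sum, Finset.sum_smul, ← Finset.sum_add_distrib]
  refine Finset.sum_congr rfl fun i _ => ?_
  rw [pd_affine]; module

theorem d2_affine (v w : Fin m → R) :
    J.d2 (J.affine c₀ c₂ c) v w = (2 * pairing v w) • J.const c₂ := by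
  rw [d2_apply, pairing, Finset.mul_sum, Finset.sum_smul]
  refine Finset.sum_congr rfl fun i _ => ?_
  rw [d1_apply, Finset.sum_eq_single i]
  · rw [pd_pd_affine, if_pos rfl]; module
  · intro j _ hj
    rw [pd_pd_affine, if_neg hj.symm, zero_smul, smul_zero]
  · simp

theorem d3_affine (v w w' : Fin m → R) : J.d3 (J.affine c₀ c₂ c) v w w' = 0 := by
  rw [d3_apply]
  refine Finset.sum_eq_zero fun i _ => ?_
  rw [d2_apply, Finset.sum_eq_zero, smul_zero]
  intro j _
  rw [d1_apply, Finset.sum_eq_zero, smul_zero]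
  intro k _
  rw [pd_pd_affine, LieDer.map_smul, J.pd_const]
  split_ifs <;> simp [LieDer.map_ofNat]

/-- Multiplication by Δ = 1 + ⟨u,u⟩ identifies affine functions of s with affine functions of u and
⟨u,u⟩. -/
theorem const_add_lc_s_eq (c₀ : L) (C : Fin (m + 1) → L) : J.const c₀ + J.lc C J.s =
    J.dinv • J.affine (c₀ + C (Fin.last m)) (c₀ - C (Fin.last m))
      (fun i => C i.castSucc + C i.castSucc) := by
  have hδ := J.delta_mul_dinv
  rw [lc_apply, Fin.sum_univ_castSucc, affine, smul_add, smul_add, Finset.smul_sum, s_last]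
  have h : ∀ i : Fin m, J.s i.castSucc • J.const (C i.castSucc)
      = J.dinv • J.u 0 i • J.const (C i.castSucc + C i.castSucc) := by
    intro i
    rw [s_castSucc, map_add]; module
  simp only [h, map_add, map_sub]
  match_scalars
  · linear_combination -hδ
  · ring
  · ring

/-- Restrictions of linear functions to the unit sphere satisfy Hess f = −f g, while constants have
zero Hessian. -/
theorem hess_const_add_lc_s (c₀ : L) (C : Fin (m + 1) → L) : J.hess (J.const c₀ + J.lc C J.s) =
    -(4 * J.dinv ^ 2 * pairing (J.u 1) (J.u 1)) • J.lc C J.s := by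
  have hδ := J.delta_mul_dinv
  have h := J.const_add_lc_s_eq c₀ C
  have hA := hess_dinv_smul (J.ord_affine (c₀ + C (Fin.last m)) (c₀ - C (Fin.last m))
    (fun i => C i.castSucc + C i.castSucc))
  rw [← h, d2_affine, d1_affine_u] at hA
  rw [hA, affine]
  simp only [map_add, map_sub]
  match_scalars
  · linear_combination (-2 * J.dinv * pairing (J.u 1) (J.u 1)) * hδ
  · linear_combination (2 * J.dinv * pairing (J.u 1) (J.u 1)) * hδ
  · ring
  · ring

/-- For affine P the third differential is zero and the second is a multiple of the pairing, so the
two remaining terms cancel. -/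
theorem cubicPart_const_add_lc_s (c₀ : L) (C : Fin (m + 1) → L) :
    J.cubicPart (J.const c₀ + J.lc C J.s) = 0 := by
  rw [const_add_lc_s_eq, cubicPart_dinv_smul (J.ord_affine _ _ _), d3_affine, d2_affine, d2_affine]
  module

theorem exists_const_add_lc_s (hm : 2 ≤ m) {A : M} (hA : J.Ord 0 A) (h : J.cubicPart A = 0) :
    ∃ (c₀ : L) (C : Fin (m + 1) → L), A = J.const c₀ + J.lc C J.s := by
  have hδ := J.delta_mul_dinv
  have hP : J.Ord 0 ((1 + pairing (J.u 0) (J.u 0)) • A) := Ord.smul (fun k hk i => by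
    rw [map_add, Derivation.map_one_eq_zero, LieDer.map_pairing, J.pd_vec_u_ne hk.ne',
      pairing_zero_left, pairing_zero_right]; simp) hA
  have hAP : J.dinv • (1 + pairing (J.u 0) (J.u 0)) • A = A := by
    rw [smul_smul, mul_comm, hδ, one_smul]
  obtain ⟨c₀, c₂, c, hc⟩ := exists_affine hP (by rw [hAP]; exact h) hm
  -- The coefficients come from inverting `const_add_lc_s_eq`.
  refine ⟨(1 / 2 : 𝕂) • (c₀ + c₂),
    Fin.snoc (α := fun _ => L) (fun i => (1 / 2 : 𝕂) • c i) ((1 / 2 : 𝕂) • (c₀ - c₂)), ?_⟩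
  rw [const_add_lc_s_eq, ← hAP, hc, affine]
  have e1 : (1 / 2 : 𝕂) • (c₀ + c₂) + (1 / 2 : 𝕂) • (c₀ - c₂) = c₀ := by module
  have e2 : (1 / 2 : 𝕂) • (c₀ + c₂) - (1 / 2 : 𝕂) • (c₀ - c₂) = c₂ := by module
  have e3 : ∀ i, (1 / 2 : 𝕂) • c i + (1 / 2 : 𝕂) • c i = c i := fun i => by module
  simp only [Fin.snoc_last, Fin.snoc_castSucc, e1, e2, e3]

end Affine

/-- The double bracket with a combination of the `C_l`. -/
theorem lie_lie_lc (hm : 2 ≤ m) {r : Fin (m + 1) → 𝕂} {C : Fin (m + 1) → L}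
    (triple : ∀ i j k, i ≠ j → j ≠ k → k ≠ i → ⁅C i, ⁅C j, C k⁆⁆ = 0)
    (double : ∀ i j k, i ≠ k → j ≠ k → ⁅C i, ⁅C i, C k⁆⁆ - ⁅C j, ⁅C j, C k⁆⁆ = (r j - r i) • C k)
    (y v : Fin (m + 1) → R) :
    ⁅J.lc C y, ⁅J.lc C y, J.lc C v⁆⁆ =
      pairing y y • J.lc (linCoeff r C) v - pairing y v • J.lc (linCoeff r C) y
      - (∑ l, algebraMap 𝕂 R (r l) * y l ^ 2) • J.lc C v
      + (∑ l, algebraMap 𝕂 R (r l) * y l * v l) • J.lc C y := by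
  -- By the triple relation only C_j and C_k fail to commute with [C_j,C_k], and [C_j,[C_j,C_k]] =
  -- K_k − r_j C_k with K = `linCoeff`.
  have key : ∀ j k, ⁅J.lc C y, J.const ⁅C j, C k⁆⁆ =
      y j • (J.const (linCoeff r C k) - algebraMap 𝕂 R (r j) • J.const (C k))
      - y k • (J.const (linCoeff r C j) - algebraMap 𝕂 R (r k) • J.const (C j)) := by
    intro j k
    by_cases hjk : j = k
    · subst hjk
      rw [lie_self, map_zero, lie_zero, sub_self]
    have h1 : ∀ i, y i • ⁅J.const (C i), J.const ⁅C j, C k⁆⁆ =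
        (if i = j then y j • (J.const (linCoeff r C k) - algebraMap 𝕂 R (r j) • J.const (C k))
          else 0)
        - (if i = k then y k • (J.const (linCoeff r C j) - algebraMap 𝕂 R (r k) • J.const (C j))
          else 0) := by
      intro i
      rw [← J.const_lie]
      by_cases hij : i = j
      · subst hij
        rw [if_pos rfl, if_neg hjk, linCoeff_eq (by omega) double hjk, map_add, const_smul]
        module
      by_cases hik : i = k
      · subst hik
        rw [if_pos rfl, if_neg hij, linCoeff_eq (by omega) double hij, map_add, const_smul,
          ← lie_skew (C i) (C j), lie_neg, map_neg]
        module
      rw [if_neg hij, if_neg hik, triple i j k hij hjk (Ne.symm hik), map_zero, smul_zero, sub_zero]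
    rw [lc_apply, sum_lie]
    simp only [smul_lie, h1, Finset.sum_sub_distrib, Finset.sum_ite_eq', Finset.mem_univ, if_true]
  have h2 : ⁅J.lc C y, J.lc C v⁆ = ∑ j, ∑ k, (y j * v k) • J.const ⁅C j, C k⁆ := by
    rw [lc_apply, lc_apply, sum_lie]
    refine Finset.sum_congr rfl fun j _ => ?_
    rw [lie_sum]
    refine Finset.sum_congr rfl fun k _ => ?_
    rw [smul_lie, lie_smul, J.const_lie, smul_smul]
  rw [h2, lie_sum]
  simp only [lie_sum, lie_smul, key]
  have h3 : ∀ j k, (y j * v k) •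
      (y j • (J.const (linCoeff r C k) - algebraMap 𝕂 R (r j) • J.const (C k))
      - y k • (J.const (linCoeff r C j) - algebraMap 𝕂 R (r k) • J.const (C j)))
      = (y j * y j) • v k • J.const (linCoeff r C k) - (y k * v k) • y j • J.const (linCoeff r C j)
        - (algebraMap 𝕂 R (r j) * y j ^ 2) • v k • J.const (C k)
        + (algebraMap 𝕂 R (r k) * y k * v k) • y j • J.const (C j) := by
    intro j k; module
  simp only [h3, Finset.sum_add_distrib, Finset.sum_sub_distrib]
  rw [Finset.sum_comm (f := fun j k => (y k * v k) • y j • J.const (linCoeff r C j)),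
    Finset.sum_comm (f := fun j k => (algebraMap 𝕂 R (r k) * y k * v k) • y j • J.const (C j))]
  simp only [← Finset.smul_sum, ← Finset.sum_smul, ← lc_apply]
  rfl

end JetModel

/-! ### The parts of degree two, one and zero, and the criterion in a jet model -/

namespace JetModel

variable {𝕂 R L M : Type*} [Field 𝕂] [CharZero 𝕂] [CommRing R] [Algebra 𝕂 R] [LieRing L]
  [LieAlgebra 𝕂 L] [LieRing M] [LieAlgebra R M] [Module 𝕂 M] [IsScalarTower 𝕂 R M] {m : ℕ}
  {J : JetModel 𝕂 R L M m} {r : Fin (m + 1) → 𝕂} {c₀ : L} {C : Fin (m + 1) → L}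

theorem lie_hess_const_add_lc_s : ⁅J.const c₀ + J.lc C J.s, J.hess (J.const c₀ + J.lc C J.s)⁆ =
    -(4 * J.dinv ^ 2 * pairing (J.u 1) (J.u 1)) • J.lc (fun l => ⁅c₀, C l⁆) J.s := by
  rw [hess_const_add_lc_s, lie_smul, add_lie, lie_self, add_zero, lie_const_lc]

theorem comm_of_lie_hess_eq_zero (hm : 2 ≤ m)
    (h : ⁅J.const c₀ + J.lc C J.s, J.hess (J.const c₀ + J.lc C J.s)⁆ = 0) (k : Fin (m + 1)) :
    ⁅c₀, C k⁆ = 0 := by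
  rw [lie_hess_const_add_lc_s] at h
  set X := J.lc (fun l => ⁅c₀, C l⁆) J.s
  have hX : J.Ord 0 X := J.ord_lc_s _
  let i : Fin m := ⟨0, by omega⟩
  -- Two derivatives in u^i_1 turn the factor ⟨u_1,u_1⟩ into 2, leaving a multiple of Δ⁻² that can
  -- be cancelled.
  have h1 := congrArg (fun x => (J.pd 1 i).onM ((J.pd 1 i).onM x)) h
  have hd : (J.pd 1 i).onR J.dinv = 0 := by
    rw [J.map_dinv, J.pd_vec_u_ne (by omega), pairing_zero_right]; ring
  have hs : (J.pd 1 i).vec (Pi.single i (1 : R)) = 0 := by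
    rw [← J.pd_vec_u_self 0 i]
    ext j
    rw [LieDer.vec_apply, J.pd_vec_u_self, Pi.single_apply]
    split_ifs <;> simp
  simp only [LieDer.map_smul, hX 1 one_pos, map_zero, smul_zero, add_zero, map_neg,
    Derivation.leibniz, Derivation.leibniz_pow, hd, LieDer.map_ofNat, smul_eq_mul, mul_zero,
    LieDer.map_pairing, J.pd_vec_u_self, hs, map_add, pairing_single_left, pairing_single_right,
    Pi.single_eq_same, J.pd_u, pairing_zero_left, pairing_zero_right, zero_add, and_self, if_true,
    nsmul_zero, Derivation.map_one_eq_zero] at h1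
  have h2 : (8 : R) • J.dinv • J.dinv • X = 0 := by
    linear_combination (norm := module) -h1
  have h3 := J.dinv_cancel (J.dinv_cancel (eq_zero_of_ofNat_smul (𝕂 := 𝕂) h2))
  exact (J.const_add_lc_s_eq_zero (c := 0) (by omega)
    (by rw [map_zero, zero_add]; exact h3)).2 k

/-- As C_0 commutes with every C_k, it drops out of the double bracket. -/
theorem lie_lie_const_add (h0 : ∀ k, ⁅c₀, C k⁆ = 0) (y v : Fin (m + 1) → R) :
    ⁅J.const c₀ + J.lc C y, ⁅J.lc C v, J.const c₀ + J.lc C y⁆⁆ =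
      -⁅J.lc C y, ⁅J.lc C y, J.lc C v⁆⁆ := by
  have h1 : ∀ y, ⁅J.const c₀, J.lc C y⁆ = 0 := fun y => by rw [lie_const_lc, lc_eq_zero _ h0]
  have h2 : ⁅J.lc C v, J.const c₀⁆ = 0 := by rw [← lie_skew, h1, neg_zero]
  rw [lie_add, h2, zero_add, add_lie, leibniz_lie (J.const c₀), h1, h1, zero_lie, lie_zero,
    add_zero, zero_add, ← lie_skew (J.lc C v) (J.lc C y), lie_neg]

theorem linearPart_const_add_lc_s (h0 : ∀ k, ⁅c₀, C k⁆ = 0) (E : M) :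
    J.linearPart r (J.const c₀ + J.lc C J.s) E = (2 : R) • J.d1 E (J.u 1)
      - (3 * J.quad r) • J.d1 (J.lc C J.s) (J.u 1)
      - (2 : R) • ⁅J.lc C J.s, ⁅J.lc C J.s, J.d1 (J.lc C J.s) (J.u 1)⁆⁆ := by
  rw [linearPart, d1_add, d1_const, zero_add, d1_lc_s, lie_lie_const_add h0, smul_neg,
    ← sub_eq_add_neg]

/-- The part is linear in u_1, so ∂/∂u^i_1 extracts its i-th coefficient. -/
theorem two_smul_pd_of_linearPart_eq_zero (h0 : ∀ k, ⁅c₀, C k⁆ = 0) {E : M} (hE : J.Ord 0 E)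
    (h : J.linearPart r (J.const c₀ + J.lc C J.s) E = 0) (i : Fin m) :
    (2 : R) • (J.pd 0 i).onM E = (3 * J.quad r) • (J.pd 0 i).onM (J.lc C J.s)
      + (2 : R) • ⁅J.lc C J.s, ⁅J.lc C J.s, (J.pd 0 i).onM (J.lc C J.s)⁆⁆ := by
  rw [linearPart_const_add_lc_s h0] at h
  have hd : ∀ {x : M}, J.Ord 0 x → (J.pd 1 i).onM (J.d1 x (J.u 1)) = (J.pd 0 i).onM x :=
    fun {x} hx => by
      rw [(J.geom_pd 1 i).map_d1 hx, J.pd_vec_u_ne (by omega), J.pd_vec_u_self, d1_single, map_zero,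
        LinearMap.zero_apply, zero_add]
  have hS := J.ord_lc_s C
  have h1 := congrArg (J.pd 1 i).onM h
  simp only [map_sub, LieDer.map_smul, LieDer.map_lie, hd hE, hd hS, hS 1 one_pos, zero_lie,
    Derivation.leibniz, J.map_quad_eq_zero (J.pd_vec_u_ne (show (1 : ℕ) ≠ 0 by omega) i),
    LieDer.map_ofNat, smul_zero, zero_smul, zero_add, map_zero] at h1
  linear_combination (norm := module) h1

/-- The integrability condition of the equation for `E`. -/
theorem lie_lie_pd_of_two_smul_pd {E : M}
    (h : ∀ i, (2 : R) • (J.pd 0 i).onM E = (3 * J.quad r) • (J.pd 0 i).onM (J.lc C J.s)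
      + (2 : R) • ⁅J.lc C J.s, ⁅J.lc C J.s, (J.pd 0 i).onM (J.lc C J.s)⁆⁆) (i j : Fin m) :
    (2 : R) • ⁅J.lc C J.s, ⁅(J.pd 0 i).onM (J.lc C J.s), (J.pd 0 j).onM (J.lc C J.s)⁆⁆
      = (J.pd 0 j).onR (J.quad r) • (J.pd 0 i).onM (J.lc C J.s)
        - (J.pd 0 i).onR (J.quad r) • (J.pd 0 j).onM (J.lc C J.s) := by
  have hi := congrArg (J.pd 0 j).onM (h i)
  have hj := congrArg (J.pd 0 i).onM (h j)
  simp only [map_add, LieDer.map_smul, LieDer.map_lie, Derivation.leibniz, LieDer.map_ofNat,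
    smul_zero, zero_smul, zero_add, add_zero, smul_eq_mul] at hi hj
  rw [J.pd_comm 0 i 0 j] at hj
  rw [J.pd_comm 0 i 0 j] at hj
  set S := J.lc C J.s
  set Si := (J.pd 0 i).onM S
  set Sj := (J.pd 0 j).onM S
  have jac1 : ⁅S, ⁅Si, Sj⁆⁆ = ⁅⁅S, Si⁆, Sj⁆ + ⁅Si, ⁅S, Sj⁆⁆ := leibniz_lie _ _ _
  have e1 : ⁅Sj, ⁅S, Si⁆⁆ = -⁅⁅S, Si⁆, Sj⁆ := (lie_skew _ _).symm
  have e2 : ⁅S, ⁅Sj, Si⁆⁆ = -⁅S, ⁅Si, Sj⁆⁆ := by rw [← lie_skew Sj Si, lie_neg]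
  rw [e1, lie_add, e2] at hi
  rw [lie_add] at hj
  -- Cross-differentiation cancels the mixed second derivatives of E and S. The Jacobi identity
  -- merges the brackets into three copies of [S,[S_i,S_j]], and q carries the coefficient 3 too.
  have key : (3 : R) • ((2 : R) • ⁅S, ⁅Si, Sj⁆⁆ - ((J.pd 0 j).onR (J.quad r) • Si
        - (J.pd 0 i).onR (J.quad r) • Sj)) = 0 := by
    linear_combination (norm := module) hi - hj + (2 : R) • jac1
  exact sub_eq_zero.1 (eq_zero_of_ofNat_smul (𝕂 := 𝕂) key)

theorem ds_eq_sum_smul (w : Fin m → R) : J.ds w = ∑ i, w i • J.ds (Pi.single i 1) := by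
  ext l
  rw [ds_eq_sum, Finset.sum_apply]
  refine Finset.sum_congr rfl fun i _ => ?_
  rw [Pi.smul_apply, ← vec_pd_s, LieDer.vec_apply, smul_eq_mul]

theorem pd_lc_s (C : Fin (m + 1) → L) (i : Fin m) :
    (J.pd 0 i).onM (J.lc C J.s) = J.lc C (J.ds (Pi.single i 1)) := by
  rw [J.map_lc _ (J.pd_const 0 i), vec_pd_s]

/-- Both sides are `R`-bilinear, tangent vectors are combinations of the ds(e_i), and ∂_i q = 2 ∑
r_l s^l ∂_i s^l. -/
theorem tangent_identity
    (h : ∀ i j, (2 : R) • ⁅J.lc C J.s, ⁅(J.pd 0 i).onM (J.lc C J.s), (J.pd 0 j).onM (J.lc C J.s)⁆⁆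
      = (J.pd 0 j).onR (J.quad r) • (J.pd 0 i).onM (J.lc C J.s)
        - (J.pd 0 i).onR (J.quad r) • (J.pd 0 j).onM (J.lc C J.s))
    (v v' : Fin (m + 1) → R) (hv : pairing J.s v = 0) (hv' : pairing J.s v' = 0) :
    ⁅J.lc C J.s, ⁅J.lc C v, J.lc C v'⁆⁆
      = (∑ l, algebraMap 𝕂 R (r l) * J.s l * v' l) • J.lc C v
        - (∑ l, algebraMap 𝕂 R (r l) * J.s l * v l) • J.lc C v' := by
  obtain ⟨w, rfl⟩ := J.exists_ds_eq hv
  obtain ⟨w', rfl⟩ := J.exists_ds_eq hv'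
  change _ = pairing (fun l => algebraMap 𝕂 R (r l) * J.s l) _ • _
    - pairing (fun l => algebraMap 𝕂 R (r l) * J.s l) _ • _
  set p : Fin (m + 1) → R := fun l => algebraMap 𝕂 R (r l) * J.s l
  let κ : (Fin (m + 1) → R) →ₗ[R] R :=
    { toFun := pairing p
      map_add' := pairing_add_right p
      map_smul' := fun f v => pairing_smul_right f p v }
  change _ = κ _ • _ - κ _ • _
  have h1 : ∀ i j, ⁅J.lc C J.s, ⁅J.lc C (J.ds (Pi.single i 1)), J.lc C (J.ds (Pi.single j 1))⁆⁆
      = κ (J.ds (Pi.single j 1)) • J.lc C (J.ds (Pi.single i 1))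
        - κ (J.ds (Pi.single i 1)) • J.lc C (J.ds (Pi.single j 1)) := by
    intro i j
    have hκ : ∀ i, (J.pd 0 i).onR (J.quad r) = 2 * κ (J.ds (Pi.single i 1)) := fun i => by
      rw [map_quad, vec_pd_s]; rfl
    have := h i j
    rw [pd_lc_s, pd_lc_s, hκ, hκ] at this
    refine sub_eq_zero.1 (eq_zero_of_ofNat_smul (𝕂 := 𝕂) (R := R) (k := 2) ?_)
    linear_combination (norm := module) this
  have h2 : ∀ i, ⁅J.lc C J.s, ⁅J.lc C (J.ds (Pi.single i 1)), J.lc C (J.ds w')⁆⁆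
      = κ (J.ds w') • J.lc C (J.ds (Pi.single i 1))
        - κ (J.ds (Pi.single i 1)) • J.lc C (J.ds w') := by
    intro i
    simp only [ds_eq_sum_smul w', map_sum, map_smul, lie_sum, lie_smul, Finset.sum_smul,
      Finset.smul_sum, h1, ← Finset.sum_sub_distrib]
    refine Finset.sum_congr rfl fun j _ => ?_
    module
  simp only [ds_eq_sum_smul w, map_sum, map_smul, lie_sum, lie_smul, sum_lie, smul_lie,
    Finset.sum_smul, Finset.smul_sum, h2, ← Finset.sum_sub_distrib]
  refine Finset.sum_congr rfl fun j _ => ?_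
  module

/-- The function `E` in `B = D² A + [D A, A] - (3/2) H + E`. -/
noncomputable def potential (J : JetModel 𝕂 R L M m) (r : Fin (m + 1) → 𝕂) (C : Fin (m + 1) → L)
    (c : L) : M :=
  algebraMap 𝕂 R (1 / 2) • J.quad r • J.lc C J.s + J.lc (linCoeff r C) J.s + J.const c

theorem two_mul_half : 2 * algebraMap 𝕂 R (1 / 2) = 1 := by
  have h2 : (2 : R) = algebraMap 𝕂 R 2 := (_root_.map_ofNat _ 2).symm
  rw [h2, ← map_mul, mul_div_cancel₀ _ (two_ne_zero' 𝕂), map_one]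

theorem two_smul_potential (c : L) : (2 : R) • J.potential r C c =
    J.quad r • J.lc C J.s + (2 : R) • J.lc (linCoeff r C) J.s + (2 : R) • J.const c := by
  have h := two_mul_half (𝕂 := 𝕂) (R := R)
  rw [potential]
  match_scalars
  · linear_combination J.quad r * h
  · ring
  · ring

theorem ord_potential (c : L) : J.Ord 0 (J.potential r C c) := by
  refine ((Ord.smul (fun k _ i => (J.pd k i).onR.map_algebraMap _)
    (Ord.smul (fun k hk i => J.map_quad_eq_zero (J.pd_vec_u_ne hk.ne' i) r) (J.ord_lc_s C))).add
      (J.ord_lc_s _)).add (ord_const 0 c)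

/-- The general double bracket at y = s, v = Ds, where ⟨s,s⟩ = 1 and ⟨s,Ds⟩ = 0. -/
theorem lie_lie_lc_s (hm : 2 ≤ m)
    (triple : ∀ i j k, i ≠ j → j ≠ k → k ≠ i → ⁅C i, ⁅C j, C k⁆⁆ = 0)
    (double : ∀ i j k, i ≠ k → j ≠ k → ⁅C i, ⁅C i, C k⁆⁆ - ⁅C j, ⁅C j, C k⁆⁆ = (r j - r i) • C k)
    (D : LieDer 𝕂 R M) :
    (2 : R) • ⁅J.lc C J.s, ⁅J.lc C J.s, J.lc C (D.vec J.s)⁆⁆ =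
      (2 : R) • J.lc (linCoeff r C) (D.vec J.s) - (2 * J.quad r) • J.lc C (D.vec J.s)
        + D.onR (J.quad r) • J.lc C J.s := by
  rw [J.lie_lie_lc hm triple double, pairing_s_s, vec_s, pairing_s_ds, ← quad_eq, map_quad, vec_s]
  module

/-- By `lie_lie_lc_s` the right-hand side becomes q DS + (Dq) S + 2 ∑ K_l Ds^l, which is D of qS + 2
∑ K_l s^l. -/
theorem two_smul_map_potential (hm : 2 ≤ m)
    (triple : ∀ i j k, i ≠ j → j ≠ k → k ≠ i → ⁅C i, ⁅C j, C k⁆⁆ = 0)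
    (double : ∀ i j k, i ≠ k → j ≠ k → ⁅C i, ⁅C i, C k⁆⁆ - ⁅C j, ⁅C j, C k⁆⁆ = (r j - r i) • C k)
    (D : LieDer 𝕂 R M) (hD : ∀ c, D.onM (J.const c) = 0) (c : L) :
    (2 : R) • D.onM (J.potential r C c) = (3 * J.quad r) • D.onM (J.lc C J.s)
      + (2 : R) • ⁅J.lc C J.s, ⁅J.lc C J.s, D.onM (J.lc C J.s)⁆⁆ := by
  have h := congrArg D.onM (two_smul_potential (J := J) (r := r) (C := C) c)
  simp only [map_add, LieDer.map_smul, LieDer.map_ofNat, zero_smul, zero_add, hD, smul_zero,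
    add_zero, J.map_lc D hD] at h
  rw [h, J.map_lc D hD, lie_lie_lc_s hm triple double]
  module

theorem exists_eq_potential (hm : 2 ≤ m)
    (triple : ∀ i j k, i ≠ j → j ≠ k → k ≠ i → ⁅C i, ⁅C j, C k⁆⁆ = 0)
    (double : ∀ i j k, i ≠ k → j ≠ k → ⁅C i, ⁅C i, C k⁆⁆ - ⁅C j, ⁅C j, C k⁆⁆ = (r j - r i) • C k)
    {E : M} (hE : J.Ord 0 E)
    (h : ∀ i, (2 : R) • (J.pd 0 i).onM E = (3 * J.quad r) • (J.pd 0 i).onM (J.lc C J.s)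
      + (2 : R) • ⁅J.lc C J.s, ⁅J.lc C J.s, (J.pd 0 i).onM (J.lc C J.s)⁆⁆) :
    ∃ c, E = J.potential r C c := by
  obtain ⟨c, hc⟩ := J.exists_const (E - J.potential r C 0) fun k i => by
    rcases Nat.eq_zero_or_pos k with rfl | hk
    · refine eq_zero_of_ofNat_smul (𝕂 := 𝕂) (R := R) (k := 2) ?_
      have h1 := h i
      have h2 := two_smul_map_potential hm triple double (J.pd 0 i) (J.pd_const 0 i) 0
      rw [map_sub]
      linear_combination (norm := module) h1 - h2
    · rw [map_sub, hE k hk, ord_potential 0 k hk, sub_zero]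
  refine ⟨c, ?_⟩
  rw [potential, hc, potential, map_zero]
  module

/-- C_0 commutes with the C_k, hence with the K_k. The bracket [S, ∑ K_l s^l] is a quadratic form in
s whose symmetrized coefficients vanish by `lie_linCoeff_add`. Only brackets with c survive. -/
theorem lie_potential (hm : 2 ≤ m) (h0 : ∀ k, ⁅c₀, C k⁆ = 0)
    (triple : ∀ i j k, i ≠ j → j ≠ k → k ≠ i → ⁅C i, ⁅C j, C k⁆⁆ = 0)
    (double : ∀ i j k, i ≠ k → j ≠ k → ⁅C i, ⁅C i, C k⁆⁆ - ⁅C j, ⁅C j, C k⁆⁆ = (r j - r i) • C k)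
    (c : L) : ⁅J.const c₀ + J.lc C J.s, J.potential r C c⁆ =
      J.const ⁅c₀, c⁆ + J.lc (fun l => ⁅C l, c⁆) J.s := by
  have h1 : ∀ k, ⁅c₀, linCoeff r C k⁆ = 0 := by
    intro k
    have h2 : ∀ i j, ⁅c₀, ⁅C i, ⁅C i, C j⁆⁆ + r i • C j⁆ = 0 := fun i j => by
      rw [lie_add, lie_smul, h0, leibniz_lie c₀, leibniz_lie c₀ (C i) (C j), h0, h0]; simp
    rw [linCoeff]
    split_ifs with hk
    · exact h2 1 0
    · exact h2 0 k
  have h2 : ⁅J.lc C J.s, J.lc (linCoeff r C) J.s⁆ = 0 := by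
    have e : ⁅J.lc C J.s, J.lc (linCoeff r C) J.s⁆ =
        ∑ i, ∑ j, (J.s i * J.s j) • J.const ⁅C i, linCoeff r C j⁆ := by
      rw [lc_apply, lc_apply, sum_lie]
      refine Finset.sum_congr rfl fun i _ => ?_
      rw [lie_sum]
      refine Finset.sum_congr rfl fun j _ => ?_
      rw [smul_lie, lie_smul, J.const_lie, smul_smul]
    refine eq_zero_of_ofNat_smul (𝕂 := 𝕂) (R := R) (k := 2) ?_
    rw [two_smul, e]
    nth_rewrite 2 [Finset.sum_comm]
    simp only [← Finset.sum_add_distrib]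
    refine Finset.sum_eq_zero fun i _ => Finset.sum_eq_zero fun j _ => ?_
    rw [mul_comm (J.s j), ← smul_add, ← map_add, lie_linCoeff_add hm triple double, map_zero,
      smul_zero]
  rw [potential, lie_add, lie_add, add_lie, add_lie, add_lie, lie_smul, lie_smul, lie_smul,
    lie_smul,
    lie_const_lc, lc_eq_zero J h0, lie_const_lc, lc_eq_zero J h1, h2, lie_self, lie_lc_const,
    ← J.const_lie]
  simp

/-- Description of the pairs `(A, B)` satisfying the zero curvature equation. -/
theorem zero_curvature_iff (hm : 2 ≤ m) {A B : M} (hA : J.Ord 0 A) (hB : J.Ord 2 B) :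
    J.D.onM B - J.d1 A (rhs r J.u) + ⁅A, B⁆ = 0 ↔
      ∃ (c₀ : L) (C : Fin (m + 1) → L) (c : L), Relations r c₀ C c ∧ A = J.const c₀ + J.lc C J.s ∧
        B = J.D.onM (J.D.onM A) + ⁅J.D.onM A, A⁆
          + (J.threeHalves * (4 * J.dinv ^ 2 * pairing (J.u 1) (J.u 1))) • J.lc C J.s
          + J.potential r C c := by
  constructor
  · intro h
    obtain ⟨E, hE, hBE⟩ := exists_ord_zero hA hB h
    have h2 := two_smul_equation (r := r) hA hE hBE
    rw [h, smul_zero, eq_comm] at h2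
    -- Degree 3 determines A, degree 2 gives [C_0,C_k] = 0, degree 1 gives the remaining relations
    -- among the C_k and then E, and degree 0 the relations for C_{n+1}.
    obtain ⟨p3, p2, p1, p0⟩ := parts_eq_zero hA hE h2
    obtain ⟨c₀, C, rfl⟩ := J.exists_const_add_lc_s hm hA p3
    have h0 := comm_of_lie_hess_eq_zero hm p2
    have hE1 := two_smul_pd_of_linearPart_eq_zero h0 hE p1
    have ht := tangent_identity (lie_lie_pd_of_two_smul_pd hE1)
    have triple : ∀ i j k, i ≠ j → j ≠ k → k ≠ i → ⁅C i, ⁅C j, C k⁆⁆ = 0 :=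
      fun i j k hij _ hki => J.triple_of_tangent_identity ht hij hki
    have double : ∀ i j k, i ≠ k → j ≠ k →
        ⁅C i, ⁅C i, C k⁆⁆ - ⁅C j, ⁅C j, C k⁆⁆ = (r j - r i) • C k :=
      fun i j k hik hjk => J.double_of_tangent_identity ht hik hjk
    obtain ⟨c, rfl⟩ := exists_eq_potential hm triple double hE hE1
    rw [lie_potential hm h0 triple double] at p0
    obtain ⟨hc0, hc⟩ := J.const_add_lc_s_eq_zero (by omega) p0
    refine ⟨c₀, C, c, ⟨h0, triple, double, hc0, hc⟩, rfl, ?_⟩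
    rw [hBE, hess_const_add_lc_s]
    module
  · rintro ⟨c₀, C, c, ⟨h0, triple, double, hc0, hc⟩, rfl, hBE⟩
    have hE := ord_potential (J := J) (r := r) (C := C) c
    have hBE' : B = J.D.onM (J.D.onM (J.const c₀ + J.lc C J.s))
        + ⁅J.D.onM (J.const c₀ + J.lc C J.s), J.const c₀ + J.lc C J.s⁆
        - J.threeHalves • J.hess (J.const c₀ + J.lc C J.s) + J.potential r C c := by
      rw [hBE, hess_const_add_lc_s]
      module
    have h2 := two_smul_equation (r := r) hA hE hBE'
    refine eq_zero_of_ofNat_smul (𝕂 := 𝕂) (R := R) (k := 2) ?_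
    -- The linear part vanishes because the potential solves its equation along every derivation
    -- killing constants, in particular along `J.D`.
    have hD := two_smul_map_potential hm triple double J.D (J.field_const _ _) c
    rw [D_of_ord_zero hE, D_of_ord_zero (J.ord_lc_s C)] at hD
    rw [h2, cubicPart_const_add_lc_s, lie_hess_const_add_lc_s, lc_eq_zero J h0,
      linearPart_const_add_lc_s h0, hD, lie_potential hm h0 triple double, hc0, lc_eq_zero J hc,
      map_zero]
    module

theorem onR_s_eq_zero (J : JetModel 𝕂 R L M m) {D : LieDer 𝕂 R M} (hD : D.vec (J.u 0) = 0)
    (l : Fin (m + 1)) : D.onR (J.s l) = 0 := by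
  rw [← LieDer.vec_apply, vec_s, hD, ds_eq_sum]
  simp

theorem Ord.D {A : M} (hA : J.Ord 0 A) : J.Ord 1 (J.D.onM A) := by
  rw [D_of_ord_zero hA]
  exact hA.d1 fun k hk i => J.pd_vec_u_ne hk.ne' i

/-- Translation into coordinate-free sums: ∑ (D s^i)² = 4Δ⁻²⟨u_1,u_1⟩ is the metric on (u_1,u_1),
and ∑ r_i (s^i)² is `J.quad r`. -/
theorem zero_curvature_iff_form (hm : 2 ≤ m) {A B : M} (hA : J.Ord 0 A) (hB : J.Ord 2 B) :
    J.D.onM B - J.d1 A (rhs r J.u) + ⁅A, B⁆ = 0 ↔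
      ∃ (C0 : L) (C : Fin (m + 1) → L) (Cn1 : L), Relations r C0 C Cn1 ∧
        A = formA (fun f c => f • J.const c) (sphereCoord (J.u 0)) C0 C ∧
        B = formB (fun f c => f • J.const c) (fun X Y => ⁅X, Y⁆) J.D.onR J.D.onM
          r (sphereCoord (J.u 0)) A C Cn1 := by
  rw [zero_curvature_iff hm hA hB]
  refine exists_congr fun c₀ => exists_congr fun C => exists_congr fun c =>
    and_congr_right fun _ => ?_
  have eA : formA (fun f c => f • J.const c) (sphereCoord (J.u 0)) c₀ C
      = J.const c₀ + J.lc C J.s := by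
    rw [formA, one_smul]; rfl
  have hp : ∀ f : Fin (m + 1) → R, ∑ i, ∑ k, (J.s k * f i) • J.const (C k)
      = (∑ i, f i) • J.lc C J.s := by
    intro f
    rw [Finset.sum_smul]
    refine Finset.sum_congr rfl fun i _ => ?_
    rw [lc_apply, Finset.smul_sum]
    refine Finset.sum_congr rfl fun k _ => ?_
    module
  have e1 : ∑ i, J.D.onR (J.s i) ^ 2 = 4 * J.dinv ^ 2 * pairing (J.u 1) (J.u 1) := by
    rw [← J.D_vec_u (show 0 < 3 by norm_num), ← pairing_ds_ds, ← vec_s, pairing]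
    exact Finset.sum_congr rfl fun i _ => by rw [LieDer.vec_apply, sq]
  have e2 : ∑ i, ∑ k, r i • (J.s k * J.s i ^ 2) • J.const (C k) = J.quad r • J.lc C J.s := by
    rw [quad_eq, ← hp]
    refine Finset.sum_congr rfl fun i _ => Finset.sum_congr rfl fun k _ => ?_
    rw [← algebraMap_smul R (r i), smul_smul]
    congr 1; ring
  have eB : formB (fun f c => f • J.const c) (fun X Y => ⁅X, Y⁆) J.D.onR J.D.onM
      r (sphereCoord (J.u 0)) A C c = J.D.onM (J.D.onM A) + ⁅J.D.onM A, A⁆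
          + (J.threeHalves * (4 * J.dinv ^ 2 * pairing (J.u 1) (J.u 1))) • J.lc C J.s
          + J.potential r C c := by
    have h1 := hp fun i => J.D.onR (J.s i) ^ 2
    rw [e1] at h1
    simp only [formB]
    change _ + _ + (3 / 2 : 𝕂) • ∑ i, ∑ k, (J.s k * J.D.onR (J.s i) ^ 2) • J.const (C k)
      + (1 / 2 : 𝕂) • ∑ i, ∑ k, r i • (J.s k * J.s i ^ 2) • J.const (C k)
      + J.lc (linCoeff r C) J.s + (1 : R) • J.const c = _
    rw [h1, e2, potential, threeHalves, ← algebraMap_smul R (3 / 2 : 𝕂),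
      ← algebraMap_smul R (1 / 2 : 𝕂)]
    module
  rw [eA, eB]

end JetModel

/-! ## Functions with values in a Lie algebra as tensors -/

section Tensor

variable {𝕂 R L : Type*} [Field 𝕂] [CommRing R] [Algebra 𝕂 R] [LieRing L] [LieAlgebra 𝕂 L]

theorem rTensor_derivation_smul (d : Derivation 𝕂 R R) (f : R) (x : R ⊗[𝕂] L) :
    (d : R →ₗ[𝕂] R).rTensor L (f • x) = d f • x + f • (d : R →ₗ[𝕂] R).rTensor L x := by
  induction x using TensorProduct.induction_on with
  | zero => simp
  | add x y hx hy => rw [smul_add, map_add, hx, hy, map_add, smul_add, smul_add]; abel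
  | tmul g c =>
    rw [TensorProduct.smul_tmul', LinearMap.rTensor_tmul, LinearMap.rTensor_tmul,
      TensorProduct.smul_tmul', TensorProduct.smul_tmul', ← TensorProduct.add_tmul]
    congr 1
    simp only [smul_eq_mul, Derivation.coeFn_coe, Derivation.leibniz]
    ring

theorem rTensor_derivation_lie (d : Derivation 𝕂 R R) (x y : R ⊗[𝕂] L) :
    (d : R →ₗ[𝕂] R).rTensor L ⁅x, y⁆
      = ⁅(d : R →ₗ[𝕂] R).rTensor L x, y⁆ + ⁅x, (d : R →ₗ[𝕂] R).rTensor L y⁆ := by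
  induction x using TensorProduct.induction_on with
  | zero => simp
  | add x x' hx hx' => rw [add_lie, map_add, hx, hx', map_add, add_lie, add_lie]; abel
  | tmul f c =>
    induction y using TensorProduct.induction_on with
    | zero => simp
    | add x y hx hy => rw [lie_add, map_add, hx, hy, map_add, lie_add, lie_add]; abel
    | tmul g d' =>
      rw [LieAlgebra.ExtendScalars.bracket_tmul, LinearMap.rTensor_tmul, LinearMap.rTensor_tmul,
        LinearMap.rTensor_tmul, LieAlgebra.ExtendScalars.bracket_tmul,
        LieAlgebra.ExtendScalars.bracket_tmul, ← TensorProduct.add_tmul]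
      congr 1
      simp only [Derivation.coeFn_coe, Derivation.leibniz, smul_eq_mul]
      ring

/-- The extension of a derivation of `R` to the functions with values in `L`. -/
noncomputable def LieDer.ofDerivation (L : Type*) [LieRing L] [LieAlgebra 𝕂 L]
    (d : Derivation 𝕂 R R) : LieDer 𝕂 R (R ⊗[𝕂] L) where
  onR := d
  onM := ((d : R →ₗ[𝕂] R).rTensor L).toAddMonoidHom
  smul' := rTensor_derivation_smul d
  lie' := rTensor_derivation_lie d

/-- The coefficients of an `L`-valued function with respect to a basis of `L`. -/
theorem exists_basis_repr (x : R ⊗[𝕂] L) :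
    ∃ f : Module.Basis.ofVectorSpaceIndex 𝕂 L →₀ R,
      x = ∑ j ∈ f.support, f j ⊗ₜ[𝕂] Module.Basis.ofVectorSpace 𝕂 L j ∧
      ∀ φ : R →ₗ[𝕂] R, φ.rTensor L x = 0 → ∀ j, φ (f j) = 0 := by
  let b := Module.Basis.ofVectorSpace 𝕂 L
  obtain ⟨f, rfl⟩ := TensorProduct.eq_repr_basis_right b x
  refine ⟨f, rfl, fun φ h j => ?_⟩
  have h1 : (f.mapRange φ (map_zero _)).sum (fun j g => g ⊗ₜ[𝕂] b j) = 0 := by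
    rw [Finsupp.sum_mapRange_index (h := fun j g => g ⊗ₜ[𝕂] b j)
      (fun _ => TensorProduct.zero_tmul _ _), ← h, Finsupp.sum,
      Finsupp.sum, map_sum]
    rfl
  simpa using DFunLike.congr_fun (TensorProduct.sum_tmul_basis_right_eq_zero b _ h1) j

/-- Expansion in a basis of `L` reduces the identity to scalar coefficients, which inherit the
vanishing conditions from `x`. It lets infinite sums of partial derivatives be truncated on tensors.
-/
theorem rTensor_eq_sum {ι : Type*} {s : Finset ι} {φ : R →ₗ[𝕂] R} {Q : ι → R} {d : ι → R →ₗ[𝕂] R}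
    {P : Set (R →ₗ[𝕂] R)} (h : ∀ f, (∀ ψ ∈ P, ψ f = 0) → φ f = ∑ k ∈ s, Q k * d k f)
    {x : R ⊗[𝕂] L} (hx : ∀ ψ ∈ P, ψ.rTensor L x = 0) :
    φ.rTensor L x = ∑ k ∈ s, Q k • (d k).rTensor L x := by
  obtain ⟨f, hfx, hf⟩ := exists_basis_repr x
  have h1 : ∀ ψ : R →ₗ[𝕂] R, ψ.rTensor L x =
      ∑ j ∈ f.support, ψ (f j) ⊗ₜ[𝕂] Module.Basis.ofVectorSpace 𝕂 L j := fun ψ => by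
    nth_rewrite 1 [hfx]
    rw [map_sum]
    rfl
  simp only [h1, Finset.smul_sum, TensorProduct.smul_tmul', smul_eq_mul]
  rw [Finset.sum_comm]
  refine Finset.sum_congr rfl fun j _ => ?_
  rw [h _ fun ψ hψ => hf ψ (hx ψ hψ) j, TensorProduct.sum_tmul]

end Tensor

/-! ## The model of smooth functions -/

section SmoothModel

variable {𝕂 : Type*} [RCLike 𝕂] {m : ℕ} (U : TopologicalSpace.Opens (Jet 𝕂 m))

theorem pd_apply_eq {l : ℕ} {f : smoothFun (U : Set (Jet 𝕂 m))}
    {g : (Fin (l + 1) → Fin m → 𝕂) → 𝕂}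
    (hg : ∀ p : U, ContDiffAt 𝕂 ∞ g (trunc l p.1)) (hfg : ∀ p : U, f.1 p = g (trunc l p.1))
    (k : ℕ) (i : Fin m) (p : U) :
    (pd U k i f).1 p = fderiv 𝕂 g (trunc l p.1)
      (fun j => if (j : ℕ) = k then Pi.single i (1 : 𝕂) else 0) :=
  partialFun_eq U hg hfg k i p

/-- The partial derivative as a derivation of the algebra of smooth functions. -/
noncomputable def pdDer (k : ℕ) (i : Fin m) :
    Derivation 𝕂 (smoothFun (U : Set (Jet 𝕂 m))) (smoothFun (U : Set (Jet 𝕂 m))) :=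
  Derivation.mk' (pd U k i) fun f f' => by
    obtain ⟨f, l, hf⟩ := f
    obtain ⟨f', l', hf'⟩ := f'
    obtain ⟨g, hg, hfg⟩ := hf.mono (le_max_left l l')
    obtain ⟨g', hg', hfg'⟩ := hf'.mono (le_max_right l l')
    ext p
    have h1 := partialFun_eq U hg hfg k i p
    have h2 := partialFun_eq U hg' hfg' k i p
    have h3 := partialFun_eq U (f := f * f') (g := g * g') (fun p => (hg p).mul (hg' p))
      (fun p => by simp [hfg, hfg']) k i p
    rw [fderiv_mul ((hg p).differentiableAt (by simp)) ((hg' p).differentiableAt (by simp))] at h3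
    change partialFun (U : Set (Jet 𝕂 m)) k i (f * f') p
      = f p * partialFun (U : Set (Jet 𝕂 m)) k i f' p
        + f' p * partialFun (U : Set (Jet 𝕂 m)) k i f p
    rw [h1, h2, h3, hfg, hfg']; rfl

theorem pd_pd_comm (k : ℕ) (i : Fin m) (l : ℕ) (j : Fin m) (f : smoothFun (U : Set (Jet 𝕂 m))) :
    pd U k i (pd U l j f) = pd U l j (pd U k i f) := by
  obtain ⟨N, g, hg, hfg⟩ := f.2
  let e : ℕ → Fin m → Fin (N + 1) → Fin m → 𝕂 :=
    fun k i j => if (j : ℕ) = k then Pi.single i (1 : 𝕂) else 0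
  have hd : ∀ p : U, ContDiffAt 𝕂 ∞ (fderiv 𝕂 g) (trunc N p.1) := fun p =>
    (hg p).fderiv_right (m := ∞) (by simp)
  have h2 : ∀ (k : ℕ) (i : Fin m) (l : ℕ) (j : Fin m) (p : U), (pd U k i (pd U l j f)).1 p =
      fderiv 𝕂 (fderiv 𝕂 g) (trunc N p.1) (e k i) (e l j) := by
    intro k i l j p
    rw [pd_apply_eq U (g := fun q => fderiv 𝕂 g q (e l j))
      (fun p => (hd p).clm_apply contDiffAt_const) (fun p => pd_apply_eq U hg hfg l j p) k i p,
      fderiv_clm_apply ((hd p).differentiableAt (by simp)) (differentiableAt_const _)]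
    simp [e]
  ext p
  rw [h2, h2]
  exact (hg p).isSymmSndFDerivAt
    (by rw [minSmoothness_of_isRCLikeNormedField]; exact WithTop.coe_le_coe.2 le_top) _ _

theorem pd_coordFun (k : ℕ) (i : Fin m) (l : ℕ) (j : Fin m) :
    pd U k i (coordFun (U : Set (Jet 𝕂 m)) l j) = if k = l ∧ i = j then 1 else 0 := by
  ext p
  let φ : (Fin (l + 1) → Fin m → 𝕂) →L[𝕂] 𝕂 :=
    (ContinuousLinearMap.proj (R := 𝕂) (φ := fun _ : Fin m => 𝕂) j).comp
      (ContinuousLinearMap.proj (R := 𝕂) (φ := fun _ : Fin (l + 1) => Fin m → 𝕂) (Fin.last l))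
  rw [pd_apply_eq U (g := φ) (fun p => φ.contDiff.contDiffAt) (fun p => rfl), φ.fderiv]
  by_cases hk : k = l
  · subst hk
    by_cases hij : i = j
    · subst hij; simp [φ]
    · simp [φ, hij, Pi.single_apply, Ne.symm hij]
  · simp [φ, hk, Ne.symm hk]

/-- A smooth function on a connected open set all of whose partial derivatives vanish is
constant. -/
theorem exists_eq_algebraMap (hU : IsConnected (U : Set (Jet 𝕂 m)))
    (f : smoothFun (U : Set (Jet 𝕂 m))) (hf : ∀ k i, pd U k i f = 0) :
    ∃ a : 𝕂, f = algebraMap 𝕂 _ a := by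
  obtain ⟨N, g, hg, hfg⟩ := f.2
  have hd : ∀ p : U, fderiv 𝕂 g (trunc N p.1) = 0 := by
    intro p
    ext v
    have hv : v = ∑ k : Fin (N + 1), ∑ i, v k i •
        (fun j : Fin (N + 1) => if (j : ℕ) = k then Pi.single i (1 : 𝕂) else 0) := by
      ext k i
      simp only [Finset.sum_apply, Pi.smul_apply, smul_eq_mul, Fin.val_inj]
      rw [Finset.sum_eq_single k, Finset.sum_eq_single i]
      · simp
      · intro j _ hj; simp [Pi.single_apply, Ne.symm hj]
      · simp
      · intro j _ hj; simp [Ne.symm hj]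
      · simp
    rw [hv, map_sum]
    refine Finset.sum_eq_zero fun k _ => ?_
    rw [map_sum]
    refine Finset.sum_eq_zero fun i _ => ?_
    rw [map_smul, ← pd_apply_eq U hg hfg k i p, hf]
    exact smul_zero _
  have hloc : IsLocallyConstant f.1 := by
    rw [IsLocallyConstant.iff_eventually_eq]
    intro p
    -- The truncation of a convex neighbourhood inside U is convex, and each of its points is the
    -- truncation of a point of U, where the derivative of `g` is zero. The mean value inequality
    -- then makes `g` constant on it.
    obtain ⟨W, ⟨hW, hWc⟩, hWU⟩ := (LocallyConvexSpace.convex_basis (𝕜 := ℝ) p.1).mem_iff.1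
      (U.isOpen.mem_nhds p.2)
    have hWp : p.1 ∈ W := mem_of_mem_nhds hW
    filter_upwards [continuous_subtype_val.continuousAt.preimage_mem_nhds hW] with q hq
    let T : Jet 𝕂 m →ₗ[ℝ] (Fin (N + 1) → Fin m → 𝕂) :=
      { toFun := trunc N, map_add' := fun _ _ => rfl, map_smul' := fun _ _ => rfl }
    have hconv : Convex ℝ (T '' W) := hWc.linear_image T
    have h := hconv.norm_image_sub_le_of_norm_hasFDerivWithin_le (𝕜 := 𝕂) (f := g)
      (f' := fun _ => 0) (C := 0) (x := T p.1) (y := T q.1) ?_ (by simp) ⟨_, hWp, rfl⟩ ⟨_, hq, rfl⟩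
    · rw [zero_mul, norm_le_zero_iff, sub_eq_zero] at h
      rw [hfg, hfg]; exact h
    · rintro _ ⟨x, hx, rfl⟩
      have := ((hg ⟨x, hWU hx⟩).differentiableAt (by simp)).hasFDerivAt
      rw [hd ⟨x, hWU hx⟩] at this
      exact this.hasFDerivWithinAt
  have : PreconnectedSpace (U : Set (Jet 𝕂 m)) :=
    isPreconnected_iff_preconnectedSpace.1 hU.isPreconnected
  obtain ⟨p₀, hp₀⟩ := hU.nonempty
  exact ⟨f.1 ⟨p₀, hp₀⟩, Subtype.ext (funext fun p =>
    hloc.apply_eq_of_preconnectedSpace p ⟨p₀, hp₀⟩)⟩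

variable (L : Type*) [LieRing L] [LieAlgebra 𝕂 L]

theorem coe_pdDer (k : ℕ) (i : Fin m) :
    (pdDer U k i : smoothFun (U : Set (Jet 𝕂 m)) →ₗ[𝕂] smoothFun (U : Set (Jet 𝕂 m))) = pd U k i :=
  rfl

theorem vecField_apply_eq (Q : ℕ → Fin m → smoothFun (U : Set (Jet 𝕂 m))) {N : ℕ}
    {f : smoothFun (U : Set (Jet 𝕂 m))} (hf : ∀ k, N ≤ k → ∀ i, pd U k i f = 0) :
    vecField U Q f = ∑ k ∈ Finset.range N, ∑ i, Q k i * pd U k i f := by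
  refine finsum_eq_sum_of_support_subset _ fun k hk => ?_
  by_contra hkN
  refine hk (Finset.sum_eq_zero fun i _ => ?_)
  rw [hf k (by simpa using hkN), mul_zero]

theorem rTensor_vecField_eq (Q : ℕ → Fin m → smoothFun (U : Set (Jet 𝕂 m))) {N : ℕ}
    {x : LieFun L (U : Set (Jet 𝕂 m))} (hx : ∀ k, N ≤ k → ∀ i, (pd U k i).rTensor L x = 0) :
    (vecField U Q).rTensor L x = ∑ k ∈ Finset.range N, ∑ i, Q k i • (pd U k i).rTensor L x := by
  rw [rTensor_eq_sum (s := Finset.range N ×ˢ Finset.univ) (Q := fun q : ℕ × Fin m => Q q.1 q.2)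
    (d := fun q => pd U q.1 q.2) (P := {ψ | ∃ k i, N ≤ k ∧ ψ = pd U k i}), Finset.sum_product]
  · intro f hf
    rw [vecField_apply_eq U Q fun k hk i => hf _ ⟨k, i, hk, rfl⟩, Finset.sum_product]
  · rintro _ ⟨k, i, hk, rfl⟩
    exact hx k hk i

/-- Smooth functions on a connected open subset of the jet space. -/
noncomputable def smoothModel (hU : IsConnected (U : Set (Jet 𝕂 m)))
    (hδ : ∀ p ∈ U, delta (p 0) ≠ 0) :
    JetModel 𝕂 (smoothFun (U : Set (Jet 𝕂 m))) L (LieFun L (U : Set (Jet 𝕂 m))) m where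
  u := coordFun (U : Set (Jet 𝕂 m))
  isUnit_delta := isUnit_delta_smooth _ hδ
  pd k i := LieDer.ofDerivation L (pdDer U k i)
  pd_u := pd_coordFun U
  pd_comm k i l j x := by
    change (pd U k i).rTensor L ((pd U l j).rTensor L x)
      = (pd U l j).rTensor L ((pd U k i).rTensor L x)
    rw [← LinearMap.comp_apply, ← LinearMap.comp_apply, ← LinearMap.rTensor_comp,
      ← LinearMap.rTensor_comp]
    congr 2
    ext1 f
    exact pd_pd_comm U k i l j f
  const := TensorProduct.mk 𝕂 _ L 1
  const_lie x y := by
    rw [TensorProduct.mk_apply, TensorProduct.mk_apply, TensorProduct.mk_apply,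
      LieAlgebra.ExtendScalars.bracket_tmul, mul_one]
  const_injective := by
    obtain ⟨p₀, hp₀⟩ := hU.nonempty
    let ev : smoothFun (U : Set (Jet 𝕂 m)) →ₗ[𝕂] 𝕂 :=
      { toFun := fun f => f.1 ⟨p₀, hp₀⟩, map_add' := fun _ _ => rfl, map_smul' := fun _ _ => rfl }
    -- Evaluation at a point of U is a left inverse of the inclusion of constants.
    have h : ∀ c : L, TensorProduct.lid 𝕂 L (ev.rTensor L (TensorProduct.mk 𝕂 _ L 1 c)) = c := by
      intro c
      rw [TensorProduct.mk_apply, LinearMap.rTensor_tmul, TensorProduct.lid_tmul]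
      exact one_smul _ _
    exact Function.LeftInverse.injective (g := fun x => TensorProduct.lid 𝕂 L (ev.rTensor L x)) h
  pd_const k i c := by
    change (pd U k i).rTensor L (1 ⊗ₜ c) = 0
    rw [LinearMap.rTensor_tmul, ← coe_pdDer, Derivation.coeFn_coe, Derivation.map_one_eq_zero,
      TensorProduct.zero_tmul]
  exists_const x hx := by
    obtain ⟨f, hfx, hf⟩ := exists_basis_repr x
    choose a ha using fun j => exists_eq_algebraMap U hU (f j) fun k i => hf (pd U k i) (hx k i) j
    refine ⟨∑ j ∈ f.support, a j • Module.Basis.ofVectorSpace 𝕂 L j, ?_⟩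
    rw [map_sum, hfx]
    refine Finset.sum_congr rfl fun j _ => ?_
    rw [ha j, Algebra.algebraMap_eq_smul_one, TensorProduct.smul_tmul, TensorProduct.mk_apply]

variable {L} {U}

theorem rTensor_pd_eq_zero {l : ℕ} {x : LieFun L (U : Set (Jet 𝕂 m))}
    (hx : x ∈ lieFunOfOrder L (U : Set (Jet 𝕂 m)) l) {k : ℕ} (hk : l < k) (i : Fin m) :
    (pd U k i).rTensor L x = 0 := by
  obtain ⟨y, rfl⟩ := hx
  rw [← LinearMap.comp_apply, ← LinearMap.rTensor_comp]
  have : pd U k i ∘ₗ (smoothFunOfOrder (U : Set (Jet 𝕂 m)) l).subtype = 0 := by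
    ext1 f
    exact Subtype.ext (partialFun_eq_zero U f.2 hk i)
  rw [this, LinearMap.rTensor_zero, LinearMap.zero_apply]

theorem zero_curvature_iff_smooth (hm : 2 ≤ m) (r : Fin (m + 1) → 𝕂)
    (hU : IsConnected (U : Set (Jet 𝕂 m))) (hδ : ∀ p ∈ U, delta (p 0) ≠ 0)
    {A B : LieFun L (U : Set (Jet 𝕂 m))} (hA : A ∈ lieFunOfOrder L (U : Set (Jet 𝕂 m)) 0)
    (hB : B ∈ lieFunOfOrder L (U : Set (Jet 𝕂 m)) 2) :
    (Dx U).rTensor L B - (Dt U r).rTensor L A + ⁅A, B⁆ = 0 ↔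
      ∃ (C0 : L) (C : Fin (m + 1) → L) (Cn1 : L), Relations r C0 C Cn1 ∧
        A = formA (fun f c => f ⊗ₜ[𝕂] c)
          (sphereCoord (coordFun (U : Set (Jet 𝕂 m)) 0)) C0 C ∧
        B = formB (fun f c => f ⊗ₜ[𝕂] c) (fun X Y => ⁅X, Y⁆) (Dx U) ((Dx U).rTensor L)
          r (sphereCoord (coordFun (U : Set (Jet 𝕂 m)) 0)) A C Cn1 := by
  let J := smoothModel U L hU hδ
  have oA : J.Ord 0 A := fun k hk i => rTensor_pd_eq_zero hA hk i
  have oB : J.Ord 2 B := fun k hk i => rTensor_pd_eq_zero hB hk i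
  -- The infinite sum stops at k = 2 on functions of order at most two, where it is the truncated
  -- field `J.D`. For `Dt` on A only k = 0 remains.
  have hDx : ∀ {x}, J.Ord 2 x → (Dx U).rTensor L x = J.D.onM x := fun {x} hx => by
    rw [Dx, rTensor_vecField_eq U L _ (N := 3) (fun k hk i => hx k hk i), JetModel.D,
      JetModel.field_onM]
    rfl
  have hDt : (Dt U r).rTensor L A = J.d1 A (rhs r J.u) := by
    rw [Dt, rTensor_vecField_eq U L _ (N := 1) (fun k hk i => oA k hk i), JetModel.d1_apply,
      Finset.sum_range_one]
    rfl
  have hmk : (fun f c => f ⊗ₜ[𝕂] c : smoothFun (U : Set (Jet 𝕂 m)) → L → _)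
      = fun f c => f • J.const c := by
    funext f c
    change _ = f • (1 ⊗ₜ[𝕂] c)
    rw [TensorProduct.smul_tmul', smul_eq_mul, mul_one]
  have hdR : ∀ i, Dx U (sphereCoord (coordFun (U : Set (Jet 𝕂 m)) 0) i) = J.D.onR (J.s i) :=
    fun i => by
      change Dx U (J.s i) = _
      rw [Dx, vecField_apply_eq U _ (N := 3) (fun k hk j => J.onR_s_eq_zero
        (J.pd_vec_u_ne (by omega) j) i), JetModel.D, JetModel.field_onR]
      rfl
  rw [hDx oB, hDt, hmk, J.zero_curvature_iff_form hm oA oB]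
  simp only [formB, hdR, hDx (oA.mono (by omega)), hDx ((JetModel.Ord.D oA).mono (by omega))]
  rfl

end SmoothModel

/-! ## Sums over antidiagonals -/

section Antidiagonal

variable {ι X : Type*} [AddCommMonoid X]

section Monoid

variable [AddCommMonoid ι] [Finset.HasAntidiagonal ι]

theorem sum_antidiagonal_assoc (γ : ι) (F : ι → ι → ι → X) :
    ∑ p ∈ Finset.HasAntidiagonal.antidiagonal γ,
        ∑ q ∈ Finset.HasAntidiagonal.antidiagonal p.1, F q.1 q.2 p.2
      = ∑ p ∈ Finset.HasAntidiagonal.antidiagonal γ,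
        ∑ q ∈ Finset.HasAntidiagonal.antidiagonal p.2, F p.1 q.1 q.2 := by
  rw [Finset.sum_sigma', Finset.sum_sigma']
  refine Finset.sum_nbij' (fun x => ⟨(x.2.1, x.2.2 + x.1.2), (x.2.2, x.1.2)⟩)
    (fun x => ⟨(x.1.1 + x.2.1, x.2.2), (x.1.1, x.2.1)⟩) ?_ ?_ ?_ ?_ ?_
  · rintro ⟨⟨a, b⟩, ⟨c, d⟩⟩
    simp only [Finset.mem_sigma, Finset.HasAntidiagonal.mem_antidiagonal]
    rintro ⟨rfl, rfl⟩
    exact ⟨(add_assoc _ _ _).symm, trivial⟩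
  · rintro ⟨⟨a, b⟩, ⟨c, d⟩⟩
    simp only [Finset.mem_sigma, Finset.HasAntidiagonal.mem_antidiagonal]
    rintro ⟨rfl, rfl⟩
    exact ⟨add_assoc _ _ _, trivial⟩
  · rintro ⟨⟨a, b⟩, ⟨c, d⟩⟩
    simp only [Finset.mem_sigma, Finset.HasAntidiagonal.mem_antidiagonal]
    rintro ⟨_, rfl⟩
    rfl
  · rintro ⟨⟨a, b⟩, ⟨c, d⟩⟩
    simp only [Finset.mem_sigma, Finset.HasAntidiagonal.mem_antidiagonal]
    rintro ⟨_, rfl⟩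
    rfl
  · intros; rfl

theorem sum_antidiagonal_comm (γ : ι) (F : ι → ι → X) :
    ∑ p ∈ Finset.HasAntidiagonal.antidiagonal γ, F p.1 p.2
      = ∑ p ∈ Finset.HasAntidiagonal.antidiagonal γ, F p.2 p.1 := by
  refine Finset.sum_nbij' Prod.swap Prod.swap ?_ ?_ ?_ ?_ ?_ <;>
    simp [add_comm]

theorem sum_antidiagonal_left_comm (γ : ι) (F : ι → ι → ι → X) :
    ∑ p ∈ Finset.HasAntidiagonal.antidiagonal γ,
        ∑ q ∈ Finset.HasAntidiagonal.antidiagonal p.2, F p.1 q.1 q.2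
      = ∑ p ∈ Finset.HasAntidiagonal.antidiagonal γ,
        ∑ q ∈ Finset.HasAntidiagonal.antidiagonal p.2, F q.1 p.1 q.2 := by
  rw [← sum_antidiagonal_assoc γ F, ← sum_antidiagonal_assoc γ fun a b c => F b a c]
  exact Finset.sum_congr rfl fun p _ => sum_antidiagonal_comm p.1 fun a b => F a b p.2

end Monoid

/-- On the antidiagonal of γ + e_q the exponents of q add up to γ q + 1, which splits the sum in
two. In each half the terms with exponent zero vanish and the others are shifted from the
antidiagonal of γ. It serves for products and brackets alike. -/
theorem sum_antidiagonal_leibniz {σ : Type*} [Finset.HasAntidiagonal (σ →₀ ℕ)] (γ : σ →₀ ℕ) (q : σ)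
    (F : (σ →₀ ℕ) → (σ →₀ ℕ) → X) :
    (γ q + 1) • ∑ p ∈ Finset.HasAntidiagonal.antidiagonal (γ + Finsupp.single q 1), F p.1 p.2
      = ∑ p ∈ Finset.HasAntidiagonal.antidiagonal γ,
          ((p.1 : σ →₀ ℕ) q + 1) • F (p.1 + Finsupp.single q 1) p.2
        + ∑ p ∈ Finset.HasAntidiagonal.antidiagonal γ,
          ((p.2 : σ →₀ ℕ) q + 1) • F p.1 (p.2 + Finsupp.single q 1) := by
  have key : ∀ F : (σ →₀ ℕ) → (σ →₀ ℕ) → X, ∑ p ∈ Finset.HasAntidiagonal.antidiagonal γ,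
      ((p.1 : σ →₀ ℕ) q + 1) • F (p.1 + Finsupp.single q 1) p.2 =
      ∑ p ∈ Finset.HasAntidiagonal.antidiagonal (γ + Finsupp.single q 1),
        (p.1 : σ →₀ ℕ) q • F p.1 p.2 := by
    intro F
    refine Finset.sum_of_injOn (fun p => (p.1 + Finsupp.single q 1, p.2)) ?_ ?_ ?_ ?_
    · rintro ⟨a, b⟩ _ ⟨c, d⟩ _ h
      simpa using h
    · rintro ⟨a, b⟩ h
      rw [Finset.mem_coe, Finset.HasAntidiagonal.mem_antidiagonal] at h
      rw [Finset.mem_coe, Finset.HasAntidiagonal.mem_antidiagonal, ← h]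
      exact add_right_comm _ _ _
    · rintro ⟨a, b⟩ h hn
      rw [Finset.HasAntidiagonal.mem_antidiagonal] at h
      by_cases ha : (a : σ →₀ ℕ) q = 0
      · exact (congrArg (· • F a b) ha).trans (zero_smul _ _)
      · have hle : Finsupp.single q 1 ≤ a := by
          rw [Finsupp.single_le_iff]; omega
        refine absurd ⟨(a - Finsupp.single q 1, b), ?_, ?_⟩ hn
        · rw [Finset.mem_coe, Finset.HasAntidiagonal.mem_antidiagonal]
          refine add_right_cancel (b := Finsupp.single q 1) ?_
          rw [← h, add_right_comm]
          change a - _ + _ + b = a + b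
          rw [tsub_add_cancel_of_le hle]
        · exact Prod.ext (tsub_add_cancel_of_le hle) rfl
    · rintro ⟨a, b⟩ _
      simp
  have key2 := key fun a b => F b a
  rw [sum_antidiagonal_comm (γ + _) fun (a b : σ →₀ ℕ) => a q • F b a,
    sum_antidiagonal_comm γ fun (a b : σ →₀ ℕ) => (a q + 1) • F b (a + Finsupp.single q 1)] at key2
  rw [key F, key2, ← Finset.sum_add_distrib, Finset.smul_sum]
  refine Finset.sum_congr rfl fun p hp => ?_
  rw [Finset.HasAntidiagonal.mem_antidiagonal] at hp
  have := DFunLike.congr_fun hp q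
  rw [← add_smul]
  congr 1
  simpa using this.symm

end Antidiagonal

/-! ## The model of formal power series -/

section FormalModel

variable {𝕂 : Type*} [RCLike 𝕂] {m : ℕ} {L : Type*} [LieRing L] [LieAlgebra 𝕂 L]

theorem Series.mulLeft_apply (f : Series m 𝕂) (A : Series m L) (γ : JetVar m →₀ ℕ) :
    Series.mulLeft f A γ = ∑ p ∈ Finset.HasAntidiagonal.antidiagonal γ, f p.1 • A p.2 := rfl

theorem Series.bracket_apply (A B : Series m L) (γ : JetVar m →₀ ℕ) :
    Series.bracket A B γ = ∑ p ∈ Finset.HasAntidiagonal.antidiagonal γ, ⁅A p.1, B p.2⁆ := rfl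

theorem Series.pd_apply (k : ℕ) (i : Fin m) (A : Series m L) (γ : JetVar m →₀ ℕ) :
    Series.pd k i A γ = (γ (k, i) + 1) • A (γ + Finsupp.single (k, i) 1) := rfl

theorem Series.add_apply (A B : Series m L) (γ : JetVar m →₀ ℕ) : (A + B) γ = A γ + B γ := rfl

theorem Series.mulLeft_scalar (f g : Series m 𝕂) : Series.mulLeft f g = f * g := by
  classical
  ext γ
  rw [MvPowerSeries.coeff_mul]
  rfl

theorem Series.mul_apply (f g : Series m 𝕂) (γ : JetVar m →₀ ℕ) :
    (f * g) γ = ∑ p ∈ Finset.HasAntidiagonal.antidiagonal γ, f p.1 * g p.2 := by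
  rw [← Series.mulLeft_scalar]
  rfl

/-- Convolution with a series concentrated in degree zero has a single term. -/
theorem sum_antidiagonal_ite_right {X : Type*} [AddCommMonoid X] (γ : JetVar m →₀ ℕ)
    (F : (JetVar m →₀ ℕ) → (JetVar m →₀ ℕ) → X) (hF : ∀ a b, b ≠ 0 → F a b = 0) :
    ∑ p ∈ Finset.HasAntidiagonal.antidiagonal γ, F p.1 p.2 = F γ 0 := by
  rw [Finset.sum_eq_single (γ, 0)]
  · rintro ⟨a, b⟩ h hne
    rw [Finset.HasAntidiagonal.mem_antidiagonal] at h
    refine hF a b fun hb => hne ?_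
    subst hb
    simpa using h
  · intro h
    exact absurd (Finset.HasAntidiagonal.mem_antidiagonal.2 (add_zero γ)) h

variable (m 𝕂 L) in
/-- Series with coefficients in `L` as a module over the scalar series. -/
@[reducible] noncomputable def Series.module : Module (Series m 𝕂) (Series m L) where
  smul := Series.mulLeft
  one_smul A := by
    funext γ
    classical
    change Series.mulLeft 1 A γ = A γ
    rw [Series.mulLeft_apply, sum_antidiagonal_comm γ fun a b => (1 : Series m 𝕂) a • A b,
      sum_antidiagonal_ite_right γ fun a b => (1 : Series m 𝕂) b • A a]
    · change MvPowerSeries.coeff 0 (1 : MvPowerSeries (JetVar m) 𝕂) • A γ = A γ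
      simp
    · intro a b hb
      change MvPowerSeries.coeff b (1 : MvPowerSeries (JetVar m) 𝕂) • A a = 0
      rw [MvPowerSeries.coeff_one, if_neg hb, zero_smul]
  mul_smul f g A := by
    funext γ
    change Series.mulLeft (f * g) A γ = Series.mulLeft f (Series.mulLeft g A) γ
    simp only [Series.mulLeft_apply, Series.mul_apply, Finset.sum_smul, Finset.smul_sum]
    rw [sum_antidiagonal_assoc γ fun a b c => (f a * g b) • A c]
    simp only [mul_smul]
  smul_zero f := by
    funext γ
    change Series.mulLeft f (0 : Series m L) γ = 0
    rw [Series.mulLeft_apply]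
    exact Finset.sum_eq_zero fun p _ => smul_zero _
  zero_smul A := by
    funext γ
    change Series.mulLeft (0 : Series m 𝕂) A γ = 0
    rw [Series.mulLeft_apply]
    exact Finset.sum_eq_zero fun p _ => zero_smul _ _
  smul_add f A B := by
    funext γ
    change Series.mulLeft f (A + B) γ = Series.mulLeft f A γ + Series.mulLeft f B γ
    simp only [Series.mulLeft_apply, Series.add_apply, smul_add, Finset.sum_add_distrib]
  add_smul f g A := by
    funext γ
    change Series.mulLeft (f + g) A γ = Series.mulLeft f A γ + Series.mulLeft g A γ
    simp only [Series.mulLeft_apply, ← Finset.sum_add_distrib]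
    exact Finset.sum_congr rfl fun p _ => add_smul _ _ _

variable (m L) in
/-- The Lie ring of series with coefficients in `L`. -/
@[reducible] noncomputable def Series.lieRing : LieRing (Series m L) where
  bracket := Series.bracket
  add_lie A B C := by
    funext γ
    change Series.bracket (A + B) C γ = Series.bracket A C γ + Series.bracket B C γ
    simp only [Series.bracket_apply, Series.add_apply, add_lie, Finset.sum_add_distrib]
  lie_add A B C := by
    funext γ
    change Series.bracket A (B + C) γ = Series.bracket A B γ + Series.bracket A C γ
    simp only [Series.bracket_apply, Series.add_apply, lie_add, Finset.sum_add_distrib]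
  lie_self A := by
    funext γ
    change Series.bracket A A γ = 0
    rw [Series.bracket_apply]
    -- Off-diagonal terms cancel in pairs by skew-symmetry, and a term fixed by the swap is a
    -- bracket of an element with itself.
    refine Finset.sum_involution (fun p _ => p.swap) ?_ ?_ ?_ ?_
    · rintro ⟨a, b⟩ _
      change ⁅A a, A b⁆ + ⁅A b, A a⁆ = 0
      rw [← lie_skew, neg_add_cancel]
    · rintro ⟨a, b⟩ _ h hab
      have : b = a := congrArg Prod.fst hab
      subst this
      exact h (lie_self _)
    · rintro ⟨a, b⟩ h
      rw [Finset.HasAntidiagonal.mem_antidiagonal] at h ⊢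
      rw [← h, add_comm]
      rfl
    · rintro ⟨a, b⟩ _
      rfl
  leibniz_lie A B C := by
    funext γ
    change Series.bracket A (Series.bracket B C) γ
      = Series.bracket (Series.bracket A B) C γ + Series.bracket B (Series.bracket A C) γ
    simp only [Series.bracket_apply, lie_sum, sum_lie]
    rw [sum_antidiagonal_assoc γ fun a b c => ⁅⁅A a, B b⁆, C c⁆,
      sum_antidiagonal_left_comm γ fun b a c => ⁅B b, ⁅A a, C c⁆⁆, ← Finset.sum_add_distrib]
    refine Finset.sum_congr rfl fun p _ => ?_
    rw [← Finset.sum_add_distrib]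
    exact Finset.sum_congr rfl fun q _ => leibniz_lie _ _ _

attribute [local instance] Series.module Series.lieRing

variable (m 𝕂 L) in
/-- Series with coefficients in `L` as a Lie algebra over the scalar series. -/
@[reducible] noncomputable def Series.lieAlgebra : LieAlgebra (Series m 𝕂) (Series m L) where
  lie_smul f A B := by
    funext γ
    change Series.bracket A (Series.mulLeft f B) γ = Series.mulLeft f (Series.bracket A B) γ
    simp only [Series.bracket_apply, Series.mulLeft_apply, lie_sum, Finset.smul_sum, lie_smul]
    rw [sum_antidiagonal_left_comm γ fun a b c => f b • ⁅A a, B c⁆]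

attribute [local instance] Series.lieAlgebra

theorem Series.smul_eq (f : Series m 𝕂) (A : Series m L) : f • A = Series.mulLeft f A := rfl

theorem Series.lie_eq (A B : Series m L) : ⁅A, B⁆ = Series.bracket A B := rfl

variable (m 𝕂 L) in
theorem Series.isScalarTower : IsScalarTower 𝕂 (Series m 𝕂) (Series m L) where
  smul_assoc a f A := by
    funext γ
    change Series.mulLeft (a • f) A γ = a • Series.mulLeft f A γ
    rw [Series.mulLeft_apply, Series.mulLeft_apply, Finset.smul_sum]
    exact Finset.sum_congr rfl fun p _ => smul_assoc a (f p.1) (A p.2)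

theorem Series.pd_scalar (k : ℕ) (i : Fin m) (f : Series m 𝕂) :
    Series.pd k i f = MvPowerSeries.pderiv 𝕂 (k, i) f := by
  ext γ
  rw [MvPowerSeries.coeff_pderiv, mul_comm, ← Nat.cast_add_one, ← nsmul_eq_mul]
  rfl

/-- The partial derivatives of power series. -/
noncomputable def Series.lieDer (k : ℕ) (i : Fin m) :
    LieDer 𝕂 (Series m 𝕂) (Series m L) where
  onR := MvPowerSeries.pderiv 𝕂 (k, i)
  onM :=
    { toFun := Series.pd k i
      map_zero' := by
        funext γ
        rw [Series.pd_apply]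
        exact smul_zero _
      map_add' := fun A B => by
        funext γ
        simp only [Series.pd_apply, Series.add_apply, smul_add] }
  smul' f A := by
    funext γ
    change Series.pd k i (Series.mulLeft f A) γ
      = Series.mulLeft (MvPowerSeries.pderiv 𝕂 (k, i) f) A γ + Series.mulLeft f (Series.pd k i A) γ
    rw [← Series.pd_scalar, Series.pd_apply, Series.mulLeft_apply,
      sum_antidiagonal_leibniz γ (k, i) fun a b => f a • A b]
    congr 1
    · refine Finset.sum_congr rfl fun p _ => ?_
      rw [← smul_assoc]
      rfl
    · refine Finset.sum_congr rfl fun p _ => ?_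
      rw [Series.pd_apply, smul_comm]
  lie' A B := by
    funext γ
    change Series.pd k i (Series.bracket A B) γ
      = Series.bracket (Series.pd k i A) B γ
        + Series.bracket A (Series.pd k i B) γ
    rw [Series.pd_apply, Series.bracket_apply,
      sum_antidiagonal_leibniz γ (k, i) fun a b => ⁅A a, B b⁆]
    congr 1
    · exact Finset.sum_congr rfl fun p _ => (nsmul_lie _ _ _).symm
    · exact Finset.sum_congr rfl fun p _ => (lie_nsmul _ _ _).symm

theorem Series.lieDer_onM (k : ℕ) (i : Fin m) (A : Series m L) :
    (Series.lieDer (𝕂 := 𝕂) k i).onM A = Series.pd k i A := rfl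

open Classical in
variable (m 𝕂 L) in
/-- The constant series. -/
noncomputable def Series.const : L →ₗ[𝕂] Series m L where
  toFun c γ := if γ = 0 then c else 0
  map_add' c d := by
    funext γ
    change (if γ = 0 then c + d else 0) = (if γ = 0 then c else 0) + (if γ = 0 then d else 0)
    by_cases h : γ = 0 <;> simp [h]
  map_smul' a c := by
    funext γ
    change (if γ = 0 then a • c else 0) = a • (if γ = 0 then c else 0)
    by_cases h : γ = 0 <;> simp [h]

theorem Series.const_apply_zero (c : L) : Series.const 𝕂 m L c 0 = c := by
  classical
  change (if (0 : JetVar m →₀ ℕ) = 0 then c else 0) = c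
  exact if_pos rfl

theorem Series.const_apply_ne {γ : JetVar m →₀ ℕ} (h : γ ≠ 0) (c : L) :
    Series.const 𝕂 m L c γ = 0 := by
  classical
  change (if γ = 0 then c else 0) = 0
  exact if_neg h

theorem Series.smul_const (f : Series m 𝕂) (c : L) :
    f • Series.const 𝕂 m L c = Series.mk f c := by
  funext γ
  rw [Series.smul_eq, Series.mulLeft_apply,
    sum_antidiagonal_ite_right γ fun a b => f a • Series.const 𝕂 m L c b]
  · rw [Series.const_apply_zero]; rfl
  · intro a b hb
    rw [Series.const_apply_ne hb, smul_zero]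

theorem Series.pd_eq_zero {l : ℕ} {A : Series m L} (hA : Series.HasOrder l A) {k : ℕ} (hk : l < k)
    (i : Fin m) : Series.pd k i A = 0 := by
  funext γ
  rw [Series.pd_apply, hA _ ⟨(k, i), by simp, hk⟩]
  exact smul_zero _

variable (L) in
/-- Formal power series at a point of the jet space. -/
noncomputable def formalModel (a : Jet 𝕂 m) (ha : delta (a 0) ≠ 0) :
    JetModel 𝕂 (Series m 𝕂) L (Series m L) m where
  u := coordSeries a
  isUnit_delta := isUnit_delta_formal a ha
  pd := Series.lieDer
  pd_u k i l j := by
    change MvPowerSeries.pderiv 𝕂 (k, i) (MvPowerSeries.C (a l j) + MvPowerSeries.X (l, j)) = _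
    rw [map_add, MvPowerSeries.pderiv_C, zero_add]
    by_cases h : k = l ∧ i = j
    · obtain ⟨rfl, rfl⟩ := h
      rw [MvPowerSeries.pderiv_X_self, if_pos ⟨rfl, rfl⟩]
    · rw [MvPowerSeries.pderiv_X_of_ne (fun e => h (by simpa [eq_comm] using e)), if_neg h]
  pd_comm k i l j A := by
    funext γ
    simp only [Series.lieDer_onM, Series.pd_apply]
    by_cases h : (k, i) = (l, j)
    · rw [h]
    · rw [smul_comm]
      simp [add_right_comm, Finsupp.single_apply, h, Ne.symm h, eq_comm]
  const := Series.const 𝕂 m L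
  const_lie x y := by
    funext γ
    rw [Series.lie_eq, Series.bracket_apply, sum_antidiagonal_ite_right γ fun a b =>
      ⁅Series.const 𝕂 m L x a, Series.const 𝕂 m L y b⁆, Series.const_apply_zero]
    · by_cases h : γ = 0
      · rw [h, Series.const_apply_zero, Series.const_apply_zero]
      · rw [Series.const_apply_ne h, Series.const_apply_ne h, zero_lie]
    · intro a b hb
      rw [Series.const_apply_ne hb, lie_zero]
  const_injective x y h := by
    rw [← Series.const_apply_zero (𝕂 := 𝕂) (m := m) x, h, Series.const_apply_zero]
  pd_const k i c := by
    funext γ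
    rw [Series.lieDer_onM, Series.pd_apply, Series.const_apply_ne (by simp)]
    exact smul_zero _
  exists_const A hA := by
    refine ⟨A 0, ?_⟩
    funext γ
    by_cases h : γ = 0
    · rw [h, Series.const_apply_zero]
    -- For q in the support of γ, the coefficient of ∂_qA at γ − e_q is γ_q A_γ, and the positive
    -- integer γ_q is invertible.
    · obtain ⟨⟨k, i⟩, hq⟩ := Finsupp.support_nonempty_iff.2 h
      have hle : Finsupp.single (k, i) 1 ≤ γ := by
        rw [Finsupp.single_le_iff]
        exact Nat.one_le_iff_ne_zero.2 (Finsupp.mem_support_iff.1 hq)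
      have h1 := congrFun (hA k i) (γ - Finsupp.single (k, i) 1)
      rw [Series.lieDer_onM, Series.pd_apply, tsub_add_cancel_of_le hle] at h1
      rw [Series.const_apply_ne h]
      have h2 : (((γ - Finsupp.single (k, i) 1 : JetVar m →₀ ℕ) (k, i) + 1 : ℕ) : 𝕂) • A γ = 0 := by
        rw [Nat.cast_smul_eq_nsmul]; exact h1
      exact ((smul_eq_zero_iff_right (Nat.cast_ne_zero.2 (Nat.succ_ne_zero _))).1 h2).symm

theorem Series.vecField_eq {V : Type*} [AddCommGroup V] [Module 𝕂 V]
    (Q : ℕ → Fin m → Series m 𝕂) {N : ℕ} {A : Series m V}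
    (hA : ∀ k, N ≤ k → ∀ i, Series.pd k i A = 0) :
    Series.vecField Q A = ∑ k ∈ Finset.range N, ∑ i, Series.mulLeft (Q k i)
      (Series.pd k i A) := by
  refine finsum_eq_sum_of_support_subset _ fun k hk => ?_
  by_contra hkN
  refine hk (Finset.sum_eq_zero fun i _ => ?_)
  rw [hA k (by simpa using hkN)]
  funext γ
  exact Finset.sum_eq_zero fun p _ => smul_zero _

theorem zero_curvature_iff_formal (hm : 2 ≤ m) (r : Fin (m + 1) → 𝕂) (a : Jet 𝕂 m)
    (ha : delta (a 0) ≠ 0) {A B : Series m L} (hA : Series.HasOrder 0 A)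
    (hB : Series.HasOrder 2 B) :
    Series.Dx a B - Series.Dt a r A + Series.bracket A B = 0 ↔
      ∃ (C0 : L) (C : Fin (m + 1) → L) (Cn1 : L), Relations r C0 C Cn1 ∧
        A = formA Series.mk (sphereCoord (coordSeries a 0)) C0 C ∧
        B = formB Series.mk Series.bracket (Series.Dx a) (Series.Dx a)
          r (sphereCoord (coordSeries a 0)) A C Cn1 := by
  have := Series.isScalarTower 𝕂 m L
  let J := formalModel L a ha
  have oA : J.Ord 0 A := fun k hk i => Series.pd_eq_zero hA hk i
  have oB : J.Ord 2 B := fun k hk i => Series.pd_eq_zero hB hk i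
  have hDx : ∀ {x : Series m L}, J.Ord 2 x → Series.Dx a x = J.D.onM x := fun {x} hx => by
    rw [Series.Dx, Series.vecField_eq _ (N := 3) (fun k hk i => hx k hk i), JetModel.D,
      JetModel.field_onM]
    rfl
  have hDt : Series.Dt a r A = J.d1 A (rhs r J.u) := by
    rw [Series.Dt, Series.vecField_eq _ (N := 1) (fun k hk i => oA k hk i), JetModel.d1_apply,
      Finset.sum_range_one]
    rfl
  have hmk : (Series.mk : Series m 𝕂 → L → _) = fun f c => f • J.const c := by
    funext f c
    exact (Series.smul_const f c).symm
  have hdR : ∀ i, Series.Dx a (sphereCoord (coordSeries a 0) i) = J.D.onR (J.s i) := fun i => by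
    change Series.Dx a (J.s i) = _
    rw [Series.Dx, Series.vecField_eq _ (N := 3) (fun k hk j => (Series.pd_scalar k j _).trans
      (J.onR_s_eq_zero (J.pd_vec_u_ne (by omega) j) i)), JetModel.D, JetModel.field_onR]
    simp only [Series.mulLeft_scalar, Series.pd_scalar]
    rfl
  rw [hDx oB, hDt, hmk]
  refine (J.zero_curvature_iff_form hm oA oB).trans ?_
  simp only [formB, hdR, hDx (oA.mono (by omega)), hDx ((JetModel.Ord.D oA).mono (by omega))]
  rfl

end FormalModel

end LandauLifshitz

open LandauLifshitz in
/-- Here `n = m + 1 ≥ 3`. -/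
theorem theorem3p6 {𝕂 : Type*} [RCLike 𝕂] {L : Type*} [LieRing L] [LieAlgebra 𝕂 L]
    (m : ℕ) (hn : 3 ≤ m + 1) (r : Fin (m + 1) → 𝕂) (hr : Function.Injective r) :
    -- smooth functions on a connected open subset of the jet space
    (∀ U : TopologicalSpace.Opens (Jet 𝕂 m), IsConnected (U : Set (Jet 𝕂 m)) →
      (∀ p ∈ U, delta (p 0) ≠ 0) →
      ∀ A ∈ lieFunOfOrder L (U : Set (Jet 𝕂 m)) 0, ∀ B ∈ lieFunOfOrder L (U : Set (Jet 𝕂 m)) 2,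
        ((Dx U).rTensor L B - (Dt U r).rTensor L A + ⁅A, B⁆ = 0 ↔
          ∃ (C0 : L) (C : Fin (m + 1) → L) (Cn1 : L), Relations r C0 C Cn1 ∧
            A = formA (fun f c => f ⊗ₜ[𝕂] c)
              (sphereCoord (coordFun (U : Set (Jet 𝕂 m)) 0)) C0 C ∧
            B = formB (fun f c => f ⊗ₜ[𝕂] c) (fun X Y => ⁅X, Y⁆) (Dx U) ((Dx U).rTensor L)
              r (sphereCoord (coordFun (U : Set (Jet 𝕂 m)) 0)) A C Cn1)) ∧
    -- formal power series at a point of the jet space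
    (∀ a : Jet 𝕂 m, delta (a 0) ≠ 0 →
      ∀ A B : Series m L, Series.HasOrder 0 A → Series.HasOrder 2 B →
        (Series.Dx a B - Series.Dt a r A + Series.bracket A B = 0 ↔
          ∃ (C0 : L) (C : Fin (m + 1) → L) (Cn1 : L), Relations r C0 C Cn1 ∧
            A = formA Series.mk (sphereCoord (coordSeries a 0)) C0 C ∧
            B = formB Series.mk Series.bracket (Series.Dx a) (Series.Dx a)
              r (sphereCoord (coordSeries a 0)) A C Cn1)) := by
  refine ⟨fun U hU hδ A hA B hB => ?_, fun a ha A B hA hB => ?_⟩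
  · exact zero_curvature_iff_smooth (by omega) r hU hδ hA hB
  · exact zero_curvature_iff_formal (by omega) r a ha hA hB
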